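/- For $\nu\in\mathbb{R}$ let $\mathcal{S}_\nu$ be the Hilbert space of analytic functions $f(z)=\sum_{n\ge 0}a_nz^n$ on the open unit disk $\mathbb{D}$ with $\|f\|_\nu^2=\sum_{n\ge 0}|a_n|^2(n+1)^{2\nu}<\infty$; the Dirichlet space is $\mathcal{S}_{1/2}$. A bounded linear operator $T$ on a Hilbert space $\mathcal{H}$ is called recurrent if for every non-empty open set $U\subset\mathcal{H}$ there is an integer $n\ge 1$ with $T^n(U)\cap U\neq\emptyset$. A linear fractional map $\phi(z)=\frac{az+b}{cz+d}$ ($a,b,c,d\in\mathbb{C}$, $ad-bc\ne0$) of the Riemann sphere is called hyperbolic if it is conjugate, by a linear fractional map, to a dilation $w\mapsto\mu w$ with $\mu>0$, $\mu\neq1$. **Theorem.** Let $\phi$ be a hyperbolic linear fractional map with $\phi(\mathbb{D})\subset\mathbb{D}$ which is not an automorphism of $\mathbb{D}$ and has no fixed point in $\mathbb{D}$, and let $\eta$, $|\eta|=1$, be its fixed point on the unit circle. Let $\nu\in\mathbb{R}$ and $\lambda\in\mathbb{C}$. Then $\phi'(\eta)$ is a positive real number, $f\mapsto\lambda C_\phi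 f=\lambda\,(f\circ\phi)$ is a bounded operator on $\mathcal{S}_\nu$, and $\lambda C_\phi$ is recurrent on $\mathcal{S}_\nu$ if and only if $$\nu\le\tfrac12\quad\text{and}\quad|\lambda|>\phi'(\eta)^{(1-2\nu)/2}.$$ In particular, on the Dirichlet space ($\nu=1/2$) the operator $\lambda C_\phi$ is recurrent if and only if $|\lambda|>1$. -/

import Mathlib

open Complex Topology
open scoped Complex.UnitDisc

noncomputable section

/-- `f : 𝔻 → ℂ` is the sum on `𝔻` of the power series with coefficients `a`; equivalently, `f` is
analytic on `𝔻` and `a` is the sequence of its Taylor coefficients at the origin. -/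
def HasTaylorSeries (f : 𝔻 → ℂ) (a : ℕ → ℂ) : Prop :=
  ∀ z : 𝔻, HasSum (fun n => a n * (z : ℂ) ^ n) (f z)

theorem HasTaylorSeries.unique {f : 𝔻 → ℂ} {a b : ℕ → ℂ} (ha : HasTaylorSeries f a)
    (hb : HasTaylorSeries f b) : a = b := by
  have key : HasFPowerSeriesAt (fun _ : ℂ => (0 : ℂ))
      (FormalMultilinearSeries.ofScalars ℂ (fun n => a n - b n)) 0 := by
    rw [hasFPowerSeriesAt_iff]
    filter_upwards [Metric.ball_mem_nhds (0 : ℂ) one_pos] with z hz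
    obtain ⟨w, rfl⟩ : ∃ w : 𝔻, (w : ℂ) = z := ⟨⟨z, hz⟩, rfl⟩
    have h := (ha w).sub (hb w)
    rw [sub_self] at h
    refine h.congr_fun fun n => ?_
    rw [FormalMultilinearSeries.coeff_ofScalars, smul_eq_mul]
    ring
  funext n
  have h1 := congrArg (fun p => FormalMultilinearSeries.coeff p n) key.eq_zero
  simp only [FormalMultilinearSeries.coeff_ofScalars] at h1
  exact sub_eq_zero.1 h1

/-- Square summability of a coefficient sequence against the weights `(n + 1) ^ (2 ν)`. -/
def WeightedSummable (ν : ℝ) (a : ℕ → ℂ) : Prop :=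
  Summable fun n : ℕ => ‖a n‖ ^ 2 * ((n : ℝ) + 1) ^ (2 * ν)

theorem WeightedSummable.inner {ν : ℝ} {a b : ℕ → ℂ} (ha : WeightedSummable ν a)
    (hb : WeightedSummable ν b) :
    Summable fun n : ℕ => starRingEnd ℂ (a n) * b n * ((((n : ℝ) + 1) ^ (2 * ν) : ℝ) : ℂ) := by
  refine Summable.of_norm_bounded (ha.add hb) fun n => ?_
  have hw : (0 : ℝ) ≤ ((n : ℝ) + 1) ^ (2 * ν) := by positivity
  rw [norm_mul, norm_mul, Complex.norm_real, Real.norm_of_nonneg hw, RCLike.norm_conj, ← add_mul]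
  refine mul_le_mul_of_nonneg_right ?_ hw
  nlinarith [sq_nonneg (‖a n‖ - ‖b n‖), norm_nonneg (a n), norm_nonneg (b n)]

theorem WeightedSummable.add {ν : ℝ} {a b : ℕ → ℂ} (ha : WeightedSummable ν a)
    (hb : WeightedSummable ν b) : WeightedSummable ν (a + b) := by
  refine Summable.of_nonneg_of_le (fun n => by positivity) (fun n => ?_)
    ((Summable.add ha hb).mul_left 2)
  have hw : (0 : ℝ) ≤ ((n : ℝ) + 1) ^ (2 * ν) := by positivity
  rw [← add_mul, ← mul_assoc]
  refine mul_le_mul_of_nonneg_right ?_ hw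
  have h := norm_add_le (a n) (b n)
  have h' := norm_nonneg (a n + b n)
  simp only [Pi.add_apply]
  nlinarith [sq_nonneg (‖a n‖ - ‖b n‖)]

theorem WeightedSummable.smul {ν : ℝ} {a : ℕ → ℂ} (c : ℂ) (ha : WeightedSummable ν a) :
    WeightedSummable ν (c • a) := by
  refine (Summable.mul_left (‖c‖ ^ 2) ha).congr fun n => ?_
  simp only [Pi.smul_apply, smul_eq_mul, norm_mul]
  ring

theorem HasTaylorSeries.add {f g : 𝔻 → ℂ} {a b : ℕ → ℂ} (ha : HasTaylorSeries f a)
    (hb : HasTaylorSeries g b) : HasTaylorSeries (f + g) (a + b) := fun z => by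
  simpa [add_mul] using (ha z).add (hb z)

theorem HasTaylorSeries.smul {f : 𝔻 → ℂ} {a : ℕ → ℂ} (c : ℂ) (ha : HasTaylorSeries f a) :
    HasTaylorSeries (c • f) (c • a) := fun z => by
  simpa [mul_assoc] using (ha z).mul_left c

/-- The vector space underlying the weighted Dirichlet space: the functions `∑ aₙ zⁿ` analytic on
`𝔻` with `∑ |aₙ|² (n + 1) ^ (2 ν) < ∞`. -/
def weightedDirichletSubmodule (ν : ℝ) : Submodule ℂ (𝔻 → ℂ) where
  carrier := {f | ∃ a : ℕ → ℂ, HasTaylorSeries f a ∧ WeightedSummable ν a}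
  zero_mem' := ⟨0, fun z => by simp, by simp [WeightedSummable, summable_zero]⟩
  add_mem' := by
    rintro f g ⟨a, ha, ha'⟩ ⟨b, hb, hb'⟩
    exact ⟨a + b, ha.add hb, ha'.add hb'⟩
  smul_mem' := by
    rintro c f ⟨a, ha, ha'⟩
    exact ⟨c • a, ha.smul c, ha'.smul c⟩

/-- The weighted Dirichlet space `S_ν`. It is a separate type, so that its topology is the one of
its Hilbert space norm (defined below) and not that of pointwise convergence. -/
def WeightedDirichlet (ν : ℝ) : Type := weightedDirichletSubmodule ν

namespace WeightedDirichlet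

variable {ν : ℝ}

instance : AddCommGroup (WeightedDirichlet ν) :=
  inferInstanceAs (AddCommGroup (weightedDirichletSubmodule ν))

instance : Module ℂ (WeightedDirichlet ν) :=
  inferInstanceAs (Module ℂ (weightedDirichletSubmodule ν))

instance : CoeFun (WeightedDirichlet ν) (fun _ => 𝔻 → ℂ) := ⟨fun f => f.1⟩

/-- The Taylor coefficients at the origin of an element of `S_ν`. -/
def coeff (f : WeightedDirichlet ν) : ℕ → ℂ := f.2.choose

theorem hasTaylorSeries_coeff (f : WeightedDirichlet ν) : HasTaylorSeries f f.coeff :=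
  f.2.choose_spec.1

theorem weightedSummable_coeff (f : WeightedDirichlet ν) : WeightedSummable ν f.coeff :=
  f.2.choose_spec.2

theorem coeff_add (f g : WeightedDirichlet ν) : (f + g).coeff = f.coeff + g.coeff :=
  (hasTaylorSeries_coeff (f + g)).unique ((hasTaylorSeries_coeff f).add (hasTaylorSeries_coeff g))

theorem coeff_smul (c : ℂ) (f : WeightedDirichlet ν) : (c • f).coeff = c • f.coeff :=
  (hasTaylorSeries_coeff (c • f)).unique ((hasTaylorSeries_coeff f).smul c)

theorem eq_zero_of_coeff (f : WeightedDirichlet ν) (h : f.coeff = 0) : f = 0 := by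
  refine Subtype.ext (funext fun z => ?_)
  have h1 := hasTaylorSeries_coeff f z
  simp only [h, Pi.zero_apply, zero_mul] at h1
  exact h1.unique hasSum_zero

/-- The inner product `∑ conj(aₙ) bₙ (n + 1) ^ (2 ν)` of `S_ν` (linear in the second variable, as
is the convention for inner products here). -/
instance : Inner ℂ (WeightedDirichlet ν) where
  inner f g := ∑' n : ℕ,
    starRingEnd ℂ (f.coeff n) * g.coeff n * ((((n : ℝ) + 1) ^ (2 * ν) : ℝ) : ℂ)

theorem inner_def (f g : WeightedDirichlet ν) : inner ℂ f g = ∑' n : ℕ,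
    starRingEnd ℂ (f.coeff n) * g.coeff n * ((((n : ℝ) + 1) ^ (2 * ν) : ℝ) : ℂ) := rfl

theorem inner_self_eq (f : WeightedDirichlet ν) : inner ℂ f f =
    ((∑' n : ℕ, ‖f.coeff n‖ ^ 2 * ((n : ℝ) + 1) ^ (2 * ν) : ℝ) : ℂ) := by
  rw [inner_def, Complex.ofReal_tsum]
  refine tsum_congr fun n => ?_
  rw [Complex.conj_mul']
  push_cast
  ring

/-- The inner product space axioms for `S_ν`. -/
@[reducible] def core (ν : ℝ) : InnerProductSpace.Core ℂ (WeightedDirichlet ν) where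
  toInner := inferInstance
  conj_inner_symm f g := by
    rw [inner_def, inner_def, Complex.conj_tsum]
    refine tsum_congr fun n => ?_
    simp only [map_mul, Complex.conj_conj, Complex.conj_ofReal]
    ring
  re_inner_nonneg f := by
    rw [inner_self_eq]
    simp only [RCLike.re_to_complex, Complex.ofReal_re]
    exact tsum_nonneg fun n => by positivity
  add_left f g h := by
    have hf := (weightedSummable_coeff f).inner (weightedSummable_coeff h)
    have hg := (weightedSummable_coeff g).inner (weightedSummable_coeff h)
    rw [inner_def, inner_def, inner_def, ← hf.tsum_add hg]
    refine tsum_congr fun n => ?_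
    rw [coeff_add]
    simp only [Pi.add_apply, map_add]
    ring
  smul_left f g c := by
    rw [inner_def, inner_def, ← tsum_mul_left]
    refine tsum_congr fun n => ?_
    rw [coeff_smul]
    simp only [Pi.smul_apply, smul_eq_mul, map_mul]
    ring
  definite f hf := by
    rw [inner_self_eq] at hf
    have hs : (∑' n : ℕ, ‖f.coeff n‖ ^ 2 * ((n : ℝ) + 1) ^ (2 * ν)) = 0 := by
      exact_mod_cast hf
    have h0 := (hasSum_zero_iff_of_nonneg (fun n => by positivity)).1
      (hs ▸ (weightedSummable_coeff f).hasSum)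
    refine eq_zero_of_coeff f (funext fun n => ?_)
    have hn := congrFun h0 n
    have hw : ((n : ℝ) + 1) ^ (2 * ν) ≠ 0 := (by positivity : (0 : ℝ) < _).ne'
    simpa [hw] using hn

instance : NormedAddCommGroup (WeightedDirichlet ν) := (core ν).toNormedAddCommGroup

instance : InnerProductSpace ℂ (WeightedDirichlet ν) := .ofCore (core ν).toCore

/-- The norm of `S_ν` is given by `‖f‖² = ∑ |aₙ|² (n + 1) ^ (2 ν)`. -/
theorem norm_sq_eq (f : WeightedDirichlet ν) :
    ‖f‖ ^ 2 = ∑' n : ℕ, ‖f.coeff n‖ ^ 2 * ((n : ℝ) + 1) ^ (2 * ν) := by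
  have h : inner ℂ f f = ((‖f‖ : ℂ)) ^ 2 := inner_self_eq_norm_sq_to_K f
  have h' := h.symm.trans (inner_self_eq f)
  exact_mod_cast h'

end WeightedDirichlet

/-- A bounded operator `T` is recurrent if every non-empty open set `U` meets `Tⁿ(U)` for some
positive integer `n`. -/
def IsRecurrent {H : Type*} [NormedAddCommGroup H] [NormedSpace ℂ H] (T : H →L[ℂ] H) : Prop :=
  ∀ U : Set H, IsOpen U → U.Nonempty → ∃ n : ℕ, 0 < n ∧ ((fun f => (T ^ n) f) '' U ∩ U).Nonempty

/-- The linear fractional map `z ↦ (a z + b) / (c z + d)`, as a function on the finite plane. -/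
def linearFractional (g : GL (Fin 2) ℂ) (z : ℂ) : ℂ :=
  (g 0 0 * z + g 0 1) / (g 1 0 * z + g 1 1)

/-- The linear fractional map of `g`, acting on the Riemann sphere `OnePoint ℂ` by
`z ↦ (a z + b) / (c z + d)`, is hyperbolic: it is conjugate, by a linear fractional map `S`, to a
dilation `w ↦ μ w` (fixing `∞`) with `μ > 0` and `μ ≠ 1`. In particular it has exactly two fixed
points. -/
def IsHyperbolicLFT (g : GL (Fin 2) ℂ) : Prop :=
  ∃ (S : GL (Fin 2) ℂ) (μ : ℝ), 0 < μ ∧ μ ≠ 1 ∧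
    ∀ z : OnePoint ℂ, S • g • z = OnePoint.map (fun w : ℂ => (μ : ℂ) * w) (S • z)

end

/-! After a rotation η = 1, and the coordinate ψ(z) = (1 - z)/(1 - qz), whose pole 1/q is the other
fixed point, turns φ into multiplication by μ = φ'(1). The absence of fixed points in the disc gives
|q| ≤ 1; a self-map that is not an automorphism has |q| < 1 and μ < 1. In the half-plane coordinate
W = 1/(1 - z), Re W > 1/2, the map is W ↦ W/μ + (1/μ - 1)q/(1 - q).

Boundedness. For ν = 0 an algebraic identity between the numerator and the denominator of φ bounds
C_φ on polynomials, by induction on the degree (`sum_normSq_comp_le`). Differentiation carries the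
result from ν to ν + 1. The matrix of the weighted operator f ↦ (cz + d)⁻¹ f∘φ is, up to
transposition and a scalar, the matrix of another map of the same kind (`compMatrix_transpose`),
which gives the negative integers by duality. The three lines argument fills in all real ν
(`FormBound.interpolate`).

Sufficiency. The function ψ^s lies in S_ν when Re s > ν - 1/2 and is an eigenvector of λC_φ with
eigenvalue λμ^s. If |λ| > μ^((1 - 2ν)/2), the exponents at which this eigenvalue is a root of unity
accumulate inside that half-plane. For x orthogonal to all periodic vectors, the holomorphic
function s ↦ ⟨x, ψ^s⟩ therefore vanishes, in particular at s = 1, 2, 3, .... When ν ≤ 1/2 this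
forces x = 0: the only candidate is a multiple of evaluation at 1, which is unbounded on S_ν
(`eq_zero_of_inner_pow_eq_zero`). So periodic vectors are dense.

Necessity. Let D f = f(0) - f(1/2). Two orbits approach 1 nontangentially, at distance O(μ^n) from
each other, so the oscillation estimate makes the functionals D∘T^n uniformly bounded when |λ| ≤
μ^((1 - 2ν)/2), whereas D(T^n ψ) = (λμ)^n D(ψ) stays away from D(ψ); hence no return near ψ. For ν >
1/2 and |λ| ≤ 1 the same estimate with exponent 1/2 applies. For ν > 1/2 and |λ| > 1, point
evaluations are uniformly bounded and nothing returns near the constant 1. -/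

noncomputable section

/-! ### Taylor series, shifts and weights -/

theorem HasTaylorSeries.differentiableOn_tsum {f : 𝔻 → ℂ} {a : ℕ → ℂ} (h : HasTaylorSeries f a) :
    DifferentiableOn ℂ (fun z : ℂ => ∑' n, a n * z ^ n) (Metric.ball 0 1) := by
  have hs : ∀ z : ℂ, ‖z‖ < 1 → HasSum (fun n => a n * z ^ n) (∑' n, a n * z ^ n) := fun z hz =>
    (h ⟨z, by simpa using hz⟩).summable.hasSum
  have hp : HasFPowerSeriesOnBall (fun z : ℂ => ∑' n, a n * z ^ n)
      (FormalMultilinearSeries.ofScalars ℂ a) 0 1 := by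
    refine ⟨?_, one_pos, fun {y} hy => ?_⟩
    · refine ENNReal.le_of_forall_nnreal_lt fun r hr => ?_
      refine FormalMultilinearSeries.le_radius_of_tendsto (l := 0) _ ?_
      have h1 := (hs (r : ℂ) (by simpa using hr)).summable.tendsto_atTop_zero.norm
      simpa [FormalMultilinearSeries.ofScalars_norm] using h1
    · have hy' : ‖y‖ < 1 := by
        rw [← ENNReal.ofReal_one, Metric.eball_ofReal] at hy
        simpa using hy
      simpa [FormalMultilinearSeries.ofScalars_apply_eq, mul_comm] using hs y hy'
  have := hp.differentiableOn
  rwa [← ENNReal.ofReal_one, Metric.eball_ofReal] at this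

theorem HasTaylorSeries.exists_differentiableOn {f : 𝔻 → ℂ} {a : ℕ → ℂ}
    (h : HasTaylorSeries f a) :
    ∃ F : ℂ → ℂ, DifferentiableOn ℂ F (Metric.ball 0 1) ∧ ∀ z : 𝔻, F z = f z :=
  ⟨_, h.differentiableOn_tsum, fun z => (h z).tsum_eq⟩

theorem hasTaylorSeries_of_differentiableOn {F : ℂ → ℂ}
    (hF : DifferentiableOn ℂ F (Metric.ball 0 1)) :
    HasTaylorSeries (fun z => F z) (fun n => (n.factorial : ℂ)⁻¹ * iteratedDeriv n F 0) :=
  fun z => by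
    have := hasSum_taylorSeries_on_ball hF (z := z) (by simpa using z.norm_lt_one)
    refine this.congr_fun fun n => ?_
    simp only [sub_zero, smul_eq_mul]
    ring

theorem HasTaylorSeries.deriv {F : ℂ → ℂ} (hF : DifferentiableOn ℂ F (Metric.ball 0 1))
    {a : ℕ → ℂ} (h : HasTaylorSeries (fun z => F z) a) :
    HasTaylorSeries (fun z => deriv F z) (fun n => ((n : ℂ) + 1) * a (n + 1)) := by
  rw [h.unique (hasTaylorSeries_of_differentiableOn hF)]
  convert hasTaylorSeries_of_differentiableOn (hF.deriv Metric.isOpen_ball) using 2 with n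
  simp only [iteratedDeriv_succ', Nat.factorial_succ]
  push_cast
  have : (n : ℂ) + 1 ≠ 0 := Nat.cast_add_one_ne_zero n
  field_simp

/-- The shifted sequence, the Taylor coefficients of `z ^ k f`. -/
def shiftCoeff (k : ℕ) (a : ℕ → ℂ) (n : ℕ) : ℂ := if k ≤ n then a (n - k) else 0

theorem shiftCoeff_add (k : ℕ) (a : ℕ → ℂ) (n : ℕ) : shiftCoeff k a (n + k) = a n := by
  simp [shiftCoeff]

theorem shiftCoeff_of_notMem_range {k : ℕ} (a : ℕ → ℂ) {n : ℕ}
    (hn : n ∉ Set.range fun n => n + k) : shiftCoeff k a n = 0 := by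
  refine if_neg fun h => hn ⟨n - k, by simp; omega⟩

theorem HasTaylorSeries.shift {f : 𝔻 → ℂ} {a : ℕ → ℂ} (h : HasTaylorSeries f a) (k : ℕ) :
    HasTaylorSeries (fun z => (z : ℂ) ^ k * f z) (shiftCoeff k a) := fun z => by
  rw [← (add_left_injective k).hasSum_iff]
  · refine ((h z).mul_left ((z : ℂ) ^ k)).congr_fun fun n => ?_
    simp only [Function.comp, shiftCoeff_add]
    ring
  · intro n hn
    simp [shiftCoeff_of_notMem_range a hn]

theorem rpow_natCast_add_one_sq (t : ℝ) (n : ℕ) :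
    (((n : ℝ) + 1) ^ t) ^ 2 = ((n : ℝ) + 1) ^ (2 * t) := by
  rw [mul_comm, Real.rpow_mul (by positivity), Real.rpow_two]

/-- For t ≥ 0 this comes from n + k + 1 ≤ (n + 1)(k + 1). The cost of a shift is only polynomial in
k, so any geometric factor beats it. -/
theorem rpow_shift_le (t : ℝ) (k n : ℕ) :
    (((n + k : ℕ) : ℝ) + 1) ^ t ≤ ((k : ℝ) + 1) ^ |t| * ((n : ℝ) + 1) ^ t := by
  have hn : (0 : ℝ) < (n : ℝ) + 1 := by positivity
  have hk : (1 : ℝ) ≤ (k : ℝ) + 1 := by simp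
  rcases le_total 0 t with ht | ht
  · rw [abs_of_nonneg ht, ← Real.mul_rpow (by positivity) hn.le]
    refine Real.rpow_le_rpow (by positivity) ?_ ht
    push_cast
    nlinarith [Nat.cast_nonneg (α := ℝ) n, Nat.cast_nonneg (α := ℝ) k,
      mul_nonneg (Nat.cast_nonneg (α := ℝ) n) (Nat.cast_nonneg (α := ℝ) k)]
  · calc _ ≤ ((n : ℝ) + 1) ^ t :=
          Real.rpow_le_rpow_of_nonpos hn (by push_cast; linarith) ht
      _ ≤ _ := le_mul_of_one_le_left (by positivity) (Real.one_le_rpow hk (abs_nonneg t))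

theorem rpow_le_shift (t : ℝ) (k n : ℕ) :
    ((n : ℝ) + 1) ^ t ≤ ((k : ℝ) + 1) ^ |t| * (((n + k : ℕ) : ℝ) + 1) ^ t := by
  have h := rpow_shift_le (-t) k n
  rw [abs_neg, Real.rpow_neg (by positivity), Real.rpow_neg (by positivity)] at h
  have h1 : (0 : ℝ) < (((n + k : ℕ) : ℝ) + 1) ^ t := by positivity
  have h2 : (0 : ℝ) < ((n : ℝ) + 1) ^ t := by positivity
  rw [inv_le_iff_one_le_mul₀ h1] at h
  calc _ = ((n : ℝ) + 1) ^ t * 1 := (mul_one _).symm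
    _ ≤ ((n : ℝ) + 1) ^ t * (((k : ℝ) + 1) ^ |t| * (((n : ℝ) + 1) ^ t)⁻¹ *
        (((n + k : ℕ) : ℝ) + 1) ^ t) := by
      refine mul_le_mul_of_nonneg_left ?_ h2.le
      linarith
    _ = _ := by field_simp

theorem summable_rpow_mul_geometric (t : ℝ) {r : ℝ} (hr0 : 0 ≤ r) (hr1 : r < 1) :
    Summable fun k : ℕ => ((k : ℝ) + 1) ^ t * r ^ k := by
  obtain ⟨N, hN⟩ := exists_nat_ge t
  rcases hr0.eq_or_lt with rfl | hr
  · refine summable_of_ne_finset_zero (s := {0}) fun k hk => ?_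
    simp [zero_pow (by simpa using hk)]
  have h : Summable fun k : ℕ => ((k : ℝ)) ^ N * r ^ k :=
    summable_pow_mul_geometric_of_norm_lt_one N (by rwa [Real.norm_of_nonneg hr0])
  have h' := ((summable_nat_add_iff 1).2 h).mul_left r⁻¹
  refine Summable.of_nonneg_of_le (fun k => by positivity) (fun k => ?_) h'
  have : r⁻¹ * (((k + 1 : ℕ) : ℝ) ^ N * r ^ (k + 1)) = ((k : ℝ) + 1) ^ N * r ^ k := by
    push_cast
    rw [pow_succ]
    field_simp
  rw [this]
  refine mul_le_mul_of_nonneg_right ?_ (by positivity)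
  rw [← Real.rpow_natCast]
  exact Real.rpow_le_rpow_of_exponent_le (by simp) hN

theorem WeightedSummable.shift {ν : ℝ} {a : ℕ → ℂ} (h : WeightedSummable ν a) (k : ℕ) :
    WeightedSummable ν (shiftCoeff k a) ∧
      ∑' n, ‖shiftCoeff k a n‖ ^ 2 * ((n : ℝ) + 1) ^ (2 * ν) ≤
        ((k : ℝ) + 1) ^ |2 * ν| * ∑' n, ‖a n‖ ^ 2 * ((n : ℝ) + 1) ^ (2 * ν) := by
  have hz : ∀ n ∉ Set.range fun n => n + k,
      ‖shiftCoeff k a n‖ ^ 2 * ((n : ℝ) + 1) ^ (2 * ν) = 0 := fun n hn => by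
    simp [shiftCoeff_of_notMem_range a hn]
  have hle : ∀ n : ℕ, ‖a n‖ ^ 2 * (((n + k : ℕ) : ℝ) + 1) ^ (2 * ν) ≤
      ((k : ℝ) + 1) ^ |2 * ν| * (‖a n‖ ^ 2 * ((n : ℝ) + 1) ^ (2 * ν)) := fun n => by
    have := mul_le_mul_of_nonneg_left (rpow_shift_le (2 * ν) k n) (sq_nonneg ‖a n‖)
    linarith
  have hs : Summable fun n : ℕ => ‖a n‖ ^ 2 * (((n + k : ℕ) : ℝ) + 1) ^ (2 * ν) :=
    Summable.of_nonneg_of_le (fun n => by positivity) hle (Summable.mul_left _ h)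
  have hs' : HasSum (fun n => ‖shiftCoeff k a n‖ ^ 2 * ((n : ℝ) + 1) ^ (2 * ν))
      (∑' n : ℕ, ‖a n‖ ^ 2 * (((n + k : ℕ) : ℝ) + 1) ^ (2 * ν)) := by
    rw [← (add_left_injective k).hasSum_iff hz]
    refine hs.hasSum.congr_fun fun n => ?_
    simp only [Function.comp, shiftCoeff_add]
  refine ⟨hs'.summable, ?_⟩
  rw [hs'.tsum_eq, ← tsum_mul_left]
  exact hs.tsum_le_tsum hle (Summable.mul_left _ h)

/-- The series with coefficients in a weighted `ℓ²` space converges in the disc. -/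
theorem WeightedSummable.hasTaylorSeries {ν : ℝ} {a : ℕ → ℂ} (h : WeightedSummable ν a) :
    HasTaylorSeries (fun z : 𝔻 => ∑' n, a n * (z : ℂ) ^ n) a := fun z => by
  -- The majorant is the weighted inequality xy ≤ x² + y² with x = |aₙ|(n + 1)^ν and y = (n +
  -- 1)^(-ν)|z|ⁿ.
  refine Summable.hasSum (Summable.of_norm_bounded
    (g := fun n => ‖a n‖ ^ 2 * ((n : ℝ) + 1) ^ (2 * ν) +
      ((n : ℝ) + 1) ^ (-(2 * ν)) * (‖(z : ℂ)‖ ^ 2) ^ n)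
    (Summable.add h (summable_rpow_mul_geometric _ (by positivity) z.sq_norm_lt_one)) fun n => ?_)
  have hw : (0 : ℝ) < ((n : ℝ) + 1) ^ ν := by positivity
  rw [Real.rpow_neg (by positivity), ← rpow_natCast_add_one_sq, norm_mul, norm_pow, ← pow_mul, mul_comm 2 n, pow_mul]
  have := sq_nonneg (‖a n‖ * ((n : ℝ) + 1) ^ ν - (((n : ℝ) + 1) ^ ν)⁻¹ * ‖(z : ℂ)‖ ^ n)
  have h2 : ‖a n‖ * ((n : ℝ) + 1) ^ ν * ((((n : ℝ) + 1) ^ ν)⁻¹ * ‖(z : ℂ)‖ ^ n) =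
    ‖a n‖ * ‖(z : ℂ)‖ ^ n := by field_simp
  have h3 : 0 ≤ ‖a n‖ * ‖(z : ℂ)‖ ^ n := by positivity
  rw [← inv_pow]
  nlinarith

/-! ### S_ν as a Hilbert space: duality, evaluations, rational multipliers -/

namespace WeightedDirichlet

variable {ν : ℝ}

/-- A function which belongs to `S_ν`, as an element of `S_ν`. -/
def ofMem (f : 𝔻 → ℂ) (h : f ∈ weightedDirichletSubmodule ν) : WeightedDirichlet ν := ⟨f, h⟩

@[ext] theorem ext {f g : WeightedDirichlet ν} (h : ∀ z, f z = g z) : f = g :=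
  Subtype.ext (funext h)

theorem mem_iff {f : 𝔻 → ℂ} : f ∈ weightedDirichletSubmodule ν ↔
    ∃ a : ℕ → ℂ, HasTaylorSeries f a ∧ WeightedSummable ν a := Iff.rfl

theorem coeff_eq (f : WeightedDirichlet ν) {a : ℕ → ℂ} (h : HasTaylorSeries f a) :
    f.coeff = a := f.hasTaylorSeries_coeff.unique h

theorem add_apply (f g : WeightedDirichlet ν) (z : 𝔻) : (f + g) z = f z + g z := rfl

theorem sub_apply (f g : WeightedDirichlet ν) (z : 𝔻) : (f - g) z = f z - g z := rfl

theorem smul_apply (c : ℂ) (f : WeightedDirichlet ν) (z : 𝔻) : (c • f) z = c * f z := rfl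

/-- The element of `S_ν` with given Taylor coefficients. -/
def ofCoeff (a : ℕ → ℂ) (h : WeightedSummable ν a) : WeightedDirichlet ν :=
  ⟨_, a, h.hasTaylorSeries, h⟩

theorem coeff_ofCoeff (a : ℕ → ℂ) (h : WeightedSummable ν a) : (ofCoeff a h).coeff = a :=
  coeff_eq _ h.hasTaylorSeries

theorem sum_range_le_norm_sq (f : WeightedDirichlet ν) (N : ℕ) :
    ∑ n ∈ Finset.range N, ‖f.coeff n‖ ^ 2 * ((n : ℝ) + 1) ^ (2 * ν) ≤ ‖f‖ ^ 2 := by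
  rw [norm_sq_eq]
  exact Summable.sum_le_tsum _ (fun n _ => by positivity) f.weightedSummable_coeff

/-- The coefficient map as an isometry onto `ℓ²`. -/
def toLp (ν : ℝ) : WeightedDirichlet ν →ₗᵢ[ℂ] lp (fun _ : ℕ => ℂ) 2 where
  toFun f := ⟨fun n => ((((n : ℝ) + 1) ^ ν : ℝ) : ℂ) * f.coeff n, by
    refine memℓp_gen (f.weightedSummable_coeff.congr fun n => ?_)
    simp only [norm_mul, norm_real, ENNReal.toReal_ofNat, Real.rpow_two, mul_pow]
    rw [Real.norm_of_nonneg (by positivity), rpow_natCast_add_one_sq, mul_comm]⟩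
  map_add' f g := by
    ext n
    simp only [coeff_add, Pi.add_apply, mul_add]
    rfl
  map_smul' c f := by
    ext n
    simp [coeff_smul, mul_left_comm]
  norm_map' f := by
    have h := lp.norm_rpow_eq_tsum (p := 2) (by simp)
      (⟨fun n => ((((n : ℝ) + 1) ^ ν : ℝ) : ℂ) * f.coeff n, by
        refine memℓp_gen (f.weightedSummable_coeff.congr fun n => ?_)
        simp only [norm_mul, norm_real, ENNReal.toReal_ofNat, Real.rpow_two, mul_pow]
        rw [Real.norm_of_nonneg (by positivity), rpow_natCast_add_one_sq, mul_comm]⟩ : lp (fun _ : ℕ => ℂ) 2)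
    simp only [ENNReal.toReal_ofNat, Real.rpow_two] at h
    refine (pow_left_inj₀ (norm_nonneg _) (norm_nonneg _) two_ne_zero).1 (h.trans ?_)
    rw [norm_sq_eq]
    refine tsum_congr fun n => ?_
    rw [norm_mul, norm_real, Real.norm_of_nonneg (by positivity), mul_pow,
      rpow_natCast_add_one_sq, mul_comm]

theorem toLp_surjective (ν : ℝ) : Function.Surjective (toLp ν) := fun b => by
  have hw : ∀ n : ℕ, ((n : ℝ) + 1) ^ ν ≠ 0 := fun n => by positivity
  have hb : WeightedSummable ν fun n => (((((n : ℝ) + 1) ^ ν : ℝ) : ℂ))⁻¹ * b n := by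
    have h := (lp.memℓp b).summable (by simp)
    refine h.congr fun n => ?_
    have := hw n
    rw [norm_mul, norm_inv, norm_real, Real.norm_of_nonneg (by positivity), mul_pow, mul_comm 2 ν,
      Real.rpow_mul (by positivity), Real.rpow_two]
    simp only [ENNReal.toReal_ofNat, Real.rpow_two]
    field_simp
  refine ⟨ofCoeff _ hb, ?_⟩
  ext n
  have : ((((n : ℝ) + 1) ^ ν : ℝ) : ℂ) ≠ 0 := ofReal_ne_zero.2 (hw n)
  change ((((n : ℝ) + 1) ^ ν : ℝ) : ℂ) * (ofCoeff _ hb).coeff n = _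
  rw [coeff_ofCoeff, mul_inv_cancel_left₀ this]

instance : CompleteSpace (WeightedDirichlet ν) :=
  (completeSpace_congr
    (e := (LinearIsometryEquiv.ofSurjective (toLp ν) (toLp_surjective ν)).toEquiv)
    (LinearIsometryEquiv.ofSurjective (toLp ν)
      (toLp_surjective ν)).isometry.isUniformEmbedding).2 inferInstance

theorem weightedSummable_dual {b : ℕ → ℂ} (hb : WeightedSummable (-ν) b) :
    WeightedSummable ν fun n => starRingEnd ℂ (b n) * ((((n : ℝ) + 1) ^ (-(2 * ν)) : ℝ) : ℂ) := by
  refine hb.congr fun n => ?_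
  rw [norm_mul, RCLike.norm_conj, norm_real, Real.norm_of_nonneg (by positivity), mul_pow,
    mul_assoc, rpow_natCast_add_one_sq, ← Real.rpow_add (by positivity)]
  congr 2
  ring

/-- The vector of `S_ν` representing the functional `f ↦ ∑ bₙ aₙ`. -/
def dual (b : ℕ → ℂ) (hb : WeightedSummable (-ν) b) : WeightedDirichlet ν :=
  ofCoeff _ (weightedSummable_dual hb)

theorem inner_dual (b : ℕ → ℂ) (hb : WeightedSummable (-ν) b) (f : WeightedDirichlet ν) :
    HasSum (fun n => b n * f.coeff n) (inner ℂ (dual b hb) f) := by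
  have h := ((dual b hb).weightedSummable_coeff.inner f.weightedSummable_coeff).hasSum
  rw [← inner_def] at h
  refine h.congr_fun fun n => ?_
  rw [dual, coeff_ofCoeff, map_mul, conj_conj, conj_ofReal, mul_right_comm, mul_assoc (b n),
    ← ofReal_mul, ← Real.rpow_add (by positivity)]
  simp

theorem norm_dual_sq (b : ℕ → ℂ) (hb : WeightedSummable (-ν) b) :
    ‖dual b hb‖ ^ 2 = ∑' n, ‖b n‖ ^ 2 * ((n : ℝ) + 1) ^ (-(2 * ν)) := by
  rw [norm_sq_eq]
  refine tsum_congr fun n => ?_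
  rw [dual, coeff_ofCoeff, norm_mul, RCLike.norm_conj, norm_real,
    Real.norm_of_nonneg (by positivity), mul_pow,
    mul_assoc, rpow_natCast_add_one_sq, ← Real.rpow_add (by positivity)]
  congr 2
  ring

theorem weightedSummable_pow (ν : ℝ) (z : 𝔻) : WeightedSummable ν fun n => (z : ℂ) ^ n := by
  refine (summable_rpow_mul_geometric (2 * ν) (by positivity) z.sq_norm_lt_one).congr fun n => ?_
  rw [norm_pow, ← pow_mul, ← pow_mul, mul_comm n 2, mul_comm]

/-- Evaluation at a point of the disc. -/
def eval (ν : ℝ) (z : 𝔻) : WeightedDirichlet ν →L[ℂ] ℂ :=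
  innerSL ℂ (dual _ (weightedSummable_pow (-ν) z))

theorem eval_apply (z : 𝔻) (f : WeightedDirichlet ν) : eval ν z f = f z := by
  have h := inner_dual _ (weightedSummable_pow (-ν) z) f
  refine h.unique ((f.hasTaylorSeries_coeff z).congr_fun fun n => mul_comm _ _)

/-- By the closed graph theorem, a weighted composition which maps `S_ν` into `S_ν'` is bounded. -/
theorem exists_weightedComposition {ν' : ℝ} (w : 𝔻 → ℂ) (Φ : 𝔻 → 𝔻)
    (h : ∀ f : WeightedDirichlet ν,
      (fun z => w z * f (Φ z)) ∈ weightedDirichletSubmodule ν') :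
    ∃ T : WeightedDirichlet ν →L[ℂ] WeightedDirichlet ν',
      ∀ f z, T f z = w z * f (Φ z) := by
  let T : WeightedDirichlet ν →ₗ[ℂ] WeightedDirichlet ν' :=
    { toFun := fun f => ⟨_, h f⟩
      map_add' := fun f g => ext fun z => mul_add _ _ _
      map_smul' := fun c f => ext fun z => mul_left_comm _ _ _ }
  have hT : ∀ f z, T f z = w z * f (Φ z) := fun f z => rfl
  refine ⟨ContinuousLinearMap.ofSeqClosedGraph (g := T) fun u x y hu hy => ext fun z => ?_,
    fun f z => hT f z⟩
  have h1 := (((eval ν (Φ z)).continuous.tendsto x).comp hu).const_mul (w z)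
  have h2 := ((eval ν' z).continuous.tendsto y).comp hy
  simp only [eval_apply] at h1 h2
  rw [hT]
  refine tendsto_nhds_unique h2 (h1.congr fun n => ?_)
  simp only [Function.comp, eval_apply, hT]

theorem one_mem (ν : ℝ) : (fun _ => 1 : 𝔻 → ℂ) ∈ weightedDirichletSubmodule ν :=
  ⟨fun n => if n = 0 then 1 else 0, fun z => by
    convert hasSum_single 0 _ using 1 <;> simp +contextual, by
    refine summable_of_ne_finset_zero (s := {0}) fun n hn => ?_
    simp at hn
    simp [hn]⟩

/-- The function `z ^ k f`. -/
def shift (k : ℕ) (f : WeightedDirichlet ν) : WeightedDirichlet ν :=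
  ⟨_, _, f.hasTaylorSeries_coeff.shift k, (f.weightedSummable_coeff.shift k).1⟩

theorem shift_apply (k : ℕ) (f : WeightedDirichlet ν) (z : 𝔻) :
    shift k f z = (z : ℂ) ^ k * f z := rfl

theorem norm_shift_le (k : ℕ) (f : WeightedDirichlet ν) :
    ‖shift k f‖ ≤ ((k : ℝ) + 1) ^ |ν| * ‖f‖ := by
  refine (pow_le_pow_iff_left₀ (norm_nonneg _) (by positivity) two_ne_zero).1 ?_
  rw [mul_pow, norm_sq_eq f, norm_sq_eq, coeff_eq (shift k f) (f.hasTaylorSeries_coeff.shift k),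
    rpow_natCast_add_one_sq]
  have := (f.weightedSummable_coeff.shift k).2
  rwa [abs_mul, abs_two] at this

theorem coe_mul_mem {f : 𝔻 → ℂ} (h : f ∈ weightedDirichletSubmodule ν) :
    (fun z : 𝔻 => (z : ℂ) * f z) ∈ weightedDirichletSubmodule ν := by
  obtain ⟨a, ha, ha'⟩ := h
  exact ⟨_, by simpa using ha.shift 1, (ha'.shift 1).1⟩

theorem const_mul_mem (c : ℂ) {f : 𝔻 → ℂ} (h : f ∈ weightedDirichletSubmodule ν) :
    (fun z => c * f z) ∈ weightedDirichletSubmodule ν :=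
  (weightedDirichletSubmodule ν).smul_mem c h

theorem affine_mul_mem (a b : ℂ) {f : 𝔻 → ℂ} (h : f ∈ weightedDirichletSubmodule ν) :
    (fun z : 𝔻 => (a * z + b) * f z) ∈ weightedDirichletSubmodule ν := by
  convert (weightedDirichletSubmodule ν).add_mem (const_mul_mem a (coe_mul_mem h))
    (const_mul_mem b h) using 1
  ext z
  simp only [Pi.add_apply]
  ring

/-- The series ∑ rᵏ zᵏ f converges absolutely in S_ν, because multiplication by zᵏ has norm at most
(k + 1)^|ν|. -/
theorem inv_one_sub_mul_mem {r : ℂ} (hr : ‖r‖ < 1) {f : 𝔻 → ℂ}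
    (h : f ∈ weightedDirichletSubmodule ν) :
    (fun z : 𝔻 => (1 - r * z)⁻¹ * f z) ∈ weightedDirichletSubmodule ν := by
  let F : WeightedDirichlet ν := ofMem f h
  have hs : Summable fun k => r ^ k • shift k F := by
    refine Summable.of_norm_bounded
      ((summable_rpow_mul_geometric |ν| (norm_nonneg r) hr).mul_right ‖F‖) fun k => ?_
    rw [norm_smul, norm_pow, mul_comm (_ ^ |ν|), mul_assoc]
    exact mul_le_mul_of_nonneg_left (norm_shift_le k F) (by positivity)
  convert (∑' k, r ^ k • shift k F).2 using 1
  ext z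
  have h1 := hs.hasSum.mapL (eval ν z)
  have h2 : ‖r * z‖ < 1 := by
    rw [norm_mul]
    exact mul_lt_one_of_nonneg_of_lt_one_left (norm_nonneg _) hr z.norm_lt_one.le
  have h3 := (hasSum_geometric_of_norm_lt_one h2).mul_right (f z)
  rw [eval_apply] at h1
  refine h3.unique (h1.congr_fun fun k => ?_)
  rw [map_smul, eval_apply, shift_apply, mul_pow, smul_eq_mul, mul_assoc]
  rfl

theorem inv_affine_mul_mem {c d : ℂ} (hcd : ‖c‖ < ‖d‖) {f : 𝔻 → ℂ}
    (h : f ∈ weightedDirichletSubmodule ν) :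
    (fun z : 𝔻 => (c * z + d)⁻¹ * f z) ∈ weightedDirichletSubmodule ν := by
  have hd : d ≠ 0 := norm_pos_iff.1 ((norm_nonneg c).trans_lt hcd)
  have hr : ‖-(c / d)‖ < 1 := by
    rw [norm_neg, norm_div]
    exact (div_lt_one (norm_pos_iff.2 hd)).2 hcd
  convert const_mul_mem d⁻¹ (inv_one_sub_mul_mem hr h) using 2 with z
  rw [← mul_assoc, ← mul_inv]
  congr 2
  field_simp
  ring

/-- `f ∈ S_{ν+1}` if and only if `f' ∈ S_ν`, in terms of coefficients. -/
theorem weightedSummable_deriv_iff {a : ℕ → ℂ} :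
    WeightedSummable ν (fun n => ((n : ℂ) + 1) * a (n + 1)) ↔ WeightedSummable (ν + 1) a := by
  have key : ∀ n : ℕ, ‖((n : ℂ) + 1) * a (n + 1)‖ ^ 2 * ((n : ℝ) + 1) ^ (2 * ν) =
      ‖a (n + 1)‖ ^ 2 * ((n : ℝ) + 1) ^ (2 * (ν + 1)) := fun n => by
    rw [norm_mul, mul_pow, show ((n : ℂ) + 1) = (((n : ℝ) + 1 : ℝ) : ℂ) by push_cast; rfl,
      norm_real, Real.norm_of_nonneg (by positivity), show 2 * (ν + 1) = 2 * ν + 2 by ring,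
      Real.rpow_add (by positivity), Real.rpow_two]
    ring
  rw [WeightedSummable, WeightedSummable, ← summable_nat_add_iff 1]
  simp only [key]
  rw [summable_nat_add_iff 1 (f := fun n => ‖a (n + 1)‖ ^ 2 * ((n : ℝ) + 1) ^ (2 * (ν + 1)))]
  constructor
  · intro h
    refine (summable_nat_add_iff 1).1 (Summable.of_nonneg_of_le (fun n => by positivity)
      (fun n => ?_) (h.mul_left ((((1 : ℕ) : ℝ) + 1) ^ |2 * (ν + 1)|)))
    have := mul_le_mul_of_nonneg_left (rpow_shift_le (2 * (ν + 1)) 1 n) (sq_nonneg ‖a (n + 1)‖)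
    linarith
  · intro h
    refine Summable.of_nonneg_of_le (fun n => by positivity) (fun n => ?_)
      (((summable_nat_add_iff 1).2 h).mul_left ((((1 : ℕ) : ℝ) + 1) ^ |2 * (ν + 1)|))
    have := mul_le_mul_of_nonneg_left (rpow_le_shift (2 * (ν + 1)) 1 n) (sq_nonneg ‖a (n + 1)‖)
    linarith

end WeightedDirichlet

/-! ### The matrix of a weighted composition operator -/

/-- `compMatrix a b c d n k` is the `n`-th Taylor coefficient of `(a z + b) ^ k / (c z + d) ^ (k + 1)`. -/
def compMatrix (a b c d : ℂ) : ℕ → ℕ → ℂ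
  | 0, 0 => d⁻¹
  | n + 1, 0 => -c / d * compMatrix a b c d n 0
  | 0, k + 1 => b / d * compMatrix a b c d 0 k
  | n + 1, k + 1 => (-c * compMatrix a b c d n (k + 1) + b * compMatrix a b c d (n + 1) k +
      a * compMatrix a b c d n k) / d

/-- The generating function in z and w of the entries is 1/(cz + d - w(az + b)); exchanging z and w
exchanges c and -b. This turns the adjoint problem into another composition problem. -/
theorem compMatrix_transpose (a b c d : ℂ) (n k : ℕ) :
    compMatrix a b c d n k = compMatrix a (-c) (-b) d k n := by
  induction n generalizing k with
  | zero =>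
    induction k with
    | zero => simp [compMatrix]
    | succ k ih => rw [compMatrix, compMatrix, ih]; simp
  | succ n ihn =>
    induction k with
    | zero => rw [compMatrix, compMatrix, ihn]
    | succ k ih => rw [compMatrix, compMatrix, ihn, ihn, ih]; ring

theorem compMatrix_mul {r : ℂ} (hr : r ≠ 0) (a b c d : ℂ) (n k : ℕ) :
    compMatrix (r * a) (r * b) (r * c) (r * d) n k = r⁻¹ * compMatrix a b c d n k := by
  have h : ∀ x y : ℂ, r * x / (r * y) = x / y := fun x y => mul_div_mul_left x y hr
  induction n generalizing k with
  | zero =>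
    induction k with
    | zero => simp [compMatrix, mul_comm]
    | succ k ih => rw [compMatrix, compMatrix, ih, h]; ring
  | succ n ihn =>
    induction k with
    | zero => rw [compMatrix, compMatrix, ihn, ← mul_neg, h]; ring
    | succ k ih =>
      have e : ∀ x y z : ℂ, -(r * c) * (r⁻¹ * x) + r * b * (r⁻¹ * y) + r * a * (r⁻¹ * z) =
          -c * x + b * y + a * z := fun x y z => by field_simp
      rw [compMatrix, compMatrix, ihn, ihn, ih, e, div_eq_mul_inv, div_eq_mul_inv, mul_inv]
      ring

/-- The Taylor coefficients of `(α z + β) f`. -/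
def affineCoeff (α β : ℂ) (x : ℕ → ℂ) (n : ℕ) : ℂ := α * shiftCoeff 1 x n + β * x n

theorem affineCoeff_zero (α β : ℂ) (x : ℕ → ℂ) : affineCoeff α β x 0 = β * x 0 := by
  simp [affineCoeff, shiftCoeff]

theorem affineCoeff_succ (α β : ℂ) (x : ℕ → ℂ) (n : ℕ) :
    affineCoeff α β x (n + 1) = α * x n + β * x (n + 1) := by
  simp [affineCoeff, shiftCoeff]

theorem HasTaylorSeries.affine {f : 𝔻 → ℂ} {x : ℕ → ℂ} (h : HasTaylorSeries f x) (α β : ℂ) :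
    HasTaylorSeries (fun z => (α * z + β) * f z) (affineCoeff α β x) := fun z => by
  have h1 := ((h.shift 1 z).mul_left α).add ((h z).mul_left β)
  simp only [pow_one, ← mul_assoc, ← add_mul] at h1
  refine h1.congr_fun fun n => ?_
  rw [affineCoeff]

theorem HasTaylorSeries.sum {ι : Type*} (s : Finset ι) {f : ι → 𝔻 → ℂ} {x : ι → ℕ → ℂ}
    (h : ∀ i ∈ s, HasTaylorSeries (f i) (x i)) (α : ι → ℂ) :
    HasTaylorSeries (fun z => ∑ i ∈ s, α i * f i z) (fun n => ∑ i ∈ s, α i * x i n) := fun z => by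
  refine (hasSum_sum fun i hi => (h i hi z).mul_left (α i)).congr_fun fun n => ?_
  rw [Finset.sum_mul]
  exact Finset.sum_congr rfl fun i _ => mul_assoc _ _ _

theorem hasTaylorSeries_one : HasTaylorSeries (fun _ => 1) fun n => if n = 0 then 1 else 0 :=
  fun z => by convert hasSum_single 0 _ using 1 <;> simp +contextual

section Columns

variable {a b c d : ℂ}

theorem affine_ne_zero (hcd : ‖c‖ < ‖d‖) (z : 𝔻) : c * z + d ≠ 0 := fun h => by
  have h1 : ‖d‖ = ‖c‖ * ‖(z : ℂ)‖ := by
    rw [← norm_mul, ← norm_neg, eq_neg_of_add_eq_zero_left h, norm_neg]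
  nlinarith [z.norm_lt_one, norm_nonneg c, norm_nonneg (z : ℂ)]

theorem column_mem (ν : ℝ) (hcd : ‖c‖ < ‖d‖) (k : ℕ) :
    (fun z : 𝔻 => (c * z + d)⁻¹ * ((a * z + b) / (c * z + d)) ^ k) ∈
      weightedDirichletSubmodule ν := by
  induction k with
  | zero => simpa using WeightedDirichlet.inv_affine_mul_mem hcd (WeightedDirichlet.one_mem ν)
  | succ k ih =>
    convert WeightedDirichlet.inv_affine_mul_mem hcd (WeightedDirichlet.affine_mul_mem a b ih)
      using 2 with z
    rw [pow_succ, div_eq_mul_inv]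
    ring

theorem hasTaylorSeries_column (hcd : ‖c‖ < ‖d‖) (k : ℕ) :
    HasTaylorSeries (fun z : 𝔻 => (c * z + d)⁻¹ * ((a * z + b) / (c * z + d)) ^ k)
      (fun n => compMatrix a b c d n k) := by
  have hd : d ≠ 0 := norm_pos_iff.1 ((norm_nonneg c).trans_lt hcd)
  induction k with
  | zero =>
    obtain ⟨x, hx, -⟩ := column_mem (a := a) (b := b) 0 hcd 0
    have h1 := hx.affine c d
    -- Multiplying by cz + d and comparing coefficients yields the recursion that defines
    -- `compMatrix`.
    have h2 := h1.unique (b := fun n => if n = 0 then 1 else 0) (by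
      convert hasTaylorSeries_one using 2 with z
      rw [pow_zero, mul_one, mul_inv_cancel₀ (affine_ne_zero hcd z)])
    convert hx using 2 with n
    induction n with
    | zero =>
      have := congrFun h2 0
      rw [affineCoeff_zero, if_pos rfl] at this
      rw [compMatrix]
      exact (eq_inv_of_mul_eq_one_right this).symm
    | succ n ih =>
      have := congrFun h2 (n + 1)
      rw [affineCoeff_succ, if_neg n.succ_ne_zero] at this
      rw [compMatrix, ih, div_mul_eq_mul_div, div_eq_iff hd]
      linear_combination -this
  | succ k ihk =>
    obtain ⟨x, hx, -⟩ := column_mem (a := a) (b := b) 0 hcd (k + 1)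
    have h1 := hx.affine c d
    have h2 := h1.unique (b := affineCoeff a b fun n => compMatrix a b c d n k) (by
      convert ihk.affine a b using 2 with z
      have := affine_ne_zero hcd z
      rw [pow_succ]
      field_simp)
    convert hx using 2 with n
    induction n with
    | zero =>
      have := congrFun h2 0
      rw [affineCoeff_zero, affineCoeff_zero] at this
      rw [compMatrix, div_mul_eq_mul_div, div_eq_iff hd]
      linear_combination -this
    | succ n ih =>
      have := congrFun h2 (n + 1)
      rw [affineCoeff_succ, affineCoeff_succ] at this
      rw [compMatrix, ih, div_eq_iff hd]
      linear_combination -this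

/-- This is Horner's rule. Write p(z) = α₀ + z r(z) and φ = (az + b)/(cz + d), and let x be the
series of r∘φ/(cz + d). Then p∘φ = α₀ + (az + b)x, while r∘φ = (cz + d)x. -/
theorem affineCoeff_column_sum (hcd : ‖c‖ < ‖d‖) (N : ℕ) (α : ℕ → ℂ) (n : ℕ) :
    affineCoeff c d (fun n => ∑ k ∈ Finset.range (N + 1), α k * compMatrix a b c d n k) n =
      (if n = 0 then α 0 else 0) +
      affineCoeff a b (fun n => ∑ k ∈ Finset.range N, α (k + 1) * compMatrix a b c d n k) n := by
  have hd : d ≠ 0 := norm_pos_iff.1 ((norm_nonneg c).trans_lt hcd)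
  cases n with
  | zero =>
    rw [affineCoeff_zero, affineCoeff_zero, if_pos rfl, Finset.sum_range_succ', mul_add,
      Finset.mul_sum, Finset.mul_sum, add_comm]
    congr 1
    · rw [compMatrix]
      field_simp
    · refine Finset.sum_congr rfl fun k _ => ?_
      rw [compMatrix]
      field_simp
  | succ n =>
    rw [affineCoeff_succ, affineCoeff_succ, if_neg n.succ_ne_zero, Finset.sum_range_succ',
      Finset.sum_range_succ', mul_add, mul_add, zero_add, Finset.mul_sum, Finset.mul_sum,
      Finset.mul_sum, Finset.mul_sum]
    have h0 : c * (α 0 * compMatrix a b c d n 0) + d * (α 0 * compMatrix a b c d (n + 1) 0) = 0 := by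
      rw [compMatrix]
      field_simp
      ring
    rw [add_add_add_comm, h0, add_zero, ← Finset.sum_add_distrib, ← Finset.sum_add_distrib]
    refine Finset.sum_congr rfl fun k _ => ?_
    rw [compMatrix]
    field_simp
    ring

end Columns

/-! ### Boundedness on the Hardy space -/

section Hardy

variable {a b c d : ℂ} {κ s : ℝ}

/-- Apply the identity to consecutive coefficients u = xₙ₋₁ and v = xₙ: the terms with s telescope
and those with κ are nonnegative. Only the coefficient of index 0 meets w, and there κ pays for the
cross term. -/
theorem sum_normSq_affineCoeff_le (hκ : 0 < κ) (hs : 0 < s)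
    (hid : ∀ u v : ℂ, ‖c * u + d * v‖ ^ 2 - ‖a * u + b * v‖ ^ 2 =
      κ * ‖v - u‖ ^ 2 + s * (‖v‖ ^ 2 - ‖u‖ ^ 2)) (x : ℕ → ℂ) (w : ℂ) (M : ℕ) :
    ∑ n ∈ Finset.range M, ‖(if n = 0 then w else 0) + affineCoeff a b x n‖ ^ 2 ≤
      (1 + ‖b‖ ^ 2 / κ) * ‖w‖ ^ 2 + ∑ n ∈ Finset.range M, ‖affineCoeff c d x n‖ ^ 2 := by
  have key : ∀ M : ℕ, ∑ n ∈ Finset.range (M + 1),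
      ‖(if n = 0 then w else 0) + affineCoeff a b x n‖ ^ 2 ≤ (1 + ‖b‖ ^ 2 / κ) * ‖w‖ ^ 2 +
        ∑ n ∈ Finset.range (M + 1), ‖affineCoeff c d x n‖ ^ 2 - s * ‖x M‖ ^ 2 := by
    intro M
    induction M with
    | zero =>
      simp only [zero_add, Finset.sum_range_one, if_true, affineCoeff_zero]
      have h1 := hid 0 (x 0)
      simp only [mul_zero, zero_add, sub_zero, norm_zero] at h1
      have h2 : ‖w + b * x 0‖ ≤ ‖w‖ + ‖b * x 0‖ := norm_add_le _ _
      have h3 : ‖w + b * x 0‖ ^ 2 ≤ (‖w‖ + ‖b * x 0‖) ^ 2 :=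
        pow_le_pow_left₀ (norm_nonneg _) h2 2
      have h4 : 0 ≤ κ * (‖x 0‖ - ‖b‖ / κ * ‖w‖) ^ 2 := by positivity
      -- Completing this square absorbs 2‖w‖‖b x₀‖ into κ‖x₀‖², which is where the constant 1 +
      -- ‖b‖²/κ comes from.
      have h5 : κ * (‖x 0‖ - ‖b‖ / κ * ‖w‖) ^ 2 =
          κ * ‖x 0‖ ^ 2 - 2 * ‖w‖ * (‖b‖ * ‖x 0‖) + ‖b‖ ^ 2 / κ * ‖w‖ ^ 2 := by
        field_simp
        ring
      rw [h5, ← norm_mul] at h4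
      linarith
    | succ M ih =>
      rw [Finset.sum_range_succ, Finset.sum_range_succ (fun n => ‖affineCoeff c d x n‖ ^ 2),
        if_neg M.succ_ne_zero, zero_add, affineCoeff_succ, affineCoeff_succ]
      have h1 := hid (x M) (x (M + 1))
      have h2 : 0 ≤ κ * ‖x (M + 1) - x M‖ ^ 2 := by positivity
      linarith
  cases M with
  | zero => simp; positivity
  | succ M =>
    have := key M
    have h2 : 0 ≤ s * ‖x M‖ ^ 2 := by positivity
    linarith

/-- Each Horner step costs the constant only on the newly added coefficient and the factor 1 on what
precedes, so the bound does not deteriorate with the degree. -/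
theorem sum_normSq_comp_le (hκ : 0 < κ) (hs : 0 < s) (hcd : ‖c‖ < ‖d‖)
    (hid : ∀ u v : ℂ, ‖c * u + d * v‖ ^ 2 - ‖a * u + b * v‖ ^ 2 =
      κ * ‖v - u‖ ^ 2 + s * (‖v‖ ^ 2 - ‖u‖ ^ 2)) (N : ℕ) (α : ℕ → ℂ) (M : ℕ) :
    ∑ n ∈ Finset.range M,
      ‖affineCoeff c d (fun n => ∑ k ∈ Finset.range N, α k * compMatrix a b c d n k) n‖ ^ 2 ≤
      (1 + ‖b‖ ^ 2 / κ) * ∑ k ∈ Finset.range N, ‖α k‖ ^ 2 := by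
  induction N generalizing α with
  | zero =>
    refine (Finset.sum_eq_zero fun n _ => ?_).le.trans (by simp)
    cases n <;> simp [affineCoeff_zero, affineCoeff_succ]
  | succ N ih =>
    simp only [affineCoeff_column_sum hcd]
    refine (sum_normSq_affineCoeff_le hκ hs hid _ _ M).trans ?_
    rw [Finset.sum_range_succ' (fun k => ‖α k‖ ^ 2), mul_add, add_comm]
    exact add_le_add_left (ih fun k => α (k + 1)) _

end Hardy

/-! ### Bilinear forms of matrices and interpolation of weights -/

/-- Boundedness of the bilinear form of an infinite matrix, with respect to the weights
`(n + 1) ^ (-2 ν)` and `(k + 1) ^ (2 ν)`. -/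
def FormBound (K : ℕ → ℕ → ℂ) (ν M : ℝ) : Prop :=
  ∀ (L N : ℕ) (β α : ℕ → ℂ),
    ‖∑ n ∈ Finset.range L, ∑ k ∈ Finset.range N, β n * K n k * α k‖ ≤
      M * √(∑ n ∈ Finset.range L, ‖β n‖ ^ 2 * ((n : ℝ) + 1) ^ (-(2 * ν))) *
        √(∑ k ∈ Finset.range N, ‖α k‖ ^ 2 * ((k : ℝ) + 1) ^ (2 * ν))

namespace FormBound

theorem transpose {K : ℕ → ℕ → ℂ} {ν M : ℝ} (h : FormBound K ν M) :
    FormBound (fun n k => K k n) (-ν) M := fun L N β α => by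
  have := h N L α β
  rw [Finset.sum_comm]
  simp only [mul_neg, neg_neg]
  rw [mul_right_comm]
  convert this using 2
  exact Finset.sum_congr rfl fun n _ => Finset.sum_congr rfl fun k _ => by ring

theorem const_mul {K : ℕ → ℕ → ℂ} {ν M : ℝ} (h : FormBound K ν M) (r : ℂ) :
    FormBound (fun n k => r * K n k) ν (‖r‖ * M) := fun L N β α => by
  have : ∑ n ∈ Finset.range L, ∑ k ∈ Finset.range N, β n * (r * K n k) * α k =
      r * ∑ n ∈ Finset.range L, ∑ k ∈ Finset.range N, β n * K n k * α k := by
    rw [Finset.mul_sum]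
    refine Finset.sum_congr rfl fun n _ => ?_
    rw [Finset.mul_sum]
    exact Finset.sum_congr rfl fun k _ => by ring
  rw [this, norm_mul, mul_assoc, mul_assoc, ← mul_assoc M]
  exact mul_le_mul_of_nonneg_left (h L N β α) (norm_nonneg r)

theorem mono {K : ℕ → ℕ → ℂ} {ν M M' : ℝ} (h : FormBound K ν M) (hM : M ≤ M') :
    FormBound K ν M' := fun L N β α => (h L N β α).trans <| by gcongr

/-- Interpolation between weights. -/
theorem interpolate {K : ℕ → ℕ → ℂ} {ν₀ ν₁ M : ℝ} (h0 : FormBound K ν₀ M)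
    (h1 : FormBound K ν₁ M) (hlt : ν₀ < ν₁) {ν : ℝ} (hν : ν ∈ Set.Icc ν₀ ν₁) : FormBound K ν M := by
  intro L N β α
  -- The weights are moved by complex powers. On Re z = μ the bound at exponent μ has the right-hand
  -- side wanted at ν, whatever μ is, and F(ν) is the original form.
  let F : ℂ → ℂ := fun z => ∑ n ∈ Finset.range L, ∑ k ∈ Finset.range N,
    (β n * ((n + 1 : ℕ) : ℂ) ^ (z - ν)) * K n k * (α k * ((k + 1 : ℕ) : ℂ) ^ (ν - z))
  have hne : ∀ n : ℕ, ((n + 1 : ℕ) : ℂ) ≠ 0 := fun n => Nat.cast_ne_zero.2 n.succ_ne_zero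
  have hnorm : ∀ (n : ℕ) (z : ℂ), ‖((n + 1 : ℕ) : ℂ) ^ z‖ = ((n : ℝ) + 1) ^ z.re := fun n z => by
    rw [norm_natCast_cpow_of_pos n.succ_pos]
    push_cast
    rfl
  have hFd : Differentiable ℂ F := by
    refine Differentiable.fun_sum fun n _ => Differentiable.fun_sum fun k _ => ?_
    refine ((Differentiable.const_mul ?_ _).mul_const _).mul (Differentiable.const_mul ?_ _)
    · exact fun z => ((differentiableAt_id.sub_const _).const_cpow (Or.inl (hne n)))
    · exact fun z => ((differentiableAt_id.const_sub _).const_cpow (Or.inl (hne k)))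
  have hedge : ∀ (μ : ℝ), FormBound K μ M → ∀ z : ℂ, z.re = μ → ‖F z‖ ≤
      M * √(∑ n ∈ Finset.range L, ‖β n‖ ^ 2 * ((n : ℝ) + 1) ^ (-(2 * ν))) *
        √(∑ k ∈ Finset.range N, ‖α k‖ ^ 2 * ((k : ℝ) + 1) ^ (2 * ν)) := by
    intro μ hμ z hz
    refine (hμ L N (fun n => β n * ((n + 1 : ℕ) : ℂ) ^ (z - ν))
      (fun k => α k * ((k + 1 : ℕ) : ℂ) ^ (ν - z))).trans_eq ?_
    have e1 : ∀ s : Finset ℕ, ∑ n ∈ s, ‖β n * ((n + 1 : ℕ) : ℂ) ^ (z - ν)‖ ^ 2 *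
        ((n : ℝ) + 1) ^ (-(2 * μ)) = ∑ n ∈ s, ‖β n‖ ^ 2 * ((n : ℝ) + 1) ^ (-(2 * ν)) := by
      refine fun s => Finset.sum_congr rfl fun n _ => ?_
      rw [norm_mul, hnorm, mul_pow, rpow_natCast_add_one_sq, mul_assoc,
        ← Real.rpow_add (by positivity), sub_re, ofReal_re, hz]
      congr 2
      ring
    have e2 : ∀ s : Finset ℕ, ∑ n ∈ s, ‖α n * ((n + 1 : ℕ) : ℂ) ^ (ν - z)‖ ^ 2 *
        ((n : ℝ) + 1) ^ (2 * μ) = ∑ n ∈ s, ‖α n‖ ^ 2 * ((n : ℝ) + 1) ^ (2 * ν) := by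
      refine fun s => Finset.sum_congr rfl fun n _ => ?_
      rw [norm_mul, hnorm, mul_pow, rpow_natCast_add_one_sq, mul_assoc,
        ← Real.rpow_add (by positivity), sub_re, ofReal_re, hz]
      congr 2
      ring
    rw [e1, e2]
  have hFν : F ν = ∑ n ∈ Finset.range L, ∑ k ∈ Finset.range N, β n * K n k * α k := by
    simp [F]
  rw [← hFν]
  refine PhragmenLindelof.vertical_strip (a := ν₀) (b := ν₁) hFd.diffContOnCl ?_
    (hedge ν₀ h0) (hedge ν₁ h1) (by simpa using hν.1) (by simpa using hν.2)
  -- Finite sums of these powers are bounded on the strip, so the growth condition holds with both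
  -- constants 0.
  refine ⟨0, div_pos Real.pi_pos (sub_pos.2 hlt), 0, ?_⟩
  simp only [zero_mul, Real.exp_zero]
  refine Asymptotics.IsBigO.of_bound (∑ n ∈ Finset.range L, ∑ k ∈ Finset.range N,
    (‖β n‖ * ((n : ℝ) + 1) ^ (ν₁ - ν)) * ‖K n k‖ * (‖α k‖ * ((k : ℝ) + 1) ^ (ν - ν₀))) ?_
  refine Filter.eventually_inf_principal.2 (Filter.Eventually.of_forall fun z hz => ?_)
  rw [norm_one, mul_one]
  refine norm_sum_le_of_le _ fun n _ => norm_sum_le_of_le _ fun k _ => ?_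
  have hz1 : ν₀ < z.re ∧ z.re < ν₁ := hz
  rw [norm_mul, norm_mul, norm_mul, norm_mul, hnorm, hnorm, sub_re, sub_re, ofReal_re]
  gcongr <;> first | simp | linarith

end FormBound

/-! ### From bounded forms to operators on S_ν -/

namespace WeightedDirichlet

variable {ν : ℝ}

/-- Truncation of a sequence. -/
def trunc (N : ℕ) (α : ℕ → ℂ) (n : ℕ) : ℂ := if n < N then α n else 0

theorem trunc_eq_zero {N : ℕ} (α : ℕ → ℂ) {n : ℕ} (hn : n ∉ Finset.range N) : trunc N α n = 0 :=
  if_neg (by simpa using hn)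

theorem trunc_eq {N : ℕ} (α : ℕ → ℂ) {n : ℕ} (hn : n ∈ Finset.range N) : trunc N α n = α n :=
  if_pos (by simpa using hn)

theorem weightedSummable_trunc (ν : ℝ) (N : ℕ) (α : ℕ → ℂ) : WeightedSummable ν (trunc N α) :=
  summable_of_ne_finset_zero (s := Finset.range N) fun n hn => by simp [trunc_eq_zero α hn]

theorem tsum_trunc (N : ℕ) (α : ℕ → ℂ) (w : ℕ → ℝ) :
    ∑' n, ‖trunc N α n‖ ^ 2 * w n = ∑ n ∈ Finset.range N, ‖α n‖ ^ 2 * w n := by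
  rw [tsum_eq_sum (s := Finset.range N) fun n hn => by simp [trunc_eq_zero α hn]]
  exact Finset.sum_congr rfl fun n hn => by rw [trunc_eq α hn]

/-- The polynomial `∑_{k < N} αₖ zᵏ` as an element of `S_ν`. -/
def poly (ν : ℝ) (N : ℕ) (α : ℕ → ℂ) : WeightedDirichlet ν :=
  ofCoeff _ (weightedSummable_trunc ν N α)

theorem poly_apply (N : ℕ) (α : ℕ → ℂ) (z : 𝔻) :
    poly ν N α z = ∑ k ∈ Finset.range N, α k * (z : ℂ) ^ k := by
  refine ((weightedSummable_trunc ν N α).hasTaylorSeries z).unique ?_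
  have e : ∑ k ∈ Finset.range N, α k * (z : ℂ) ^ k =
      ∑ k ∈ Finset.range N, trunc N α k * (z : ℂ) ^ k :=
    Finset.sum_congr rfl fun k hk => by rw [trunc_eq α hk]
  rw [e]
  exact hasSum_sum_of_ne_finset_zero fun n hn => by simp [trunc_eq_zero α hn]

theorem norm_poly_sq (N : ℕ) (α : ℕ → ℂ) :
    ‖poly ν N α‖ ^ 2 = ∑ k ∈ Finset.range N, ‖α k‖ ^ 2 * ((k : ℝ) + 1) ^ (2 * ν) := by
  rw [norm_sq_eq, poly, coeff_ofCoeff, tsum_trunc]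

theorem formBound_of_operator {K : ℕ → ℕ → ℂ} (W : WeightedDirichlet ν →L[ℂ] WeightedDirichlet ν)
    (hW : ∀ N α, (W (poly ν N α)).coeff = fun n => ∑ k ∈ Finset.range N, α k * K n k) :
    FormBound K ν ‖W‖ := fun L N β α => by
  have h1 := inner_dual (ν := ν) _ (weightedSummable_trunc (-ν) L β) (W (poly ν N α))
  have h2 : ∑ n ∈ Finset.range L, ∑ k ∈ Finset.range N, β n * K n k * α k =
      inner ℂ (dual _ (weightedSummable_trunc (-ν) L β)) (W (poly ν N α)) := by
    rw [← h1.tsum_eq, tsum_eq_sum (s := Finset.range L) fun n hn => by simp [trunc_eq_zero β hn]]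
    refine Finset.sum_congr rfl fun n hn => ?_
    rw [trunc_eq β hn, hW, Finset.mul_sum]
    exact Finset.sum_congr rfl fun k _ => by ring
  rw [h2, ← norm_poly_sq, ← tsum_trunc, ← norm_dual_sq (ν := ν) _ (weightedSummable_trunc (-ν) L β),
    Real.sqrt_sq (norm_nonneg _), Real.sqrt_sq (norm_nonneg _)]
  refine (norm_inner_le_norm _ _).trans ?_
  rw [mul_comm ‖W‖, mul_assoc]
  exact mul_le_mul_of_nonneg_left (W.le_opNorm _) (norm_nonneg _)

/-- A weighted composition which is bounded on polynomials maps `S_ν` into itself. -/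
theorem weightedComposition_mem_of_bound {w : 𝔻 → ℂ} {Φ : 𝔻 → 𝔻} {M : ℝ}
    (h : ∀ (N : ℕ) (α : ℕ → ℂ), ∃ g : WeightedDirichlet ν,
      (∀ z, g z = w z * ∑ k ∈ Finset.range N, α k * (Φ z : ℂ) ^ k) ∧
      ‖g‖ ^ 2 ≤ M * ∑ k ∈ Finset.range N, ‖α k‖ ^ 2 * ((k : ℝ) + 1) ^ (2 * ν))
    (f : WeightedDirichlet ν) :
    (fun z => w z * f (Φ z)) ∈ weightedDirichletSubmodule ν := by
  choose g hg hgM using fun N => h N f.coeff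
  let S : ℕ → ℝ := fun N => ∑ k ∈ Finset.range N, ‖f.coeff k‖ ^ 2 * ((k : ℝ) + 1) ^ (2 * ν)
  have hS : Filter.Tendsto S Filter.atTop (𝓝 (‖f‖ ^ 2)) := by
    rw [norm_sq_eq]
    exact f.weightedSummable_coeff.hasSum.tendsto_sum_nat
  have hdist : ∀ N N', N ≤ N' → ‖g N' - g N‖ ^ 2 ≤ M * (S N' - S N) := fun N N' hN => by
    -- The hypothesis is applied to the block of coefficients between N and N', so that the images
    -- of the partial sums form a Cauchy sequence.
    let α : ℕ → ℂ := fun k => if k < N then 0 else f.coeff k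
    obtain ⟨G, hG, hGM⟩ := h N' α
    have hα : ∀ k ∈ Finset.range N, α k = 0 := fun k hk => if_pos (by simpa using hk)
    have hα' : ∀ k ∈ Finset.Ico N N', α k = f.coeff k := fun k hk =>
      if_neg (by simpa using (Finset.mem_Ico.1 hk).1)
    have hGe : g N' - g N = G := ext fun z => by
      have e1 := Finset.sum_range_add_sum_Ico (fun k => α k * (Φ z : ℂ) ^ k) hN
      have e2 := Finset.sum_range_add_sum_Ico (fun k => f.coeff k * (Φ z : ℂ) ^ k) hN
      have e3 : ∑ k ∈ Finset.range N, α k * (Φ z : ℂ) ^ k = 0 :=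
        Finset.sum_eq_zero fun k hk => by rw [hα k hk, zero_mul]
      have e4 : ∑ k ∈ Finset.Ico N N', α k * (Φ z : ℂ) ^ k =
          ∑ k ∈ Finset.Ico N N', f.coeff k * (Φ z : ℂ) ^ k :=
        Finset.sum_congr rfl fun k hk => by rw [hα' k hk]
      rw [sub_apply, hg, hg, hG, ← e1, ← e2, e3, e4]
      ring
    rw [hGe]
    refine hGM.trans_eq ?_
    congr 1
    have e1 := Finset.sum_range_add_sum_Ico
      (fun k : ℕ => ‖α k‖ ^ 2 * ((k : ℝ) + 1) ^ (2 * ν)) hN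
    have e2 : S N + _ = S N' := Finset.sum_range_add_sum_Ico
      (fun k : ℕ => ‖f.coeff k‖ ^ 2 * ((k : ℝ) + 1) ^ (2 * ν)) hN
    have e3 : ∑ k ∈ Finset.range N, ‖α k‖ ^ 2 * ((k : ℝ) + 1) ^ (2 * ν) = 0 :=
      Finset.sum_eq_zero fun k hk => by simp [hα k hk]
    have e4 : ∑ k ∈ Finset.Ico N N', ‖α k‖ ^ 2 * ((k : ℝ) + 1) ^ (2 * ν) =
        ∑ k ∈ Finset.Ico N N', ‖f.coeff k‖ ^ 2 * ((k : ℝ) + 1) ^ (2 * ν) :=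
      Finset.sum_congr rfl fun k hk => by rw [hα' k hk]
    rw [← e1, ← e2, e3, e4]
    ring
  have hSle : ∀ N, S N ≤ ‖f‖ ^ 2 := f.sum_range_le_norm_sq
  have hcau : CauchySeq g := by
    refine cauchySeq_of_le_tendsto_0' (fun N => √(|M| * (‖f‖ ^ 2 - S N))) (fun N N' hN => ?_) ?_
    · rw [dist_comm, dist_eq_norm]
      refine Real.le_sqrt_of_sq_le ((hdist N N' hN).trans ?_)
      have hmono : S N ≤ S N' := Finset.sum_le_sum_of_subset_of_nonneg
        (Finset.range_mono hN) fun k _ _ => by positivity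
      exact mul_le_mul (le_abs_self M) (by linarith [hSle N']) (by linarith) (abs_nonneg M)
    · have := ((hS.const_sub (‖f‖ ^ 2)).const_mul |M|).sqrt
      simpa using this
  obtain ⟨G, hG⟩ := cauchySeq_tendsto_of_complete hcau
  convert G.2 using 1
  ext z
  have h1 := ((eval ν z).continuous.tendsto G).comp hG
  simp only [eval_apply] at h1
  refine tendsto_nhds_unique
    ((f.hasTaylorSeries_coeff (Φ z)).tendsto_sum_nat.const_mul (w z)) (h1.congr fun N => ?_)
  simp only [Function.comp, eval_apply, hg]

theorem weightedComposition_mem_of_formBound {w : 𝔻 → ℂ} {Φ : 𝔻 → 𝔻} {K : ℕ → ℕ → ℂ} {M : ℝ}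
    (hK : FormBound K ν M) (hcol : ∀ k, HasTaylorSeries (fun z => w z * (Φ z : ℂ) ^ k)
      fun n => K n k) (f : WeightedDirichlet ν) :
    (fun z => w z * f (Φ z)) ∈ weightedDirichletSubmodule ν := by
  refine weightedComposition_mem_of_bound (M := M ^ 2) (fun N α => ?_) f
  set A : ℝ := ∑ k ∈ Finset.range N, ‖α k‖ ^ 2 * ((k : ℝ) + 1) ^ (2 * ν) with hA
  have hA0 : 0 ≤ A := Finset.sum_nonneg fun k _ => by positivity
  let y : ℕ → ℂ := fun n => ∑ k ∈ Finset.range N, α k * K n k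
  have hy : HasTaylorSeries (fun z => w z * ∑ k ∈ Finset.range N, α k * (Φ z : ℂ) ^ k) y := by
    convert HasTaylorSeries.sum (Finset.range N) (fun k _ => hcol k) α using 2 with z
    rw [Finset.mul_sum]
    exact Finset.sum_congr rfl fun k _ => by ring
  have hP : ∀ L, ∑ n ∈ Finset.range L, ‖y n‖ ^ 2 * ((n : ℝ) + 1) ^ (2 * ν) ≤ M ^ 2 * A := by
    intro L
    set P := ∑ n ∈ Finset.range L, ‖y n‖ ^ 2 * ((n : ℝ) + 1) ^ (2 * ν) with hPdef
    have hP0 : 0 ≤ P := Finset.sum_nonneg fun k _ => by positivity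
    -- The extremal choice in the duality: the form and the squared dual norm of β both become the
    -- partial sum P, so P ≤ M√P√A, that is, P ≤ M²A.
    let β : ℕ → ℂ := fun n => starRingEnd ℂ (y n) * ((((n : ℝ) + 1) ^ (2 * ν) : ℝ) : ℂ)
    have h1 := hK L N β α
    have h2 : ∑ n ∈ Finset.range L, ∑ k ∈ Finset.range N, β n * K n k * α k = (P : ℂ) := by
      rw [hPdef, ofReal_sum]
      refine Finset.sum_congr rfl fun n _ => ?_
      calc _ = β n * y n := by
            rw [Finset.mul_sum]
            exact Finset.sum_congr rfl fun k _ => by ring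
        _ = _ := by
            simp only [β]
            push_cast
            rw [← conj_mul']
            ring
    have h3 : ∑ n ∈ Finset.range L, ‖β n‖ ^ 2 * ((n : ℝ) + 1) ^ (-(2 * ν)) = P := by
      refine Finset.sum_congr rfl fun n _ => ?_
      rw [norm_mul, RCLike.norm_conj, norm_real, Real.norm_of_nonneg (by positivity), mul_pow,
        mul_assoc, rpow_natCast_add_one_sq, ← Real.rpow_add (by positivity)]
      congr 2
      ring
    rw [h2, h3, norm_real, Real.norm_of_nonneg hP0, ← hA] at h1
    rcases hP0.eq_or_lt with h0 | h0
    · rw [← h0]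
      positivity
    · have hs := Real.sqrt_pos.2 h0
      have h4 : √P ≤ M * √A := by
        nth_rewrite 1 [← Real.mul_self_sqrt hP0] at h1
        nlinarith
      have h5 := pow_le_pow_left₀ hs.le h4 2
      rwa [mul_pow, Real.sq_sqrt hP0, Real.sq_sqrt hA0] at h5
  have hsum : WeightedSummable ν y :=
    summable_of_sum_range_le (fun n => by positivity) hP
  refine ⟨ofMem _ ⟨y, hy, hsum⟩, fun z => rfl, ?_⟩
  rw [norm_sq_eq, coeff_eq (ofMem _ ⟨y, hy, hsum⟩) hy]
  exact hsum.tsum_le_of_sum_range_le hP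

end WeightedDirichlet

/-! ### Boundedness of composition for linear fractional self-maps fixing 1 -/

/-- The disc self-map which becomes `W ↦ s W + t` in the coordinate `W = 1 / (1 - z)`. -/
structure IsAffineModel (s : ℝ) (t : ℂ) (Φ : 𝔻 → 𝔻) : Prop where
  pos : 0 < s
  lt : 1 < s + 2 * t.re
  apply_eq : ∀ z : 𝔻, (Φ z : ℂ) = ((1 - t) * z + (s - 1 + t)) / (-t * z + (s + t))

section AffineModel

variable {s : ℝ} {t : ℂ}

/-- With u = z and v = 1 this shows that the map preserves the disc; with consecutive coefficients
it drives the Hardy space bound. Positivity of s + 2 Re t - 1 says that the image lies in the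
horodisc Re W > s/2 + Re t, strictly smaller than the disc Re W > 1/2. -/
theorem affineModel_identity (s : ℝ) (t u v : ℂ) :
    ‖-t * u + (s + t) * v‖ ^ 2 - ‖(1 - t) * u + (s - 1 + t) * v‖ ^ 2 =
      (s + 2 * t.re - 1) * ‖v - u‖ ^ 2 + s * (‖v‖ ^ 2 - ‖u‖ ^ 2) := by
  simp only [← normSq_eq_norm_sq, normSq_apply, add_re, add_im, sub_re, sub_im, neg_re, neg_im,
    mul_re, mul_im, ofReal_re, ofReal_im, one_re, one_im]
  ring

theorem affineModel_norm_lt (hs : 0 < s) (ht : 1 < s + 2 * t.re) : ‖-t‖ < ‖(s : ℂ) + t‖ := by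
  refine (pow_lt_pow_iff_left₀ (norm_nonneg _) (norm_nonneg _) two_ne_zero).1 ?_
  simp only [← normSq_eq_norm_sq, normSq_apply, add_re, add_im, neg_re, neg_im,
    ofReal_re, ofReal_im]
  nlinarith

theorem exists_isAffineModel (hs : 0 < s) (ht : 1 < s + 2 * t.re) :
    ∃ Φ : 𝔻 → 𝔻, IsAffineModel s t Φ := by
  have h : ∀ z : 𝔻, ‖((1 - t) * z + (s - 1 + t)) / (-t * z + (s + t))‖ < 1 := fun z => by
    have hne := affine_ne_zero (affineModel_norm_lt hs ht) z
    rw [norm_div, div_lt_one (norm_pos_iff.2 hne)]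
    refine (pow_lt_pow_iff_left₀ (norm_nonneg _) (norm_nonneg _) two_ne_zero).1 ?_
    have h1 := affineModel_identity s t z 1
    rw [mul_one, mul_one, norm_one] at h1
    have h2 : 0 ≤ (s + 2 * t.re - 1) * ‖1 - (z : ℂ)‖ ^ 2 :=
      mul_nonneg (by linarith) (sq_nonneg _)
    have h3 : 0 < s * ((1 : ℝ) ^ 2 - ‖(z : ℂ)‖ ^ 2) :=
      mul_pos hs (by linarith [z.sq_norm_lt_one])
    linarith
  exact ⟨fun z => UnitDisc.mk _ (h z), hs, ht, fun z => rfl⟩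

namespace IsAffineModel

open WeightedDirichlet

variable {Φ : 𝔻 → 𝔻}

theorem norm_lt (h : IsAffineModel s t Φ) : ‖-t‖ < ‖(s : ℂ) + t‖ := affineModel_norm_lt h.pos h.lt

theorem column (h : IsAffineModel s t Φ) (k : ℕ) :
    HasTaylorSeries (fun z : 𝔻 => (-t * z + (s + t))⁻¹ * (Φ z : ℂ) ^ k)
      (fun n => compMatrix (1 - t) (s - 1 + t) (-t) (s + t) n k) := by
  simpa only [← h.apply_eq] using hasTaylorSeries_column (a := 1 - t) (b := s - 1 + t) h.norm_lt k

theorem comp_mem_zero (h : IsAffineModel s t Φ) (f : WeightedDirichlet 0) :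
    (fun z => f (Φ z)) ∈ weightedDirichletSubmodule 0 := by
  have hκ : 0 < s + 2 * t.re - 1 := by linarith [h.lt]
  have := weightedComposition_mem_of_bound (ν := 0) (w := fun _ => 1) (Φ := Φ)
    (M := 1 + ‖s - 1 + t‖ ^ 2 / (s + 2 * t.re - 1)) (fun N α => ?_) f
  · simpa only [one_mul] using this
  have hb := sum_normSq_comp_le hκ h.pos h.norm_lt (affineModel_identity s t) N α
  set y := affineCoeff (-t) (s + t) fun n => ∑ k ∈ Finset.range N,
    α k * compMatrix (1 - t) (s - 1 + t) (-t) (s + t) n k with hy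
  have hT : HasTaylorSeries (fun z => 1 * ∑ k ∈ Finset.range N, α k * (Φ z : ℂ) ^ k) y := by
    convert (HasTaylorSeries.sum (Finset.range N) (fun k _ => h.column k) α).affine (-t) (s + t)
      using 2 with z
    have := affine_ne_zero h.norm_lt z
    rw [one_mul, Finset.mul_sum]
    generalize -t * (z : ℂ) + (s + t) = D at this ⊢
    exact Finset.sum_congr rfl fun k _ => by field_simp
  simp only [mul_zero, Real.rpow_zero, mul_one]
  have hsum : WeightedSummable 0 y := by
    simpa [WeightedSummable] using summable_of_sum_range_le (fun n => sq_nonneg _) hb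
  refine ⟨ofMem _ ⟨y, hT, hsum⟩, fun z => rfl, ?_⟩
  rw [norm_sq_eq, coeff_eq (ofMem _ ⟨y, hT, hsum⟩) hT]
  refine hsum.tsum_le_of_sum_range_le fun M => ?_
  simpa using hb M

/-- Membership in S_{ν+1} is membership of the derivative in S_ν, and (f∘Φ)' = s(cz + d)⁻² f'∘Φ,
with s the determinant of the map. The rational factor is a multiplier. -/
theorem comp_mem_succ (h : IsAffineModel s t Φ) {ν : ℝ}
    (hν : ∀ f : WeightedDirichlet ν, (fun z => f (Φ z)) ∈ weightedDirichletSubmodule ν)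
    (f : WeightedDirichlet (ν + 1)) :
    (fun z => f (Φ z)) ∈ weightedDirichletSubmodule (ν + 1) := by
  obtain ⟨F, hF, hFf⟩ := f.hasTaylorSeries_coeff.exists_differentiableOn
  have hf' := HasTaylorSeries.deriv hF (by simpa only [hFf] using f.hasTaylorSeries_coeff)
  have hg : (fun z => deriv F (Φ z)) ∈ weightedDirichletSubmodule ν :=
    hν (ofMem _ ⟨_, hf', weightedSummable_deriv_iff.2 f.weightedSummable_coeff⟩)
  have hmem := const_mul_mem (s : ℂ) (inv_affine_mul_mem h.norm_lt (inv_affine_mul_mem h.norm_lt hg))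
  let φ : ℂ → ℂ := fun z => ((1 - t) * z + (s - 1 + t)) / (-t * z + (s + t))
  have hφ : ∀ z : 𝔻, φ z = Φ z := fun z => (h.apply_eq z).symm
  have hφd : ∀ z : 𝔻, HasDerivAt φ (s / (-t * z + (s + t)) ^ 2) z := fun z => by
    have hne := affine_ne_zero h.norm_lt z
    have h1 := (((hasDerivAt_id (z : ℂ)).const_mul (1 - t)).add_const ((s : ℂ) - 1 + t)).div
      (((hasDerivAt_id (z : ℂ)).const_mul (-t)).add_const ((s : ℂ) + t)) hne
    refine HasDerivAt.congr_deriv (f := φ) h1 ?_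
    simp only [id]
    congr 1
    ring
  have hGd : ∀ z : 𝔻, HasDerivAt (fun z => F (φ z))
      (deriv F (Φ z) * (s / (-t * z + (s + t)) ^ 2)) z := fun z => by
    refine HasDerivAt.comp (z : ℂ) ?_ (hφd z)
    rw [hφ]
    exact (hF.differentiableAt (Metric.isOpen_ball.mem_nhds (by simpa using (Φ z).norm_lt_one))).hasDerivAt
  have hG : DifferentiableOn ℂ (fun z => F (φ z)) (Metric.ball 0 1) := fun z hz =>
    (hGd (UnitDisc.mk z (by simpa using hz))).differentiableAt.differentiableWithinAt
  obtain ⟨e, hT⟩ : ∃ e, HasTaylorSeries (fun z => F (φ z)) e :=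
    ⟨_, hasTaylorSeries_of_differentiableOn hG⟩
  have hT' := HasTaylorSeries.deriv hG hT
  obtain ⟨b, hb, hb'⟩ := hmem
  have hbe := hb.unique (b := _) (by
    convert hT' using 2 with z
    rw [(hGd z).deriv, div_eq_mul_inv, ← inv_pow]
    generalize (-t * (z : ℂ) + (s + t))⁻¹ = D
    ring)
  rw [hbe] at hb'
  have hfun : (fun z => f (Φ z)) = fun z : 𝔻 => F (φ z) := funext fun z => by rw [hφ, hFf]
  rw [hfun]
  exact mem_iff.2 ⟨e, hT, weightedSummable_deriv_iff.1 hb'⟩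

theorem comp_mem_nat (h : IsAffineModel s t Φ) (N : ℕ) :
    ∀ f : WeightedDirichlet N, (fun z => f (Φ z)) ∈ weightedDirichletSubmodule N := by
  induction N with
  | zero =>
    rw [Nat.cast_zero]
    exact h.comp_mem_zero
  | succ N ih =>
    rw [Nat.cast_succ]
    exact h.comp_mem_succ ih

theorem formBound_nat (h : IsAffineModel s t Φ) (N : ℕ) :
    ∃ M, FormBound (compMatrix (1 - t) (s - 1 + t) (-t) (s + t)) N M := by
  obtain ⟨W, hW⟩ := exists_weightedComposition (fun z : 𝔻 => (-t * z + (s + t))⁻¹) Φ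
    fun f => inv_affine_mul_mem h.norm_lt (h.comp_mem_nat N f)
  refine ⟨_, formBound_of_operator W fun L α => coeff_eq _ ?_⟩
  convert HasTaylorSeries.sum (Finset.range L) (fun k _ => h.column k) α using 2 with z
  rw [hW, poly_apply, Finset.mul_sum]
  exact Finset.sum_congr rfl fun k _ => by ring

/-- The transposed matrix, divided by s, belongs to the affine model with parameters 1/s and (s - 1
+ t)/s, for which the positive exponent N is already known. -/
theorem formBound_neg_nat (hs : 0 < s) (ht : 1 < s + 2 * t.re) (N : ℕ) :
    ∃ M, FormBound (compMatrix (1 - t) (s - 1 + t) (-t) (s + t)) (-N) M := by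
  have hs0 : (s : ℂ) ≠ 0 := ofReal_ne_zero.2 hs.ne'
  have ht' : 1 < s⁻¹ + 2 * ((s - 1 + t) / s).re := by
    rw [div_ofReal_re, add_re, sub_re, ofReal_re, one_re]
    have : s⁻¹ + 2 * ((s - 1 + t.re) / s) = 1 + (s + 2 * t.re - 1) / s := by
      field_simp
      ring
    rw [this]
    have : 0 < (s + 2 * t.re - 1) / s := div_pos (by linarith) hs
    linarith
  obtain ⟨Ψ, hΨ⟩ := exists_isAffineModel (inv_pos.2 hs) ht'
  obtain ⟨M, hM⟩ := hΨ.formBound_nat N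
  refine ⟨‖(s : ℂ)⁻¹‖ * M, ?_⟩
  convert (hM.const_mul ((s : ℂ)⁻¹)).transpose using 1
  ext n k
  have e := compMatrix_mul (inv_ne_zero hs0) (1 - t) t (-(s - 1 + t)) (s + t) k n
  rw [inv_inv] at e
  have e1 : (1 : ℂ) - (s - 1 + t) / s = (s : ℂ)⁻¹ * (1 - t) := by field_simp; ring
  have e2 : ((s⁻¹ : ℝ) : ℂ) - 1 + (s - 1 + t) / s = (s : ℂ)⁻¹ * t := by
    push_cast; field_simp; ring
  have e3 : -(((s : ℂ) - 1 + t) / s) = (s : ℂ)⁻¹ * (-(s - 1 + t)) := by field_simp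
  have e4 : ((s⁻¹ : ℝ) : ℂ) + (s - 1 + t) / s = (s : ℂ)⁻¹ * (s + t) := by
    push_cast; field_simp; ring
  rw [e1, e2, e3, e4, e, inv_mul_cancel_left₀ hs0, compMatrix_transpose, neg_neg]

/-- The composition operator is bounded on every `S_ν`. -/
theorem comp_mem (h : IsAffineModel s t Φ) {ν : ℝ} (f : WeightedDirichlet ν) :
    (fun z => f (Φ z)) ∈ weightedDirichletSubmodule ν := by
  obtain ⟨N, hN⟩ := exists_nat_gt |ν|
  obtain ⟨M₁, h1⟩ := h.formBound_nat N
  obtain ⟨M₀, h0⟩ := formBound_neg_nat h.pos h.lt N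
  have hN' := abs_lt.1 hN
  have hK := (h0.mono (le_max_left M₀ M₁)).interpolate (h1.mono (le_max_right M₀ M₁))
    (by linarith) (ν := ν) ⟨hN'.1.le, hN'.2.le⟩
  -- The weight (cz + d)⁻¹, needed only for the symmetry under transposition, is removed by
  -- multiplication by cz + d.
  convert affine_mul_mem (-t) (s + t) (weightedComposition_mem_of_formBound hK h.column f)
    using 2 with z
  rw [mul_inv_cancel_left₀ (affine_ne_zero h.norm_lt z)]

end IsAffineModel

end AffineModel

/-! ### The eigenfunctions and their Taylor coefficients -/

/-- The Taylor coefficients of `(1 - z) ^ s`. -/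
def binomCoeff (s : ℂ) (n : ℕ) : ℂ := ∏ j ∈ Finset.range n, ((j : ℂ) - s) / (j + 1)

theorem binomCoeff_eq (s : ℂ) (n : ℕ) : binomCoeff s n = (-1) ^ n * Ring.choose s n := by
  have hfac : ∀ n : ℕ, (n.factorial : ℂ) * Ring.choose s n = (descPochhammer ℤ n).smeval s :=
    fun n => by rw [Ring.descPochhammer_eq_factorial_smul_choose, nsmul_eq_mul]
  induction n with
  | zero => simp [binomCoeff]
  | succ n ih =>
    rw [binomCoeff, Finset.prod_range_succ, ← binomCoeff, ih]
    have h1 := hfac (n + 1)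
    rw [descPochhammer_succ_right, Polynomial.smeval_mul, ← hfac n] at h1
    simp only [Polynomial.smeval_sub, Polynomial.smeval_X, pow_one, Polynomial.smeval_natCast,
      pow_zero, nsmul_eq_mul, mul_one, Nat.factorial_succ, Nat.cast_mul, Nat.cast_succ] at h1
    have hf : (n.factorial : ℂ) ≠ 0 := Nat.cast_ne_zero.2 n.factorial_ne_zero
    have hn : (n : ℂ) + 1 ≠ 0 := Nat.cast_add_one_ne_zero n
    have h2 : ((n : ℂ) + 1) * Ring.choose s (n + 1) = Ring.choose s n * (s - n) := by
      refine mul_left_cancel₀ hf ?_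
      linear_combination h1
    rw [← mul_div_assoc, div_eq_iff hn]
    linear_combination (-1) ^ n * h2

theorem differentiable_binomCoeff (n : ℕ) : Differentiable ℂ fun s => binomCoeff s n := by
  unfold binomCoeff
  fun_prop

theorem hasSum_binomCoeff (s : ℂ) {z : ℂ} (hz : ‖z‖ < 1) :
    HasSum (fun n => binomCoeff s n * z ^ n) ((1 - z) ^ s) := by
  have h := (one_add_cpow_hasFPowerSeriesOnBall_zero (a := s)).hasSum (y := -z) (by
    rw [← ENNReal.ofReal_one, Metric.eball_ofReal]
    simpa using hz)
  rw [zero_add, ← sub_eq_add_neg] at h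
  refine h.congr_fun fun n => ?_
  rw [binomialSeries_apply, binomCoeff_eq, List.ofFn_const, List.prod_replicate, smul_eq_mul,
    neg_pow z]
  ring

/-- Each factor is 1 - (1 + s)/(j + 1), of modulus at most exp(-(σ + 1)/(j + 1) + O(j + 1)⁻²), and
the harmonic sum is log(n + 1) up to a bounded error. Uniformity in s is what makes the later
pairings holomorphic. -/
theorem exists_norm_binomCoeff_le (σ R : ℝ) :
    ∃ C : ℝ, 0 ≤ C ∧ ∀ s : ℂ, σ ≤ s.re → ‖s‖ ≤ R → ∀ n : ℕ,
      ‖binomCoeff s n‖ ≤ C * ((n : ℝ) + 1) ^ (-(σ + 1)) := by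
  have hsum : Summable fun j : ℕ => 1 / ((j : ℝ) + 1) ^ 2 := by
    have := (summable_nat_add_iff 1).2 (Real.summable_one_div_nat_pow.2 one_lt_two)
    simpa using this
  set Z := ∑' j : ℕ, 1 / ((j : ℝ) + 1) ^ 2
  refine ⟨Real.exp (|σ + 1| + (1 + R) ^ 2 * Z), (Real.exp_pos _).le, fun s hs hR n => ?_⟩
  have hstep : ∀ j : ℕ, ‖((j : ℂ) - s) / (j + 1)‖ ≤
      Real.exp (-(σ + 1) * ((j + 1 : ℕ) : ℝ)⁻¹ + (1 + R) ^ 2 * (1 / ((j : ℝ) + 1) ^ 2)) := by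
    intro j
    have hj : (0 : ℝ) < (j : ℝ) + 1 := by positivity
    have hj' : (j : ℂ) + 1 ≠ 0 := Nat.cast_add_one_ne_zero j
    refine (pow_le_pow_iff_left₀ (norm_nonneg _) (Real.exp_pos _).le two_ne_zero).1 ?_
    rw [← Real.exp_nat_mul]
    have e1 : ‖((j : ℂ) - s) / (j + 1)‖ ^ 2 =
        1 - 2 * (1 + s.re) / (j + 1) + ‖1 + s‖ ^ 2 / (j + 1) ^ 2 := by
      have : ((j : ℂ) - s) / (j + 1) = ((j : ℂ) - s) / (((j : ℝ) + 1 : ℝ) : ℂ) := by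
        push_cast
        rfl
      rw [this, norm_div, norm_real, Real.norm_of_nonneg hj.le, div_pow, ← normSq_eq_norm_sq,
        ← normSq_eq_norm_sq, normSq_apply, normSq_apply]
      simp only [sub_re, sub_im, add_re, add_im, natCast_re, natCast_im, one_re, one_im]
      field_simp
      ring
    have e2 : ‖1 + s‖ ^ 2 ≤ (1 + R) ^ 2 :=
      pow_le_pow_left₀ (norm_nonneg _) ((norm_add_le _ _).trans (by simpa using hR)) 2
    have e3 : ‖1 + s‖ ^ 2 / ((j : ℝ) + 1) ^ 2 ≤ (1 + R) ^ 2 / ((j : ℝ) + 1) ^ 2 := by gcongr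
    have e4 : 2 * (1 + σ) / ((j : ℝ) + 1) ≤ 2 * (1 + s.re) / ((j : ℝ) + 1) := by gcongr
    have e5 : 0 ≤ (1 + R) ^ 2 / ((j : ℝ) + 1) ^ 2 := by positivity
    rw [e1]
    refine le_trans ?_ (Real.add_one_le_exp _)
    push_cast
    have e6 : (2 : ℝ) * (-(σ + 1) * ((j : ℝ) + 1)⁻¹ + (1 + R) ^ 2 * (1 / ((j : ℝ) + 1) ^ 2)) =
      -(2 * (1 + σ) / ((j : ℝ) + 1)) + 2 * ((1 + R) ^ 2 / ((j : ℝ) + 1) ^ 2) := by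
      field_simp
      ring
    rw [e6]
    linarith
  have hH : |(∑ j ∈ Finset.range n, ((j + 1 : ℕ) : ℝ)⁻¹) - Real.log ((n : ℝ) + 1)| ≤ 1 := by
    have h1 := log_add_one_le_harmonic n
    have h2 := harmonic_le_one_add_log n
    have h3 : ((harmonic n : ℚ) : ℝ) = ∑ j ∈ Finset.range n, ((j + 1 : ℕ) : ℝ)⁻¹ := by
      rw [harmonic]
      push_cast
      rfl
    rw [h3] at h1 h2
    push_cast at h1 h2 ⊢
    have h4 : Real.log n ≤ Real.log ((n : ℝ) + 1) := by
      rcases n.eq_zero_or_pos with rfl | hn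
      · simp
      · exact Real.log_le_log (by exact_mod_cast hn) (by linarith)
    exact abs_le.2 ⟨by linarith, by linarith⟩
  have hexp : ∑ j ∈ Finset.range n, (-(σ + 1) * ((j + 1 : ℕ) : ℝ)⁻¹ +
      (1 + R) ^ 2 * (1 / ((j : ℝ) + 1) ^ 2)) ≤
      (|σ + 1| + (1 + R) ^ 2 * Z) + Real.log ((n : ℝ) + 1) * -(σ + 1) := by
    rw [Finset.sum_add_distrib, ← Finset.mul_sum, ← Finset.mul_sum]
    have h1 : ∑ j ∈ Finset.range n, 1 / ((j : ℝ) + 1) ^ 2 ≤ Z :=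
      hsum.sum_le_tsum _ fun j _ => by positivity
    have h2 := mul_le_mul_of_nonneg_left h1 (sq_nonneg (1 + R))
    have h3 : -(σ + 1) * ((∑ j ∈ Finset.range n, ((j + 1 : ℕ) : ℝ)⁻¹) -
        Real.log ((n : ℝ) + 1)) ≤ |σ + 1| := by
      refine (le_abs_self _).trans ?_
      rw [abs_mul, abs_neg]
      exact mul_le_of_le_one_right (abs_nonneg _) hH
    linarith
  calc ‖binomCoeff s n‖ = ∏ j ∈ Finset.range n, ‖((j : ℂ) - s) / (j + 1)‖ := norm_prod _ _
    _ ≤ ∏ j ∈ Finset.range n, Real.exp (-(σ + 1) * ((j + 1 : ℕ) : ℝ)⁻¹ +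
        (1 + R) ^ 2 * (1 / ((j : ℝ) + 1) ^ 2)) :=
      Finset.prod_le_prod (fun j _ => norm_nonneg _) fun j _ => hstep j
    _ ≤ _ := by
      rw [← Real.exp_sum, Real.rpow_def_of_pos (by positivity), ← Real.exp_add]
      exact Real.exp_le_exp.2 hexp

/-- The Taylor coefficients of `(1 - z) ^ s (1 - q z) ^ (-s)`. -/
def eigenCoeff (q s : ℂ) (n : ℕ) : ℂ :=
  ∑ x ∈ Finset.HasAntidiagonal.antidiagonal n, binomCoeff s x.1 * (binomCoeff (-s) x.2 * q ^ x.2)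

theorem differentiable_eigenCoeff (q : ℂ) (n : ℕ) : Differentiable ℂ fun s => eigenCoeff q s n := by
  unfold eigenCoeff
  refine Differentiable.fun_sum fun x _ => (differentiable_binomCoeff _).mul
    (((differentiable_binomCoeff _).comp differentiable_neg).mul_const _)

/-- The function `((1 - z) / (1 - q z)) ^ s`. -/
def eigenFun (q s : ℂ) (z : 𝔻) : ℂ := (1 - (z : ℂ)) ^ s * (1 - q * (z : ℂ)) ^ (-s)

theorem norm_mul_coe_lt_one {q : ℂ} (hq : ‖q‖ < 1) (z : 𝔻) : ‖q * z‖ < 1 := by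
  rw [norm_mul]
  exact mul_lt_one_of_nonneg_of_lt_one_left (norm_nonneg _) hq z.norm_lt_one.le

theorem hasTaylorSeries_eigenFun {q : ℂ} (hq : ‖q‖ < 1) (s : ℂ) :
    HasTaylorSeries (eigenFun q s) (eigenCoeff q s) := fun z => by
  have h1 := hasSum_binomCoeff s z.norm_lt_one
  have h2 := hasSum_binomCoeff (-s) (norm_mul_coe_lt_one hq z)
  have h3 := h1.summable.norm
  have h4 := h2.summable.norm
  have h5 := (summable_norm_sum_mul_antidiagonal_of_summable_norm h3 h4).of_norm.hasSum
  rw [← tsum_mul_tsum_eq_tsum_sum_antidiagonal_of_summable_norm h3 h4, h1.tsum_eq,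
    h2.tsum_eq] at h5
  refine h5.congr_fun fun n => ?_
  rw [eigenCoeff, Finset.sum_mul]
  refine Finset.sum_congr rfl fun x hx => ?_
  rw [← Finset.HasAntidiagonal.mem_antidiagonal.1 hx, pow_add, mul_pow]
  ring

/-- Since |q| < 1, the second factor of the convolution decays geometrically and the decay rate of
the coefficients of (1 - z)^s survives. -/
theorem exists_norm_eigenCoeff_le {q : ℂ} (hq : ‖q‖ < 1) (σ R : ℝ) :
    ∃ C : ℝ, 0 ≤ C ∧ ∀ s : ℂ, σ ≤ s.re → ‖s‖ ≤ R → ∀ n : ℕ,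
      ‖eigenCoeff q s n‖ ≤ C * ((n : ℝ) + 1) ^ (-(σ + 1)) := by
  obtain ⟨C₁, hC₁, h1⟩ := exists_norm_binomCoeff_le σ R
  -- The lower bound -R serves for Re(-s), because Re s ≤ |s| ≤ R.
  obtain ⟨C₂, hC₂, h2⟩ := exists_norm_binomCoeff_le (-R) R
  have hs := summable_rpow_mul_geometric (|-(σ + 1)| + -(-R + 1)) (norm_nonneg q) hq
  set Z := ∑' k : ℕ, ((k : ℝ) + 1) ^ (|-(σ + 1)| + -(-R + 1)) * ‖q‖ ^ k
  have hZ : 0 ≤ Z := tsum_nonneg fun k => by positivity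
  refine ⟨C₁ * C₂ * Z, by positivity, fun s hσ hR n => ?_⟩
  have h3 : ∀ x ∈ Finset.HasAntidiagonal.antidiagonal n,
      ‖binomCoeff s x.1 * (binomCoeff (-s) x.2 * q ^ x.2)‖ ≤ C₁ * C₂ * ((n : ℝ) + 1) ^ (-(σ + 1)) *
        (((x.2 : ℝ) + 1) ^ (|-(σ + 1)| + -(-R + 1)) * ‖q‖ ^ x.2) := by
    intro x hx
    have e1 := h1 s hσ hR x.1
    have e2 := h2 (-s) (by simpa using (re_le_norm s).trans hR) (by simpa using hR) x.2
    have e3 := rpow_le_shift (-(σ + 1)) x.2 x.1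
    rw [Finset.HasAntidiagonal.mem_antidiagonal.1 hx] at e3
    rw [norm_mul, norm_mul, norm_pow, Real.rpow_add (by positivity)]
    calc _ ≤ (C₁ * (((x.2 : ℝ) + 1) ^ |-(σ + 1)| * ((n : ℝ) + 1) ^ (-(σ + 1)))) *
          ((C₂ * ((x.2 : ℝ) + 1) ^ (-(-R + 1))) * ‖q‖ ^ x.2) := by
          gcongr
          exact e1.trans (by gcongr)
      _ = _ := by ring
  calc ‖eigenCoeff q s n‖ ≤ ∑ x ∈ Finset.HasAntidiagonal.antidiagonal n, C₁ * C₂ * ((n : ℝ) + 1) ^ (-(σ + 1)) *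
        (((x.2 : ℝ) + 1) ^ (|-(σ + 1)| + -(-R + 1)) * ‖q‖ ^ x.2) := norm_sum_le_of_le _ h3
    _ = C₁ * C₂ * ((n : ℝ) + 1) ^ (-(σ + 1)) * ∑ k ∈ Finset.range (n + 1),
        (((k : ℝ) + 1) ^ (|-(σ + 1)| + -(-R + 1)) * ‖q‖ ^ k) := by
      rw [← Finset.mul_sum, ← Finset.Nat.sum_antidiagonal_swap]
      congr 1
      exact Finset.Nat.sum_antidiagonal_eq_sum_range_succ_mk _ _
    _ ≤ C₁ * C₂ * ((n : ℝ) + 1) ^ (-(σ + 1)) * Z := by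
      gcongr
      exact hs.sum_le_tsum _ fun k _ => by positivity
    _ = _ := by ring

theorem summable_rpow_natCast_add_one {p : ℝ} :
    (Summable fun n : ℕ => ((n : ℝ) + 1) ^ p) ↔ p < -1 := by
  rw [← Real.summable_nat_rpow, ← summable_nat_add_iff 1 (f := fun n : ℕ => (n : ℝ) ^ p)]
  simp only [Nat.cast_add, Nat.cast_one]

theorem sq_mul_weight (C σ ν : ℝ) (n : ℕ) :
    (C * ((n : ℝ) + 1) ^ (-(σ + 1))) ^ 2 * ((n : ℝ) + 1) ^ (2 * ν) =
      C ^ 2 * ((n : ℝ) + 1) ^ (2 * -(σ + 1) + 2 * ν) := by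
  rw [mul_pow, rpow_natCast_add_one_sq, mul_assoc, ← Real.rpow_add (by positivity)]

theorem weightedSummable_eigenCoeff {q : ℂ} (hq : ‖q‖ < 1) {ν : ℝ} {s : ℂ}
    (hs : ν - 1 / 2 < s.re) : WeightedSummable ν (eigenCoeff q s) := by
  obtain ⟨C, hC, h⟩ := exists_norm_eigenCoeff_le hq s.re ‖s‖
  refine Summable.of_nonneg_of_le (fun n => by positivity) (fun n => ?_)
    ((summable_rpow_natCast_add_one.2 (?_ : 2 * -(s.re + 1) + 2 * ν < -1)).mul_left (C ^ 2))
  · rw [← sq_mul_weight]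
    have := h s le_rfl le_rfl n
    gcongr
  · linarith

/-- The pairing of a vector of `S_ν` with the functions `((1 - z) / (1 - q z)) ^ s` is holomorphic
in `s`. -/
theorem differentiableOn_inner_eigenCoeff {q : ℂ} (hq : ‖q‖ < 1) {ν : ℝ} {a : ℕ → ℂ}
    (ha : WeightedSummable ν a) :
    DifferentiableOn ℂ (fun s => ∑' n : ℕ, starRingEnd ℂ (a n) * eigenCoeff q s n *
      ((((n : ℝ) + 1) ^ (2 * ν) : ℝ) : ℂ)) {s | ν - 1 / 2 < s.re} := by
  intro s₀ hs₀
  -- A margin σ strictly below Re s₀ gives one summable majorant on a whole neighbourhood of s₀.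
  obtain ⟨σ, hσ1, hσ2⟩ := exists_between (Set.mem_ofPred.1 hs₀)
  obtain ⟨C, hC, h⟩ := exists_norm_eigenCoeff_le hq σ (‖s₀‖ + 1)
  have hU : IsOpen ({s : ℂ | σ < s.re} ∩ Metric.ball 0 (‖s₀‖ + 1)) :=
    (isOpen_lt continuous_const continuous_re).inter Metric.isOpen_ball
  have hu : Summable fun n : ℕ => ‖a n‖ ^ 2 * ((n : ℝ) + 1) ^ (2 * ν) +
      C ^ 2 * ((n : ℝ) + 1) ^ (2 * -(σ + 1) + 2 * ν) :=
    Summable.add ha ((summable_rpow_natCast_add_one.2 (by linarith)).mul_left _)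
  have key := differentiableOn_tsum_of_summable_norm (F := fun (n : ℕ) (s : ℂ) =>
    starRingEnd ℂ (a n) * eigenCoeff q s n * ((((n : ℝ) + 1) ^ (2 * ν) : ℝ) : ℂ)) hu
    (fun n => (((differentiable_eigenCoeff q n).const_mul _).mul_const _).differentiableOn) hU
    (fun n s hs => ?_)
  · refine (key.differentiableAt (hU.mem_nhds ⟨hσ2, ?_⟩)).differentiableWithinAt
    simp
  · have h1 := h s hs.1.le (mem_ball_zero_iff.1 hs.2).le n
    have hw : (0 : ℝ) ≤ ((n : ℝ) + 1) ^ (2 * ν) := by positivity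
    rw [norm_mul, norm_mul, norm_real, Real.norm_of_nonneg hw, RCLike.norm_conj, ← sq_mul_weight,
      ← add_mul]
    refine mul_le_mul_of_nonneg_right ?_ hw
    set y := C * ((n : ℝ) + 1) ^ (-(σ + 1))
    have h2 : ‖a n‖ * ‖eigenCoeff q s n‖ ≤ ‖a n‖ * y := by gcongr
    nlinarith [sq_nonneg (‖a n‖ - y), sq_nonneg (‖a n‖ + y)]

theorem one_sub_mul_re_pos {q : ℂ} (hq : ‖q‖ ≤ 1) (z : 𝔻) : 0 < (1 - q * (z : ℂ)).re := by
  have h : ‖q * (z : ℂ)‖ < 1 := by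
    rw [norm_mul]
    exact mul_lt_one_of_nonneg_of_lt_one_right hq (norm_nonneg _) z.norm_lt_one
  rw [sub_re, one_re]
  linarith [re_le_norm (q * (z : ℂ))]

theorem one_sub_mul_ne_zero {q : ℂ} (hq : ‖q‖ ≤ 1) (z : 𝔻) : 1 - q * (z : ℂ) ≠ 0 := fun h => by
  have := one_sub_mul_re_pos hq z
  rw [h, zero_re] at this
  exact this.false

theorem one_sub_coe_ne_zero (z : 𝔻) : 1 - (z : ℂ) ≠ 0 := by
  simpa using one_sub_mul_ne_zero (q := 1) (by simp) z

theorem abs_log_im_lt {w : ℂ} (hw : 0 < w.re) : |(log w).im| < Real.pi / 2 := by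
  rw [log_im]
  exact abs_arg_lt_pi_div_two_iff.2 (Or.inl hw)

/-! ### The hyperbolic model -/

/-- The disc self-map with attractive fixed point `1` of multiplier `μ`, the other fixed point
being `1 / q`. -/
structure IsHyperbolicModel (μ : ℝ) (q : ℂ) (Φ : 𝔻 → 𝔻) : Prop where
  pos : 0 < μ
  lt_one : μ < 1
  norm_lt : ‖q‖ < 1
  map_eq : ∀ z : 𝔻, (1 - (Φ z : ℂ)) / (1 - q * Φ z) = μ * ((1 - z) / (1 - q * z))

theorem one_sub_ne_zero_of_norm_lt {q : ℂ} (hq : ‖q‖ < 1) : 1 - q ≠ 0 := fun h => by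
  rw [← sub_eq_zero.1 h, norm_one] at hq
  exact hq.false

namespace IsHyperbolicModel

open WeightedDirichlet

variable {μ : ℝ} {q : ℂ} {Φ : 𝔻 → 𝔻} {ν : ℝ}

theorem re_add_half_pos {q : ℂ} (hq : ‖q‖ < 1) : 0 < 1 + 2 * (q / (1 - q)).re := by
  have h0 := one_sub_ne_zero_of_norm_lt hq
  have h1 : 0 < normSq (1 - q) := normSq_pos.2 h0
  have h2 : 1 + 2 * (q / (1 - q)).re = (1 - ‖q‖ ^ 2) / normSq (1 - q) := by
    rw [div_re, eq_div_iff h1.ne', ← normSq_eq_norm_sq]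
    field_simp
    simp only [normSq_apply, sub_re, sub_im, one_re, one_im]
    ring
  rw [h2]
  have := norm_nonneg q
  exact div_pos (by nlinarith) h1

/-- With τ = q/(1 - q), the reciprocal of (1 - z)/(1 - qz) is (1 - q)(W + τ), so the map multiplies
W + τ by 1/μ. -/
theorem isAffineModel (h : IsHyperbolicModel μ q Φ) :
    IsAffineModel μ⁻¹ ((μ⁻¹ - 1) * (q / (1 - q))) Φ := by
  have hs : 1 < μ⁻¹ := (one_lt_inv₀ h.pos).2 h.lt_one
  have hre := re_add_half_pos h.norm_lt
  have hlt : 1 < μ⁻¹ + 2 * (((μ⁻¹ - 1 : ℝ) : ℂ) * (q / (1 - q))).re := by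
    rw [re_ofReal_mul]
    nlinarith [mul_pos (sub_pos.2 hs) hre]
  rw [ofReal_sub, ofReal_one] at hlt
  refine ⟨inv_pos.2 h.pos, hlt, fun z => ?_⟩
  have hne := affine_ne_zero (affineModel_norm_lt (inv_pos.2 h.pos) hlt) z
  have h0 := one_sub_ne_zero_of_norm_lt h.norm_lt
  have h1 := one_sub_mul_ne_zero h.norm_lt.le z
  have h2 := one_sub_mul_ne_zero h.norm_lt.le (Φ z)
  have hμ : (μ : ℂ) ≠ 0 := ofReal_ne_zero.2 h.pos.ne'
  have h3 := h.map_eq z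
  rw [eq_div_iff hne]
  rw [← mul_div_assoc, div_eq_div_iff h2 h1] at h3
  push_cast
  field_simp
  linear_combination -h3

/-- The functions `((1 - z) / (1 - q z)) ^ s` are eigenfunctions of composition. -/
theorem eigenFun_comp (h : IsHyperbolicModel μ q Φ) (s : ℂ) (z : 𝔻) :
    eigenFun q s (Φ z) = exp (s * Real.log μ) * eigenFun q s z := by
  have hre1 : ∀ z : 𝔻, 0 < (1 - (z : ℂ)).re := fun z => by
    simpa using one_sub_mul_re_pos (q := 1) (by simp) z
  have hform : ∀ z : 𝔻, eigenFun q s z =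
      exp (s * (log (1 - z) - log (1 - q * z))) := fun z => by
    rw [eigenFun, cpow_def_of_ne_zero (one_sub_coe_ne_zero z),
      cpow_def_of_ne_zero (one_sub_mul_ne_zero h.norm_lt.le z), ← exp_add]
    congr 1
    ring
  have him : ∀ z : 𝔻, |(log (1 - (z : ℂ)) - log (1 - q * z)).im| < Real.pi := fun z => by
    have h1 := abs_lt.1 (abs_log_im_lt (hre1 z))
    have h2 := abs_lt.1 (abs_log_im_lt (one_sub_mul_re_pos h.norm_lt.le z))
    rw [sub_im]
    exact abs_lt.2 ⟨by linarith, by linarith⟩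
  have hexp : ∀ z : 𝔻, exp (log (1 - (z : ℂ)) - log (1 - q * z)) = (1 - z) / (1 - q * z) :=
    fun z => by
      rw [exp_sub, exp_log (one_sub_coe_ne_zero z), exp_log (one_sub_mul_ne_zero h.norm_lt.le z)]
  -- Both 1 - z and 1 - qz have positive real part, so the difference of the logarithms has
  -- imaginary part in (-π, π) and no branch jump occurs.
  have hadd : log (1 - (Φ z : ℂ)) - log (1 - q * Φ z) =
      (Real.log μ : ℂ) + (log (1 - (z : ℂ)) - log (1 - q * z)) := by
    have h1 := abs_lt.1 (him (Φ z))
    have h2 := abs_lt.1 (him z)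
    refine exp_inj_of_neg_pi_lt_of_le_pi h1.1 h1.2.le ?_ ?_ ?_
    · rw [add_im, ofReal_im, zero_add]
      exact h2.1
    · rw [add_im, ofReal_im, zero_add]
      exact h2.2.le
    · rw [exp_add, hexp, hexp, ← ofReal_exp, Real.exp_log h.pos, h.map_eq]
  rw [hform, hform, hadd, ← exp_add]
  congr 1
  ring

end IsHyperbolicModel

/-! ### Recurrence from dense periodic vectors -/

section Periodic

variable {H : Type*} [NormedAddCommGroup H] [NormedSpace ℂ H]

/-- The vectors which are fixed by some positive power of an operator. -/
def periodicVectors (T : H →L[ℂ] H) : Submodule ℂ H where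
  carrier := {x | ∃ n : ℕ, 0 < n ∧ (T ^ n) x = x}
  zero_mem' := ⟨1, one_pos, map_zero _⟩
  add_mem' := by
    have hmul : ∀ (x : H) (n k : ℕ), (T ^ n) x = x → (T ^ (n * k)) x = x := fun x n k hx => by
      induction k with
      | zero => simp
      | succ k ih => rw [Nat.mul_succ, pow_add, mul_apply_eq_comp, hx, ih]
    rintro x y ⟨n, hn, hx⟩ ⟨k, hk, hy⟩
    exact ⟨n * k, Nat.mul_pos hn hk, by
      rw [map_add, hmul x n k hx, mul_comm n k, hmul y k n hy]⟩
  smul_mem' := by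
    rintro c x ⟨n, hn, hx⟩
    exact ⟨n, hn, by rw [map_smul, hx]⟩

theorem isRecurrent_of_dense_periodicVectors {T : H →L[ℂ] H}
    (h : Dense (periodicVectors T : Set H)) : IsRecurrent T := by
  intro U hU hne
  obtain ⟨x, hxU, n, hn, hx⟩ := h.inter_open_nonempty U hU hne
  exact ⟨n, hn, x, ⟨x, hxU, hx⟩, hxU⟩

end Periodic

/-! ### Density of the positive powers of (1 - z)/(1 - qz) -/

namespace WeightedDirichlet

variable {ν : ℝ} {q : ℂ}

theorem inner_eq_of_hasTaylorSeries (x f : WeightedDirichlet ν) {a : ℕ → ℂ}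
    (ha : HasTaylorSeries f a) : inner ℂ x f = ∑' n : ℕ,
      starRingEnd ℂ (x.coeff n) * a n * ((((n : ℝ) + 1) ^ (2 * ν) : ℝ) : ℂ) := by
  rw [inner_def, f.coeff_eq ha]

/-- The constant function `1`. -/
def one (ν : ℝ) : WeightedDirichlet ν := ofMem _ (one_mem ν)

theorem one_apply (z : 𝔻) : one ν z = 1 := rfl

/-- The function `z ↦ 1 / (1 - p z)`. -/
def cauchyKernel (ν : ℝ) (p : 𝔻) : WeightedDirichlet ν := ofCoeff _ (weightedSummable_pow ν p)

theorem hasTaylorSeries_geometric (p : 𝔻) :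
    HasTaylorSeries (fun z : 𝔻 => (1 - (p : ℂ) * z)⁻¹) fun n => (p : ℂ) ^ n := fun z => by
  simpa only [mul_pow] using hasSum_geometric_of_norm_lt_one (norm_mul_coe_lt_one p.norm_lt_one z)

theorem cauchyKernel_apply (p z : 𝔻) : cauchyKernel ν p z = (1 - (p : ℂ) * z)⁻¹ :=
  ((weightedSummable_pow ν p).hasTaylorSeries z).unique (hasTaylorSeries_geometric p z)

theorem exists_mul_operator (hq : ‖q‖ < 1) : ∃ M : WeightedDirichlet ν →L[ℂ] WeightedDirichlet ν,
    ∀ f z, M f z = (1 - (z : ℂ)) / (1 - q * z) * f z := by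
  refine exists_weightedComposition (fun z : 𝔻 => (1 - (z : ℂ)) / (1 - q * z)) id fun f => ?_
  convert inv_one_sub_mul_mem hq (affine_mul_mem (-1) 1 f.2) using 2 with z
  simp only [id, div_eq_mul_inv]
  ring

/-- If a vector is orthogonal to the positive powers of `(1 - z) / (1 - q z)`, then its pairing
with the Cauchy kernels near `q` is that of a multiple of the evaluation at `1`. -/
theorem inner_cauchyKernel_eq (hq : ‖q‖ < 1) {M : WeightedDirichlet ν →L[ℂ] WeightedDirichlet ν}
    (hM : ∀ f z, M f z = (1 - (z : ℂ)) / (1 - q * z) * f z) {x : WeightedDirichlet ν}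
    (hx : ∀ k : ℕ, inner ℂ x ((M ^ (k + 1)) (one ν)) = 0) :
    ∀ᶠ p in 𝓝 q, ∀ p' : 𝔻, (p' : ℂ) = p →
      inner ℂ x (cauchyKernel ν p') = inner ℂ x (one ν) / (1 - p) := by
  have hq0 := one_sub_ne_zero_of_norm_lt hq
  -- V is multiplication by z/(1 - qz). It is affine in M, so it preserves the orthogonality
  -- property Q and acts on the pairing with x as the scalar 1/(1 - q).
  let V : WeightedDirichlet ν →L[ℂ] WeightedDirichlet ν := (1 - q)⁻¹ • (1 - M)
  have hVe : ∀ u, V u = (1 - q)⁻¹ • (u - M u) := fun u => rfl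
  have hV : ∀ (f : WeightedDirichlet ν) (z : 𝔻), V f z = z / (1 - q * z) * f z := fun f z => by
    have := one_sub_mul_ne_zero hq.le z
    rw [hVe, smul_apply, sub_apply, hM]
    field_simp
    ring
  let Q : WeightedDirichlet ν → Prop := fun u => ∀ k : ℕ, inner ℂ x ((M ^ (k + 1)) u) = 0
  have hQV : ∀ u, Q u → Q (V u) := fun u hu k => by
    rw [hVe, map_smul, map_sub, ← mul_apply_eq_comp, ← pow_succ, inner_smul_right,
      inner_sub_right, hu k, hu (k + 1), sub_zero, mul_zero]
  have hiV : ∀ u, Q u → inner ℂ x (V u) = (1 - q)⁻¹ * inner ℂ x u := fun u hu => by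
    have := hu 0
    rw [zero_add, pow_one] at this
    rw [hVe, inner_smul_right, inner_sub_right, this, sub_zero]
  have hQadd : ∀ u v (c : ℂ), Q u → Q v → Q (u + c • v) := fun u v c hu hv k => by
    rw [map_add, map_smul, inner_add_right, inner_smul_right, hu k, hv k, mul_zero, add_zero]
  -- g is the Cauchy kernel 1/(1 - qz). The kernel at p solves k = g + (p - q)Vk, hence is a Neumann
  -- series in V for p near q.
  let g : WeightedDirichlet ν := one ν + q • V (one ν)
  have hQg : Q g := hQadd _ _ q hx (hQV _ hx)
  have hev : ∀ᶠ p in 𝓝 q, ‖(p - q) • V‖ < 1 := by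
    have : Filter.Tendsto (fun p : ℂ => ‖(p - q) • V‖) (𝓝 q) (𝓝 0) := by
      have h : Continuous fun p : ℂ => ‖(p - q) • V‖ := by fun_prop
      have h0 : ‖(q - q) • V‖ = 0 := by
        rw [sub_self]
        exact norm_eq_zero.2 (zero_smul ℂ V)
      exact h0 ▸ h.tendsto q
    exact this.eventually_lt_const one_pos
  filter_upwards [hev] with p hp p' hpp
  have hp0 : 1 - p ≠ 0 := hpp ▸ one_sub_ne_zero_of_norm_lt p'.norm_lt_one
  set A := (p - q) • V with hA
  let k := (∑' i : ℕ, A ^ i) g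
  have hk : k = g + (p - q) • V k := by
    have h1 := congrArg (fun B => B g) (mul_neg_geom_series A hp)
    simp only [sub_mul, one_mul] at h1
    exact (sub_eq_iff_eq_add.1 h1 :)
  have hkK : k = cauchyKernel ν p' := ext fun z => by
    have h1 : k z = (g + (p - q) • V k) z := congrArg (fun u : WeightedDirichlet ν => u z) hk
    rw [add_apply, smul_apply, hV, add_apply, smul_apply, hV, one_apply] at h1
    have h2 := one_sub_mul_ne_zero hq.le z
    have h3 := one_sub_mul_ne_zero p'.norm_lt_one.le z
    rw [cauchyKernel_apply, eq_comm, inv_eq_iff_eq_inv, eq_comm, inv_eq_of_mul_eq_one_left]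
    rw [hpp] at h3 ⊢
    field_simp at h1
    linear_combination h1
  have hQk : Q k := fun j => by
    have hs := (summable_geometric_of_norm_lt_one hp).hasSum
    have hAQ : ∀ i : ℕ, Q ((A ^ i) g) := fun i => by
      induction i with
      | zero => exact hQg
      | succ i ih =>
        rw [pow_succ', mul_apply_eq_comp, hA, _root_.smul_apply]
        have := hQadd 0 _ (p - q) (fun k => by simp) (hQV _ ih)
        rwa [zero_add] at this
    have h1 := (((hs.mapL (ContinuousLinearMap.apply ℂ _ g)).mapL (M ^ (j + 1))).mapL (innerSL ℂ x))
    refine h1.unique (hasSum_zero.congr_fun fun i => ?_)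
    exact hAQ i j
  have h1 : inner ℂ x k = inner ℂ x (g + (p - q) • V k) := congrArg _ hk
  rw [inner_add_right, inner_smul_right, hiV _ hQk, inner_add_right, inner_smul_right,
    hiV _ hx] at h1
  rw [← hkK, eq_div_iff hp0]
  field_simp at h1
  linear_combination h1

/-- Density of the polynomials in `(1 - z) / (1 - q z)` without constant term. -/
theorem eq_zero_of_inner_pow_eq_zero (hν : ν ≤ 1 / 2) (hq : ‖q‖ < 1)
    {M : WeightedDirichlet ν →L[ℂ] WeightedDirichlet ν}
    (hM : ∀ f z, M f z = (1 - (z : ℂ)) / (1 - q * z) * f z) {x : WeightedDirichlet ν}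
    (hx : ∀ k : ℕ, inner ℂ x ((M ^ (k + 1)) (one ν)) = 0) : x = 0 := by
  set c := inner ℂ x (one ν) with hc
  let b : ℕ → ℂ := fun n => starRingEnd ℂ (x.coeff n) * ((((n : ℝ) + 1) ^ (2 * ν) : ℝ) : ℂ)
  have hb : HasTaylorSeries (fun p => inner ℂ x (cauchyKernel ν p)) b := fun p => by
    have h := (x.weightedSummable_coeff.inner (cauchyKernel ν p).weightedSummable_coeff).hasSum
    rw [← inner_def] at h
    refine h.congr_fun fun n => ?_
    rw [cauchyKernel, coeff_ofCoeff]
    ring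
  obtain ⟨F, hF, hFb⟩ := hb.exists_differentiableOn
  have hG : DifferentiableOn ℂ (fun p : ℂ => c / (1 - p)) (Metric.ball 0 1) := fun p hp => by
    have := one_sub_ne_zero_of_norm_lt (mem_ball_zero_iff.1 hp)
    fun_prop (disch := assumption)
  have hqm : q ∈ Metric.ball (0 : ℂ) 1 := mem_ball_zero_iff.2 hq
  have hEq := (hF.analyticOnNhd Metric.isOpen_ball).eqOn_of_preconnected_of_eventuallyEq
    (hG.analyticOnNhd Metric.isOpen_ball) (convex_ball 0 1).isPreconnected hqm (by
      filter_upwards [inner_cauchyKernel_eq hq hM hx, Metric.isOpen_ball.mem_nhds hqm] with p hp hpm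
      have h1 := hFb (UnitDisc.mk p (mem_ball_zero_iff.1 hpm))
      rw [hp _ (UnitDisc.coe_mk _ _)] at h1
      exact h1)
  -- All monomials have the same pairing c with x: formally x is c times evaluation at 1.
  have hbc : b = fun _ => c := hb.unique fun p => by
    have h1 : F p = c / (1 - p) := hEq (mem_ball_zero_iff.2 p.norm_lt_one)
    simp only [← hFb, h1, div_eq_mul_inv]
    exact (hasSum_geometric_of_norm_lt_one p.norm_lt_one).mul_left c
  have hw : ∀ n : ℕ, ‖x.coeff n‖ * ((n : ℝ) + 1) ^ (2 * ν) = ‖c‖ := fun n => by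
    rw [← congrFun hbc n, norm_mul, norm_real, RCLike.norm_conj,
      Real.norm_of_nonneg (by positivity)]
  have hc0 : ‖c‖ = 0 := by
    by_contra hne
    have h1 : Summable fun n : ℕ => ‖c‖ ^ 2 * ((n : ℝ) + 1) ^ (-(2 * ν)) := by
      refine x.weightedSummable_coeff.congr fun n => ?_
      rw [← hw n, Real.rpow_neg (by positivity)]
      have : ((n : ℝ) + 1) ^ (2 * ν) ≠ 0 := by positivity
      field_simp
    -- A nonzero c would make ∑ (n + 1)^(-2ν) converge, which fails exactly when ν ≤ 1/2.
    rw [summable_mul_left_iff (pow_ne_zero 2 hne), summable_rpow_natCast_add_one] at h1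
    linarith
  refine eq_zero_of_coeff x (funext fun n => ?_)
  have h1 := hw n
  rw [hc0] at h1
  have : ((n : ℝ) + 1) ^ (2 * ν) ≠ 0 := by positivity
  simpa [this] using h1

end WeightedDirichlet

/-! ### Sufficiency of the condition -/

namespace IsHyperbolicModel

open WeightedDirichlet

variable {μ : ℝ} {q : ℂ} {Φ : 𝔻 → 𝔻} {ν : ℝ}

theorem isRecurrent (h : IsHyperbolicModel μ q Φ) {lam : ℂ} (hν : ν ≤ 1 / 2)
    (hlam : μ ^ ((1 - 2 * ν) / 2) < ‖lam‖) {T : WeightedDirichlet ν →L[ℂ] WeightedDirichlet ν}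
    (hT : ∀ (f : WeightedDirichlet ν) (z : 𝔻), T f z = lam * f (Φ z)) : IsRecurrent T := by
  refine isRecurrent_of_dense_periodicVectors ?_
  rw [Submodule.dense_iff_topologicalClosure_eq_top, Submodule.topologicalClosure_eq_top_iff,
    Submodule.eq_bot_iff]
  intro x hx
  obtain ⟨M, hM⟩ := exists_mul_operator (ν := ν) h.norm_lt
  refine eq_zero_of_inner_pow_eq_zero hν h.norm_lt hM ?_
  have hlogμ : Real.log μ < 0 := Real.log_neg h.pos h.lt_one
  have hlogμ' : (Real.log μ : ℂ) ≠ 0 := ofReal_ne_zero.2 hlogμ.ne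
  have hlam0 : 0 < ‖lam‖ := (Real.rpow_nonneg h.pos.le _).trans_lt hlam
  let E : ∀ s : ℂ, ν - 1 / 2 < s.re → WeightedDirichlet ν := fun s hs =>
    ofMem _ ⟨_, hasTaylorSeries_eigenFun h.norm_lt s, weightedSummable_eigenCoeff h.norm_lt hs⟩
  let G : ℂ → ℂ := fun s => ∑' n : ℕ, starRingEnd ℂ (x.coeff n) * eigenCoeff q s n *
      ((((n : ℝ) + 1) ^ (2 * ν) : ℝ) : ℂ)
  have hGE : ∀ s hs, inner ℂ x (E s hs) = G s := fun s hs =>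
    inner_eq_of_hasTaylorSeries x (E s hs) (hasTaylorSeries_eigenFun h.norm_lt s)
  have hTE : ∀ s hs (n : ℕ), (T ^ n) (E s hs) = (lam * exp (s * Real.log μ)) ^ n • E s hs := by
    intro s hs n
    induction n with
    | zero => simp
    | succ n ih =>
      rw [pow_succ', mul_apply_eq_comp, ih, map_smul, pow_succ, mul_smul]
      congr 1
      ext z
      rw [hT, WeightedDirichlet.smul_apply, mul_assoc]
      exact congrArg _ (h.eigenFun_comp s z)
  -- S k solves λμ^s = exp(2πi/(k + 1)). All S k lie on one vertical line inside the half-plane Re s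
  -- > ν - 1/2, by the hypothesis on |λ|, and they accumulate at s₀.
  let S : ℕ → ℂ := fun k => (2 * Real.pi * I * ((1 / ((k : ℝ) + 1) : ℝ) : ℂ) - log lam) / Real.log μ
  have hSre : ∀ k, (S k).re = -Real.log ‖lam‖ / Real.log μ := fun k => by
    simp only [S]
    rw [div_ofReal_re, sub_re, re_mul_ofReal, log_re]
    simp
  have hre : ν - 1 / 2 < -Real.log ‖lam‖ / Real.log μ := by
    rw [lt_div_iff_of_neg hlogμ]
    have := Real.log_lt_log (Real.rpow_pos_of_pos h.pos _) hlam
    rw [Real.log_rpow h.pos] at this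
    linarith
  have hSE : ∀ k, ν - 1 / 2 < (S k).re := fun k => hre.trans_eq (hSre k).symm
  have hS0 : ∀ k, G (S k) = 0 := fun k => by
    rw [← hGE (S k) (hSE k)]
    refine (Submodule.mem_orthogonal' _ _).1 hx _ ⟨k + 1, k.succ_pos, ?_⟩
    rw [hTE _ (hSE k)]
    have hk : ((k : ℂ) + 1) ≠ 0 := Nat.cast_add_one_ne_zero k
    have h1 : (lam * exp (S k * Real.log μ)) ^ (k + 1) = 1 := by
      simp only [S]
      rw [div_mul_cancel₀ _ hlogμ', exp_sub, exp_log (norm_pos_iff.1 hlam0),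
        mul_div_cancel₀ _ (norm_pos_iff.1 hlam0), ← exp_nat_mul, ← exp_two_pi_mul_I]
      congr 1
      push_cast
      field_simp
    rw [h1, one_smul]
  let s₀ : ℂ := -log lam / Real.log μ
  have hs₀ : s₀ ∈ {s : ℂ | ν - 1 / 2 < s.re} := by
    change ν - 1 / 2 < (-log lam / (Real.log μ : ℂ)).re
    rwa [div_ofReal_re, neg_re, log_re]
  have hU : IsOpen {s : ℂ | ν - 1 / 2 < s.re} := isOpen_lt continuous_const continuous_re
  have hGa : AnalyticOnNhd ℂ G {s | ν - 1 / 2 < s.re} :=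
    (differentiableOn_inner_eigenCoeff h.norm_lt x.weightedSummable_coeff).analyticOnNhd hU
  have hSlim : Filter.Tendsto S Filter.atTop (𝓝[≠] s₀) := by
    refine tendsto_nhdsWithin_iff.2 ⟨?_, Filter.Eventually.of_forall fun k => ?_⟩
    · have h1 : Filter.Tendsto (fun k : ℕ => ((1 / ((k : ℝ) + 1) : ℝ) : ℂ)) Filter.atTop (𝓝 0) := by
        have := (continuous_ofReal.tendsto 0).comp (tendsto_one_div_add_atTop_nhds_zero_nat (𝕜 := ℝ))
        rw [ofReal_zero] at this
        exact this
      have h2 := ((h1.const_mul (2 * Real.pi * I)).sub_const (log lam)).div_const (Real.log μ : ℂ)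
      rw [mul_zero, zero_sub] at h2
      exact h2
    · have hk : ((k : ℂ) + 1) ≠ 0 := Nat.cast_add_one_ne_zero k
      have hpi : (Real.pi : ℂ) ≠ 0 := ofReal_ne_zero.2 Real.pi_ne_zero
      simp only [S, s₀, Set.mem_compl_iff, Set.mem_singleton_iff]
      intro heq
      rw [div_left_inj' hlogμ', sub_eq_add_neg, add_eq_right] at heq
      simp [hk, hpi] at heq
  have hG0 : Set.EqOn G 0 {s | ν - 1 / 2 < s.re} :=
    hGa.eqOn_zero_of_preconnected_of_frequently_eq_zero
      (convex_halfSpace_re_gt _).isPreconnected hs₀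
      (hSlim.frequently (Filter.Frequently.of_forall hS0))
  intro k
  -- The integers from 1 on lie in the half-plane because ν ≤ 1/2.
  have hk : ν - 1 / 2 < (((k + 1 : ℕ) : ℂ)).re := by
    rw [natCast_re]
    push_cast
    linarith [(Nat.cast_nonneg k : (0 : ℝ) ≤ k)]
  have hME : (M ^ (k + 1)) (one ν) = E ((k + 1 : ℕ) : ℂ) hk := by
    have hpow : ∀ (j : ℕ) (z : 𝔻), (M ^ j) (one ν) z = ((1 - (z : ℂ)) / (1 - q * z)) ^ j := by
      intro j z
      induction j with
      | zero => rfl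
      | succ j ih => rw [pow_succ', mul_apply_eq_comp, hM, ih, pow_succ']
    ext z
    rw [hpow]
    change _ = (1 - (z : ℂ)) ^ (((k + 1 : ℕ) : ℂ)) * (1 - q * (z : ℂ)) ^ (-((k + 1 : ℕ) : ℂ))
    rw [cpow_neg, cpow_natCast, cpow_natCast, div_pow, div_eq_mul_inv]
  rw [hME, hGE _ hk]
  exact hG0 hk

end IsHyperbolicModel

/-! ### An obstruction to recurrence, and auxiliary estimates -/

section Recurrence

variable {H : Type*} [NormedAddCommGroup H] [NormedSpace ℂ H]

/-- If f and Tⁿf are both close to e, uniform boundedness of the functionals D∘Tⁿ makes D e close to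
D(Tⁿe), which is too small. -/
theorem not_isRecurrent_of_functional_bound {T : H →L[ℂ] H} (D : H →ₗ[ℂ] ℂ) {C r : ℝ}
    (hC : ∀ (n : ℕ) (f : H), ‖D ((T ^ n) f)‖ ≤ C * ‖f‖) {e : H} (he : D e ≠ 0) (hr : r < 1)
    (hre : ∀ n : ℕ, 0 < n → ‖D ((T ^ n) e)‖ ≤ r * ‖D e‖) : ¬ IsRecurrent T := fun h => by
  have hDe : 0 < ‖D e‖ := norm_pos_iff.2 he
  have hC0 : 0 ≤ |C| := abs_nonneg C
  have hCC : ∀ (n : ℕ) (f : H), ‖D ((T ^ n) f)‖ ≤ |C| * ‖f‖ := fun n f =>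
    (hC n f).trans (mul_le_mul_of_nonneg_right (le_abs_self C) (norm_nonneg f))
  set δ := (1 - r) * ‖D e‖ / (2 * (|C| + 1)) with hδ
  have hδ0 : 0 < δ := div_pos (mul_pos (by linarith) hDe) (by positivity)
  obtain ⟨n, hn, -, ⟨f, hf, rfl⟩, hTf⟩ := h (Metric.ball e δ) Metric.isOpen_ball
    ⟨e, Metric.mem_ball_self hδ0⟩
  rw [Metric.mem_ball, dist_eq_norm] at hf hTf
  have h1 := hCC 0 ((T ^ n) f - e)
  rw [pow_zero] at h1
  have h1' : ‖D ((T ^ n) f) - D e‖ ≤ |C| * ‖(T ^ n) f - e‖ := by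
    rw [← map_sub]
    exact h1
  have h2 := hCC n (f - e)
  rw [map_sub, map_sub] at h2
  have h3 := hre n hn
  have h4 : ‖D e‖ ≤ ‖D ((T ^ n) f) - D e‖ + ‖D ((T ^ n) f) - D ((T ^ n) e)‖ +
      ‖D ((T ^ n) e)‖ := by
    have e1 : D e = -(D ((T ^ n) f) - D e) + (D ((T ^ n) f) - D ((T ^ n) e)) + D ((T ^ n) e) := by
      ring
    calc ‖D e‖ = ‖-(D ((T ^ n) f) - D e) + (D ((T ^ n) f) - D ((T ^ n) e)) + D ((T ^ n) e)‖ := by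
          rw [← e1]
      _ ≤ _ := by
          refine (norm_add₃_le).trans_eq ?_
          rw [norm_neg]
  have h5 : |C| * ‖(T ^ n) f - e‖ ≤ |C| * δ := mul_le_mul_of_nonneg_left hTf.le hC0
  have h6 : |C| * ‖f - e‖ ≤ |C| * δ := mul_le_mul_of_nonneg_left hf.le hC0
  have h7 : 2 * (|C| + 1) * δ = (1 - r) * ‖D e‖ := by
    rw [hδ]
    field_simp
  nlinarith

end Recurrence

theorem rpow_le_mul_exp {T x : ℝ} (hT : 0 < T) (hx : 0 ≤ x) : x ^ T ≤ T ^ T * Real.exp x := by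
  have h1 : x / T ≤ Real.exp (x / T) := by linarith [Real.add_one_le_exp (x / T)]
  have h2 := Real.rpow_le_rpow (by positivity) h1 hT.le
  rw [← Real.exp_mul, div_mul_cancel₀ _ hT.ne', Real.div_rpow hx hT.le,
    div_le_iff₀ (by positivity)] at h2
  linarith

theorem norm_pow_sub_pow_le {p p' : ℂ} {r : ℝ} (hp : ‖p‖ ≤ r) (hp' : ‖p'‖ ≤ r) (n : ℕ) :
    ‖p ^ (n + 1) - p' ^ (n + 1)‖ ≤ (n + 1) * r ^ n * ‖p - p'‖ := by
  have hr : 0 ≤ r := (norm_nonneg p).trans hp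
  induction n with
  | zero => simp
  | succ n ih =>
    have e : p ^ (n + 1 + 1) - p' ^ (n + 1 + 1) =
        p * (p ^ (n + 1) - p' ^ (n + 1)) + (p - p') * p' ^ (n + 1) := by ring
    rw [e]
    refine (norm_add_le _ _).trans ?_
    rw [norm_mul, norm_mul, norm_pow]
    have h1 : ‖p‖ * ‖p ^ (n + 1) - p' ^ (n + 1)‖ ≤ r * ((n + 1) * r ^ n * ‖p - p'‖) := by gcongr
    have h2 : ‖p - p'‖ * ‖p'‖ ^ (n + 1) ≤ ‖p - p'‖ * r ^ (n + 1) := by gcongr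
    have h3 : r ^ (n + 1) = r ^ n * r := pow_succ r n
    rw [h3] at h2 ⊢
    push_cast
    linarith

/-- Weighted geometric sums `∑ (n + 1) ^ T e ^ (-2 ε n)` are `O(ε ^ (-(T + 1)))`. -/
theorem exists_sum_rpow_mul_exp_le {T : ℝ} (hT : 0 < T) : ∃ C : ℝ, 0 ≤ C ∧
    ∀ ε : ℝ, 0 < ε → ε ≤ 1 → ∀ N : ℕ, ∑ n ∈ Finset.range N,
      ((n : ℝ) + 1) ^ T * Real.exp (-(2 * ε * n)) ≤ C * ε ^ (-(T + 1)) := by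
  refine ⟨T ^ T * Real.exp 1 * 2, by positivity, fun ε hε hε1 N => ?_⟩
  -- Half of the exponential absorbs the power at the cost of ε^(-T); the other half leaves a
  -- geometric series of sum at most 2/ε.
  have h1 : ∀ n : ℕ, ((n : ℝ) + 1) ^ T * Real.exp (-(2 * ε * n)) ≤
      T ^ T * Real.exp 1 * ε ^ (-T) * Real.exp (-ε) ^ n := fun n => by
    have h2 := rpow_le_mul_exp hT (x := ε * ((n : ℝ) + 1)) (by positivity)
    rw [Real.mul_rpow hε.le (by positivity)] at h2
    have h3 : Real.exp (ε * ((n : ℝ) + 1)) ≤ Real.exp 1 * Real.exp (ε * n) := by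
      rw [← Real.exp_add]
      exact Real.exp_le_exp.2 (by linarith)
    have h4 : ((n : ℝ) + 1) ^ T ≤ T ^ T * Real.exp 1 * ε ^ (-T) * Real.exp (ε * n) := by
      rw [Real.rpow_neg hε.le]
      have h5 : 0 < ε ^ T := by positivity
      have h6 : T ^ T * Real.exp (ε * ((n : ℝ) + 1)) ≤ T ^ T * (Real.exp 1 * Real.exp (ε * n)) := by
        gcongr
      calc ((n : ℝ) + 1) ^ T = (ε ^ T * ((n : ℝ) + 1) ^ T) * (ε ^ T)⁻¹ := by field_simp
        _ ≤ (T ^ T * (Real.exp 1 * Real.exp (ε * n))) * (ε ^ T)⁻¹ := by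
          exact mul_le_mul_of_nonneg_right (h2.trans h6) (by positivity)
        _ = _ := by ring
    calc _ ≤ T ^ T * Real.exp 1 * ε ^ (-T) * Real.exp (ε * n) * Real.exp (-(2 * ε * n)) := by gcongr
      _ = _ := by
        rw [mul_assoc, ← Real.exp_add, ← Real.exp_nat_mul]
        congr 2
        ring
  refine (Finset.sum_le_sum fun n _ => h1 n).trans ?_
  rw [← Finset.mul_sum]
  have hx : Real.exp (-ε) < 1 := Real.exp_lt_one_iff.2 (by linarith)
  have hgeo : ∑ n ∈ Finset.range N, Real.exp (-ε) ^ n ≤ 2 / ε := by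
    refine ((summable_geometric_of_lt_one (Real.exp_pos _).le hx).sum_le_tsum _
      fun n _ => by positivity).trans ?_
    rw [tsum_geometric_of_lt_one (Real.exp_pos _).le hx, inv_eq_one_div,
      div_le_div_iff₀ (by linarith) hε]
    have h2 : Real.exp (-ε) * (1 + ε) ≤ 1 := by
      have h3 := mul_le_mul_of_nonneg_left (Real.add_one_le_exp ε) (Real.exp_pos (-ε)).le
      rw [← Real.exp_add, neg_add_cancel, Real.exp_zero] at h3
      linarith
    nlinarith [Real.exp_pos (-ε)]
  calc _ ≤ T ^ T * Real.exp 1 * ε ^ (-T) * (2 / ε) := by gcongr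
    _ = _ := by
      rw [neg_add, Real.rpow_add hε, Real.rpow_neg_one]
      ring

/-! ### Oscillation and point evaluations on S_ν -/

namespace WeightedDirichlet

/-- An estimate for the oscillation of the functions in `S_ν`. -/
theorem exists_norm_sub_le {ν₀ : ℝ} (hν₀ : ν₀ ≤ 1 / 2) : ∃ C : ℝ, 0 ≤ C ∧
    ∀ (ν : ℝ), ν₀ ≤ ν → ∀ (f : WeightedDirichlet ν) (p p' : 𝔻) (ε : ℝ), 0 < ε →
      ε ≤ 1 - ‖(p : ℂ)‖ → ε ≤ 1 - ‖(p' : ℂ)‖ →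
      ‖f p - f p'‖ ^ 2 ≤ C * ‖(p : ℂ) - p'‖ ^ 2 * ε ^ (-(3 - 2 * ν₀)) * ‖f‖ ^ 2 := by
  obtain ⟨C, hC, h⟩ := exists_sum_rpow_mul_exp_le (T := 2 - 2 * ν₀) (by linarith)
  refine ⟨Real.exp 1 ^ 2 * C, by positivity, fun ν hν f p p' ε hε hp hp' => ?_⟩
  have hε1 : ε ≤ 1 := hp.trans (by linarith [norm_nonneg (p : ℂ)])
  let b : ℕ → ℂ := (fun n => (p : ℂ) ^ n) + (-1 : ℂ) • fun n => (p' : ℂ) ^ n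
  have hbn : ∀ n, b n = (p : ℂ) ^ n - (p' : ℂ) ^ n := fun n => by
    simp only [b, Pi.add_apply, Pi.smul_apply, smul_eq_mul]
    ring
  have hb : WeightedSummable (-ν) b :=
    (weightedSummable_pow _ p).add ((weightedSummable_pow _ p').smul _)
  have hin : inner ℂ (dual b hb) f = f p - f p' := by
    refine (inner_dual b hb f).unique
      (((f.hasTaylorSeries_coeff p).sub (f.hasTaylorSeries_coeff p')).congr_fun fun n => ?_)
    rw [hbn]
    ring
  have hbound : ∀ n : ℕ, ‖b n‖ ≤ Real.exp 1 * ‖(p : ℂ) - p'‖ *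
      (((n : ℝ) + 1) * Real.exp (-(ε * n))) := by
    intro n
    rw [hbn]
    cases n with
    | zero =>
      simp only [pow_zero, sub_self, norm_zero]
      positivity
    | succ n =>
      refine (norm_pow_sub_pow_le (r := 1 - ε) (by linarith) (by linarith) n).trans ?_
      -- The factor e pays for the index shift from n to n + 1, since ε ≤ 1.
      have h1 : (1 - ε) ^ n ≤ Real.exp 1 * Real.exp (-(ε * ((n + 1 : ℕ) : ℝ))) := by
        calc (1 - ε) ^ n ≤ Real.exp (-ε) ^ n :=
              pow_le_pow_left₀ (by linarith) (by linarith [Real.add_one_le_exp (-ε)]) n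
          _ ≤ _ := by
              rw [← Real.exp_nat_mul, ← Real.exp_add]
              refine Real.exp_le_exp.2 ?_
              push_cast
              linarith
      calc ((n : ℝ) + 1) * (1 - ε) ^ n * ‖(p : ℂ) - p'‖ ≤ (((n + 1 : ℕ) : ℝ) + 1) *
            (Real.exp 1 * Real.exp (-(ε * ((n + 1 : ℕ) : ℝ)))) * ‖(p : ℂ) - p'‖ := by
            have h2 : (n : ℝ) + 1 ≤ ((n + 1 : ℕ) : ℝ) + 1 := by push_cast; linarith
            exact mul_le_mul_of_nonneg_right (mul_le_mul h2 h1 (pow_nonneg (by linarith) n)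
              (by positivity)) (norm_nonneg _)
        _ = _ := by ring
  have hterm : ∀ n : ℕ, ‖b n‖ ^ 2 * ((n : ℝ) + 1) ^ (-(2 * ν)) ≤
      (Real.exp 1 * ‖(p : ℂ) - p'‖) ^ 2 *
        (((n : ℝ) + 1) ^ (2 - 2 * ν₀) * Real.exp (-(2 * ε * n))) := by
    intro n
    have hw : ((n : ℝ) + 1) ^ (-(2 * ν)) ≤ ((n : ℝ) + 1) ^ (-(2 * ν₀)) :=
      Real.rpow_le_rpow_of_exponent_le (by simp) (by linarith)
    have hs := pow_le_pow_left₀ (norm_nonneg _) (hbound n) 2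
    calc _ ≤ (Real.exp 1 * ‖(p : ℂ) - p'‖ * (((n : ℝ) + 1) * Real.exp (-(ε * n)))) ^ 2 *
          ((n : ℝ) + 1) ^ (-(2 * ν₀)) := by gcongr
      _ = _ := by
        rw [sub_eq_add_neg 2, Real.rpow_add (by positivity), Real.rpow_two, mul_pow, mul_pow,
          mul_pow ((n : ℝ) + 1), ← Real.exp_nat_mul (-(ε * n)) 2]
        rw [show ((2 : ℕ) : ℝ) * -(ε * n) = -(2 * ε * n) by push_cast; ring]
        ring
  have hnorm : ‖dual b hb‖ ^ 2 ≤
      (Real.exp 1 * ‖(p : ℂ) - p'‖) ^ 2 * (C * ε ^ (-(2 - 2 * ν₀ + 1))) := by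
    rw [norm_dual_sq]
    have hs : Summable fun n : ℕ => ‖b n‖ ^ 2 * ((n : ℝ) + 1) ^ (-(2 * ν)) := by
      refine hb.congr fun n => ?_
      rw [mul_neg]
    refine hs.tsum_le_of_sum_range_le fun N => ?_
    refine (Finset.sum_le_sum fun n _ => hterm n).trans ?_
    rw [← Finset.mul_sum]
    gcongr
    exact h ε hε hε1 N
  rw [← hin]
  have h1 := pow_le_pow_left₀ (norm_nonneg _) (norm_inner_le_norm (𝕜 := ℂ) (dual b hb) f) 2
  refine h1.trans ?_
  rw [mul_pow]
  refine (mul_le_mul_of_nonneg_right hnorm (sq_nonneg _)).trans_eq ?_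
  rw [show -(2 - 2 * ν₀ + 1) = -(3 - 2 * ν₀) by ring]
  ring

/-- The evaluation functional at z has squared norm ∑ |z|^(2n)(n + 1)^(-2ν), which stays bounded up
to the circle when ν > 1/2. -/
theorem exists_norm_apply_le {ν : ℝ} (hν : 1 / 2 < ν) : ∃ C : ℝ, 0 ≤ C ∧
    ∀ (f : WeightedDirichlet ν) (z : 𝔻), ‖f z‖ ≤ C * ‖f‖ := by
  have hs : Summable fun n : ℕ => ((n : ℝ) + 1) ^ (-(2 * ν)) :=
    summable_rpow_natCast_add_one.2 (by linarith)
  refine ⟨√(∑' n : ℕ, ((n : ℝ) + 1) ^ (-(2 * ν))), Real.sqrt_nonneg _, fun f z => ?_⟩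
  have h1 : inner ℂ (dual _ (weightedSummable_pow (-ν) z)) f = f z := eval_apply z f
  rw [← h1]
  refine (norm_inner_le_norm _ _).trans (mul_le_mul_of_nonneg_right ?_ (norm_nonneg f))
  refine Real.le_sqrt_of_sq_le ?_
  rw [norm_dual_sq]
  have hle : ∀ n : ℕ, ‖(z : ℂ) ^ n‖ ^ 2 * ((n : ℝ) + 1) ^ (-(2 * ν)) ≤
      ((n : ℝ) + 1) ^ (-(2 * ν)) := fun n => by
    refine mul_le_of_le_one_left (by positivity) ?_
    rw [norm_pow, ← pow_mul]
    exact pow_le_one₀ (norm_nonneg _) z.norm_lt_one.le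
  exact (Summable.of_nonneg_of_le (fun n => by positivity) hle hs).tsum_le_tsum hle hs

end WeightedDirichlet

/-! ### Orbits of the model and necessity of the condition -/

namespace IsHyperbolicModel

open WeightedDirichlet

variable {μ : ℝ} {q : ℂ} {Φ : 𝔻 → 𝔻} {ν : ℝ}

theorem map_iterate_eq (h : IsHyperbolicModel μ q Φ) (n : ℕ) (z : 𝔻) :
    (1 - (Φ^[n] z : ℂ)) / (1 - q * Φ^[n] z) = μ ^ n * ((1 - z) / (1 - q * z)) := by
  induction n with
  | zero => simp
  | succ n ih => rw [Function.iterate_succ_apply', h.map_eq, ih, pow_succ']; ring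

theorem inv_one_sub_iterate (h : IsHyperbolicModel μ q Φ) (n : ℕ) (z : 𝔻) :
    (1 - (Φ^[n] z : ℂ))⁻¹ =
      ((μ⁻¹ ^ n : ℝ) : ℂ) * ((1 - (z : ℂ))⁻¹ + q / (1 - q)) - q / (1 - q) := by
  have h0 := one_sub_ne_zero_of_norm_lt h.norm_lt
  have h1 := one_sub_mul_ne_zero h.norm_lt.le z
  have h2 := one_sub_mul_ne_zero h.norm_lt.le (Φ^[n] z)
  have h3 := one_sub_coe_ne_zero z
  have h4 := one_sub_coe_ne_zero (Φ^[n] z)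
  have hμ : (μ : ℂ) ^ n ≠ 0 := pow_ne_zero _ (ofReal_ne_zero.2 h.pos.ne')
  have h5 := h.map_iterate_eq n z
  rw [← mul_div_assoc, div_eq_div_iff h2 h1] at h5
  push_cast
  rw [inv_pow]
  field_simp
  linear_combination -h5

theorem re_inv_one_sub (z : 𝔻) :
    ((1 - (z : ℂ))⁻¹).re = 1 / 2 + (1 - ‖(z : ℂ)‖ ^ 2) * ‖(1 - (z : ℂ))⁻¹‖ ^ 2 / 2 := by
  have h1 : normSq (1 - (z : ℂ)) ≠ 0 := normSq_eq_zero.not.2 (one_sub_coe_ne_zero z)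
  rw [norm_inv, inv_pow, ← normSq_eq_norm_sq, ← normSq_eq_norm_sq, inv_re]
  field_simp
  simp only [normSq_apply, sub_re, sub_im, one_re, one_im]
  ring

/-- The orbit of a point tends to `1` nontangentially, at the rate `μ ^ n`. -/
theorem exists_orbit_bounds (h : IsHyperbolicModel μ q Φ) (z : 𝔻) : ∃ c ρ : ℝ, 0 < c ∧ 0 < ρ ∧
    ∀ n : ℕ, c * μ ^ n ≤ 1 - ‖(Φ^[n] z : ℂ)‖ ∧ ρ * μ⁻¹ ^ n ≤ ‖(1 - (Φ^[n] z : ℂ))⁻¹‖ := by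
  set τ := q / (1 - q) with hτ
  set U := (1 - (z : ℂ))⁻¹ + τ with hU
  have hδ : 0 < 1 / 2 + τ.re := by linarith [re_add_half_pos h.norm_lt]
  have hz : 0 < ‖(1 - (z : ℂ))⁻¹‖ := norm_pos_iff.2 (inv_ne_zero (one_sub_coe_ne_zero z))
  have hρ : 0 < ((1 - (z : ℂ))⁻¹).re - 1 / 2 := by
    rw [re_inv_one_sub, add_sub_cancel_left]
    have := z.sq_norm_lt_one
    exact div_pos (mul_pos (by linarith) (by positivity)) two_pos
  set ρ := ((1 - (z : ℂ))⁻¹).re - 1 / 2 with hρd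
  have hK : 0 < ‖U‖ + ‖τ‖ + 1 := by positivity
  refine ⟨ρ / (‖U‖ + ‖τ‖ + 1) ^ 2, ρ, by positivity, hρ, fun n => ?_⟩
  set S := μ⁻¹ ^ n with hS
  have hS1 : 1 ≤ S := one_le_pow₀ ((one_le_inv₀ h.pos).2 h.lt_one.le)
  have hμS : μ ^ n = S⁻¹ := by rw [hS, inv_pow, inv_inv]
  set w := Φ^[n] z with hw
  have hW : (1 - (w : ℂ))⁻¹ = (S : ℂ) * U - τ := h.inv_one_sub_iterate n z
  have hre : ((1 - (w : ℂ))⁻¹).re = S * U.re - τ.re := by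
    rw [hW, sub_re, re_ofReal_mul]
  have hUre : U.re = ρ + 1 / 2 + τ.re := by
    rw [hU, add_re, hρd]
    ring
  -- The discarded remainder is (S - 1)(1/2 + Re τ) ≥ 0.
  have hlow : S * ρ ≤ ((1 - (w : ℂ))⁻¹).re - 1 / 2 := by
    rw [hre, hUre]
    nlinarith
  have hup : ‖(1 - (w : ℂ))⁻¹‖ ≤ S * (‖U‖ + ‖τ‖ + 1) := by
    rw [hW]
    refine (norm_sub_le _ _).trans ?_
    rw [norm_mul, norm_real, Real.norm_of_nonneg (by linarith)]
    nlinarith [norm_nonneg τ, norm_nonneg U]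
  constructor
  · have h1 := re_inv_one_sub w
    have hw1 := w.norm_lt_one
    have hw0 := norm_nonneg (w : ℂ)
    have h2 : S * ρ ≤ (1 - ‖(w : ℂ)‖) * (S * (‖U‖ + ‖τ‖ + 1)) ^ 2 := by
      have h3 : (1 - ‖(w : ℂ)‖ ^ 2) * ‖(1 - (w : ℂ))⁻¹‖ ^ 2 / 2 ≤
          (1 - ‖(w : ℂ)‖) * ‖(1 - (w : ℂ))⁻¹‖ ^ 2 := by
        have : 0 ≤ ‖(1 - (w : ℂ))⁻¹‖ ^ 2 * (1 - ‖(w : ℂ)‖) ^ 2 := by positivity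
        nlinarith
      have h4 : (1 - ‖(w : ℂ)‖) * ‖(1 - (w : ℂ))⁻¹‖ ^ 2 ≤
          (1 - ‖(w : ℂ)‖) * (S * (‖U‖ + ‖τ‖ + 1)) ^ 2 := by
        have := pow_le_pow_left₀ (norm_nonneg _) hup 2
        exact mul_le_mul_of_nonneg_left this (by linarith)
      linarith
    have hS0 : 0 < S := by linarith
    rw [hμS, div_mul_eq_mul_div, div_le_iff₀ (by positivity)]
    rw [mul_inv_le_iff₀ hS0]
    refine le_of_mul_le_mul_left ?_ hS0
    linarith
  · have := re_le_norm (1 - (w : ℂ))⁻¹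
    linarith

/-- In the coordinate W the two orbits separate like μ⁻ⁿ, but the passage back to z divides by a
product of two factors of size at least a constant times μ⁻ⁿ. -/
theorem exists_orbit_dist (h : IsHyperbolicModel μ q Φ) (z z' : 𝔻) : ∃ C : ℝ, 0 ≤ C ∧
    ∀ n : ℕ, ‖(Φ^[n] z : ℂ) - Φ^[n] z'‖ ≤ C * μ ^ n := by
  obtain ⟨_, ρ, _, hρ, h1⟩ := h.exists_orbit_bounds z
  obtain ⟨_, ρ', _, hρ', h2⟩ := h.exists_orbit_bounds z'
  refine ⟨‖(1 - (z : ℂ))⁻¹ - (1 - (z' : ℂ))⁻¹‖ / (ρ * ρ'), by positivity, fun n => ?_⟩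
  have e1 := (h1 n).2
  have e2 := (h2 n).2
  set S := μ⁻¹ ^ n with hS
  have hS0 : 0 < S := pow_pos (inv_pos.2 h.pos) n
  have hμS : μ ^ n = S⁻¹ := by rw [hS, inv_pow, inv_inv]
  have h3 : (1 - (Φ^[n] z : ℂ))⁻¹ - (1 - (Φ^[n] z' : ℂ))⁻¹ =
      (S : ℂ) * ((1 - (z : ℂ))⁻¹ - (1 - (z' : ℂ))⁻¹) := by
    rw [h.inv_one_sub_iterate, h.inv_one_sub_iterate]
    ring
  have h4 : (1 - (Φ^[n] z : ℂ))⁻¹ - (1 - (Φ^[n] z' : ℂ))⁻¹ = ((Φ^[n] z : ℂ) - Φ^[n] z') *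
      ((1 - (Φ^[n] z : ℂ))⁻¹ * (1 - (Φ^[n] z' : ℂ))⁻¹) := by
    have := one_sub_coe_ne_zero (Φ^[n] z)
    have := one_sub_coe_ne_zero (Φ^[n] z')
    field_simp
    ring
  rw [h4] at h3
  have h5 := congrArg norm h3
  rw [norm_mul, norm_mul, norm_mul, norm_real, Real.norm_of_nonneg hS0.le] at h5
  have h6 : ‖(Φ^[n] z : ℂ) - Φ^[n] z'‖ * ((ρ * S) * (ρ' * S)) ≤
      S * ‖(1 - (z : ℂ))⁻¹ - (1 - (z' : ℂ))⁻¹‖ := by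
    rw [← h5]
    gcongr
  rw [hμS, div_mul_eq_mul_div, le_div_iff₀ (by positivity), ← div_eq_mul_inv, le_div_iff₀ hS0]
  refine le_of_mul_le_mul_left ?_ hS0
  linarith

theorem pow_apply {lam : ℂ} {T : WeightedDirichlet ν →L[ℂ] WeightedDirichlet ν}
    (hT : ∀ (f : WeightedDirichlet ν) (z : 𝔻), T f z = lam * f (Φ z)) (n : ℕ)
    (f : WeightedDirichlet ν) (z : 𝔻) : (T ^ n) f z = lam ^ n * f (Φ^[n] z) := by
  induction n generalizing z with
  | zero => simp
  | succ n ih =>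
    rw [pow_succ', mul_apply_eq_comp, hT, ih, Function.iterate_succ_apply, pow_succ']
    ring

/-- By the oscillation estimate with distances to the circle of order at least μⁿ, |f(Φⁿ0) -
f(Φⁿ(1/2))| is at most a constant times μⁿ μ^(-n(3 - 2ν₀)/2)‖f‖ = μ^(-n(1 - 2ν₀)/2)‖f‖, which |λ|ⁿ
compensates. The auxiliary ν₀ ≤ ν lets the borderline exponent 1/2 serve every ν > 1/2. -/
theorem not_isRecurrent_of_norm_le (h : IsHyperbolicModel μ q Φ) {lam : ℂ} {ν₀ : ℝ}
    (hν₀ : ν₀ ≤ 1 / 2) (hν : ν₀ ≤ ν) (hlam : ‖lam‖ ≤ μ ^ ((1 - 2 * ν₀) / 2))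
    {T : WeightedDirichlet ν →L[ℂ] WeightedDirichlet ν}
    (hT : ∀ (f : WeightedDirichlet ν) (z : 𝔻), T f z = lam * f (Φ z)) : ¬ IsRecurrent T := by
  have hμ := h.pos
  let z₁ : 𝔻 := UnitDisc.mk (1 / 2) (by norm_num)
  let D : WeightedDirichlet ν →ₗ[ℂ] ℂ := (eval ν 0).toLinearMap - (eval ν z₁).toLinearMap
  have hD : ∀ f, D f = f 0 - f z₁ := fun f => by
    change eval ν 0 f - eval ν z₁ f = _
    rw [eval_apply, eval_apply]
  obtain ⟨M, hM⟩ := exists_mul_operator (ν := ν) h.norm_lt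
  have he : ∀ z, M (one ν) z = (1 - (z : ℂ)) / (1 - q * z) := fun z => by
    rw [hM, one_apply, mul_one]
  have hlam1 : ‖lam‖ ≤ 1 :=
    hlam.trans (Real.rpow_le_one h.pos.le h.lt_one.le (by linarith))
  obtain ⟨C, hC, hosc⟩ := exists_norm_sub_le hν₀
  obtain ⟨B, hB, hdist⟩ := h.exists_orbit_dist 0 z₁
  obtain ⟨c, _, hc, _, hb⟩ := h.exists_orbit_bounds 0
  obtain ⟨c', _, hc', _, hb'⟩ := h.exists_orbit_bounds z₁
  have hm : 0 < min c c' := lt_min hc hc'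
  set m := min c c' with hmdef
  refine not_isRecurrent_of_functional_bound (e := M (one ν)) (r := μ) D
    (C := √(C * B ^ 2 * m ^ (-(3 - 2 * ν₀)))) (fun n f => ?_) ?_ h.lt_one fun n hn => ?_
  · rw [hD, pow_apply hT, pow_apply hT, ← mul_sub, norm_mul, norm_pow]
    have hμn : 0 < μ ^ n := pow_pos hμ n
    have h1 := hosc ν hν f (Φ^[n] 0) (Φ^[n] z₁) (m * μ ^ n) (by positivity)
      ((mul_le_mul_of_nonneg_right (min_le_left _ _) hμn.le).trans (hb n).1)
      ((mul_le_mul_of_nonneg_right (min_le_right _ _) hμn.le).trans (hb' n).1)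
    have h2 : (‖lam‖ ^ n) ^ 2 ≤ (μ ^ n) ^ (1 - 2 * ν₀) := by
      calc (‖lam‖ ^ n) ^ 2 ≤ ((μ ^ ((1 - 2 * ν₀) / 2)) ^ n) ^ 2 := by gcongr
        _ = _ := by
          rw [← Real.rpow_natCast, ← Real.rpow_natCast, ← Real.rpow_natCast,
            ← Real.rpow_mul hμ.le, ← Real.rpow_mul hμ.le, ← Real.rpow_mul hμ.le]
          congr 1
          push_cast
          ring
    have h3 : ‖(Φ^[n] 0 : ℂ) - Φ^[n] z₁‖ ^ 2 ≤ (B * μ ^ n) ^ 2 :=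
      pow_le_pow_left₀ (norm_nonneg _) (hdist n) 2
    have h4 : (m * μ ^ n) ^ (-(3 - 2 * ν₀)) =
        m ^ (-(3 - 2 * ν₀)) * ((μ ^ n) ^ (1 - 2 * ν₀))⁻¹ * ((μ ^ n) ^ 2)⁻¹ := by
      rw [Real.mul_rpow hm.le hμn.le, mul_assoc, ← Real.rpow_two, ← Real.rpow_neg hμn.le,
        ← Real.rpow_neg hμn.le, ← Real.rpow_add hμn]
      congr 2
      ring
    have hX : 0 < (μ ^ n) ^ (1 - 2 * ν₀) := by positivity
    have h5 : (‖lam‖ ^ n * ‖f (Φ^[n] 0) - f (Φ^[n] z₁)‖) ^ 2 ≤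
        C * B ^ 2 * m ^ (-(3 - 2 * ν₀)) * ‖f‖ ^ 2 := by
      rw [mul_pow]
      calc _ ≤ (μ ^ n) ^ (1 - 2 * ν₀) * (C * (B * μ ^ n) ^ 2 *
            (m ^ (-(3 - 2 * ν₀)) * ((μ ^ n) ^ (1 - 2 * ν₀))⁻¹ * ((μ ^ n) ^ 2)⁻¹) * ‖f‖ ^ 2) := by
            rw [← h4]
            refine mul_le_mul h2 (h1.trans ?_) (sq_nonneg _) hX.le
            gcongr
        _ = _ := by field_simp
    have h6 := Real.abs_le_sqrt h5
    rw [Real.sqrt_mul' _ (sq_nonneg _), Real.sqrt_sq (norm_nonneg _)] at h6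
    exact (le_abs_self _).trans h6
  · rw [hD, he, he]
    have h0 := one_sub_ne_zero_of_norm_lt h.norm_lt
    have h1 := one_sub_mul_ne_zero h.norm_lt.le z₁
    have hz : (z₁ : ℂ) = 1 / 2 := rfl
    rw [hz] at h1 ⊢
    simp only [UnitDisc.coe_zero, sub_zero, mul_zero, div_one]
    intro h2
    rw [sub_eq_zero, eq_div_iff h1] at h2
    exact h0 (by linear_combination 2 * h2)
  · have h1 : D ((T ^ n) (M (one ν))) = (lam * μ) ^ n * D (M (one ν)) := by
      rw [hD, hD, pow_apply hT, pow_apply hT, he, he, he, he, h.map_iterate_eq,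
        h.map_iterate_eq]
      ring
    rw [h1, norm_mul, norm_pow, norm_mul, norm_real, Real.norm_of_nonneg hμ.le]
    refine mul_le_mul_of_nonneg_right ?_ (norm_nonneg _)
    have h2 : ‖lam‖ * μ ≤ μ := mul_le_of_le_one_left hμ.le hlam1
    exact (pow_le_of_le_one (by positivity) (h2.trans h.lt_one.le) hn.ne').trans h2

/-- Near the constant 1 all values are uniformly near 1, so λⁿf(Φⁿ0) is too large to be near 1
again. -/
theorem not_isRecurrent_of_one_lt_norm {lam : ℂ} (hν : 1 / 2 < ν) (hlam : 1 < ‖lam‖)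
    {T : WeightedDirichlet ν →L[ℂ] WeightedDirichlet ν}
    (hT : ∀ (f : WeightedDirichlet ν) (z : 𝔻), T f z = lam * f (Φ z)) : ¬ IsRecurrent T :=
  fun hrec => by
    obtain ⟨C, hC, hb⟩ := exists_norm_apply_le hν
    -- Chosen so that |λ|(1 - Cδ) > 1 + Cδ.
    set δ := (‖lam‖ - 1) / ((‖lam‖ + 1) * (C + 1)) with hδ
    have hδ0 : 0 < δ := div_pos (by linarith) (by positivity)
    obtain ⟨n, hn, -, ⟨f, hf, rfl⟩, hTf⟩ := hrec (Metric.ball (one ν) δ) Metric.isOpen_ball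
      ⟨one ν, Metric.mem_ball_self hδ0⟩
    rw [Metric.mem_ball, dist_eq_norm] at hf hTf
    have hclose : ∀ g : WeightedDirichlet ν, ‖g - one ν‖ < δ → ∀ z, ‖g z - 1‖ ≤ C * δ :=
      fun g hg z => (hb (g - one ν) z).trans (mul_le_mul_of_nonneg_left hg.le hC)
    have h1 := hclose f hf (Φ^[n] 0)
    have h2 := hclose _ hTf 0
    rw [pow_apply hT] at h2
    have h3 : 1 - C * δ ≤ ‖f (Φ^[n] 0)‖ := by
      have := norm_sub_norm_le (1 : ℂ) (1 - f (Φ^[n] 0))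
      rw [sub_sub_cancel, norm_one, norm_sub_rev] at this
      linarith
    have h4 : ‖lam ^ n * f (Φ^[n] 0)‖ ≤ 1 + C * δ := by
      have := norm_add_le (lam ^ n * f (Φ^[n] 0) - 1) 1
      rw [sub_add_cancel, norm_one] at this
      linarith
    rw [norm_mul, norm_pow] at h4
    have h5 : ‖lam‖ ≤ ‖lam‖ ^ n := le_self_pow₀ hlam.le hn.ne'
    have h6 : (‖lam‖ + 1) * (C + 1) * δ = ‖lam‖ - 1 := by
      rw [hδ]
      field_simp
    have h7 : ‖lam‖ * ‖f (Φ^[n] 0)‖ ≤ ‖lam‖ ^ n * ‖f (Φ^[n] 0)‖ :=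
      mul_le_mul_of_nonneg_right h5 (norm_nonneg _)
    have h8 := mul_le_mul_of_nonneg_left h3 (norm_nonneg lam)
    nlinarith

theorem isRecurrent_iff (h : IsHyperbolicModel μ q Φ) {lam : ℂ}
    {T : WeightedDirichlet ν →L[ℂ] WeightedDirichlet ν}
    (hT : ∀ (f : WeightedDirichlet ν) (z : 𝔻), T f z = lam * f (Φ z)) :
    IsRecurrent T ↔ ν ≤ 1 / 2 ∧ μ ^ ((1 - 2 * ν) / 2) < ‖lam‖ := by
  refine ⟨fun hrec => ?_, fun ⟨hν, hlam⟩ => h.isRecurrent hν hlam hT⟩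
  rcases le_or_gt ν (1 / 2) with hν | hν
  · refine ⟨hν, not_le.1 fun hlam => h.not_isRecurrent_of_norm_le hν le_rfl hlam hT hrec⟩
  · rcases le_or_gt ‖lam‖ 1 with hlam | hlam
    · exact absurd hrec (h.not_isRecurrent_of_norm_le le_rfl hν.le (by norm_num [hlam]) hT)
    · exact absurd hrec (not_isRecurrent_of_one_lt_norm hν hlam hT)

end IsHyperbolicModel

/-! ### Conjugation invariance and rotations -/

section Conjugation

variable {H H' : Type*} [NormedAddCommGroup H] [NormedSpace ℂ H] [NormedAddCommGroup H']
  [NormedSpace ℂ H']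

theorem IsRecurrent.of_semiconj {T : H →L[ℂ] H} {T' : H' →L[ℂ] H'} (e : H ≃L[ℂ] H')
    (he : ∀ f, e (T f) = T' (e f)) (h : IsRecurrent T) : IsRecurrent T' := by
  have hpow : ∀ (n : ℕ) (f : H), e ((T ^ n) f) = (T' ^ n) (e f) := fun n => by
    induction n with
    | zero => exact fun f => rfl
    | succ n ih =>
      intro f
      rw [pow_succ, pow_succ, mul_apply_eq_comp, mul_apply_eq_comp, ih, he]
  intro U hU ⟨u, hu⟩
  obtain ⟨n, hn, -, ⟨f, hf, rfl⟩, hTf⟩ := h (e ⁻¹' U) (hU.preimage e.continuous)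
    ⟨e.symm u, by simpa using hu⟩
  refine ⟨n, hn, (T' ^ n) (e f), ⟨e f, hf, rfl⟩, ?_⟩
  rw [← hpow]
  exact hTf

theorem isRecurrent_iff_of_semiconj {T : H →L[ℂ] H} {T' : H' →L[ℂ] H'} (e : H ≃L[ℂ] H')
    (he : ∀ f, e (T f) = T' (e f)) : IsRecurrent T ↔ IsRecurrent T' := by
  refine ⟨.of_semiconj e he, .of_semiconj e.symm fun f => ?_⟩
  rw [e.symm_apply_eq, he, e.apply_symm_apply]

end Conjugation

namespace WeightedDirichlet

variable {ν : ℝ}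

theorem circle_smul_mem (c : Circle) (f : WeightedDirichlet ν) :
    (fun z => f (c • z)) ∈ weightedDirichletSubmodule ν := by
  refine ⟨fun n => (c : ℂ) ^ n * f.coeff n, fun z => ?_, ?_⟩
  · refine (f.hasTaylorSeries_coeff (c • z)).congr_fun fun n => ?_
    rw [UnitDisc.coe_circle_smul, mul_pow]
    ring
  · refine f.weightedSummable_coeff.congr fun n => ?_
    rw [norm_mul, norm_pow, Circle.norm_coe, one_pow, one_mul]

/-- Rotations of the disk act on `S_ν`. -/
theorem exists_rotation (ν : ℝ) (c : Circle) :
    ∃ e : WeightedDirichlet ν ≃L[ℂ] WeightedDirichlet ν, (∀ f z, e f z = f (c • z)) ∧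
      ∀ f z, e.symm f z = f (c⁻¹ • z) := by
  obtain ⟨R, hR⟩ := exists_weightedComposition (ν := ν) (ν' := ν) (fun _ => 1) (fun z => c • z)
    fun f => by simpa using circle_smul_mem c f
  obtain ⟨R', hR'⟩ := exists_weightedComposition (ν := ν) (ν' := ν) (fun _ => 1)
    (fun z => c⁻¹ • z) fun f => by simpa using circle_smul_mem c⁻¹ f
  simp only [one_mul] at hR hR'
  exact ⟨.equivOfInverse R R' (fun f => ext fun z => by rw [hR', hR, smul_inv_smul])
    (fun f => ext fun z => by rw [hR, hR', inv_smul_smul]), hR, hR'⟩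

end WeightedDirichlet

/-! ### Reduction of a hyperbolic map to the model -/

theorem half_lt_re_inv_one_sub (z : 𝔻) : 1 / 2 < ((1 - (z : ℂ))⁻¹).re := by
  have h1 : 0 < ‖(1 - (z : ℂ))⁻¹‖ := norm_pos_iff.2 (inv_ne_zero (one_sub_coe_ne_zero z))
  have h2 := z.sq_norm_lt_one
  rw [IsHyperbolicModel.re_inv_one_sub]
  have : 0 < (1 - ‖(z : ℂ)‖ ^ 2) * ‖(1 - (z : ℂ))⁻¹‖ ^ 2 :=
    mul_pos (by linarith) (by positivity)
  linarith

theorem exists_inv_one_sub_eq {W : ℂ} (hW : 1 / 2 < W.re) : ∃ z : 𝔻, (1 - (z : ℂ))⁻¹ = W := by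
  have hW0 : W ≠ 0 := fun h => by norm_num [h] at hW
  refine ⟨UnitDisc.mk (1 - W⁻¹) ?_, ?_⟩
  · have e : 1 - W⁻¹ = (W - 1) / W := by field_simp
    rw [e, norm_div, div_lt_one (norm_pos_iff.2 hW0)]
    refine lt_of_pow_lt_pow_left₀ 2 (norm_nonneg W) ?_
    rw [← normSq_eq_norm_sq, ← normSq_eq_norm_sq, normSq_apply, normSq_apply, sub_re, sub_im,
      one_re, one_im]
    nlinarith
  · rw [UnitDisc.coe_mk, sub_sub_cancel, inv_inv]

theorem inv_one_sub_coe_injective : Function.Injective fun z : 𝔻 => (1 - (z : ℂ))⁻¹ :=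
  fun _ _ h => UnitDisc.coe_injective (sub_right_injective (inv_injective h))

theorem re_div_one_sub_of_norm_eq_one {q : ℂ} (hq : ‖q‖ = 1) (hq1 : q ≠ 1) :
    (q / (1 - q)).re = -1 / 2 := by
  have h0 : 1 - q ≠ 0 := sub_ne_zero.2 hq1.symm
  have h1 : normSq (1 - q) ≠ 0 := normSq_eq_zero.not.2 h0
  have h2 : normSq q = 1 := by rw [normSq_eq_norm_sq, hq, one_pow]
  rw [div_re, ← add_div, div_eq_iff h1]
  rw [normSq_apply] at h2 ⊢
  simp only [sub_re, sub_im, one_re, one_im]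
  linarith

/-- A self-map of the disk which is not an automorphism and is conjugate to a dilation in the
coordinate `(1 - z) / (1 - q z)` contracts this coordinate, and `1 / q` is outside the closed
disk. -/
theorem isHyperbolicModel_of_not_bijective {μ : ℝ} {q : ℂ} {Φ : 𝔻 → 𝔻} (hμ : 0 < μ) (hμ1 : μ ≠ 1)
    (hq : ‖q‖ ≤ 1) (hq1 : q ≠ 1) (hΦ : ¬ Function.Bijective Φ)
    (hmap : ∀ z, (1 - (Φ z : ℂ)) * (1 - q * z) = μ * ((1 - z) * (1 - q * Φ z))) :
    IsHyperbolicModel μ q Φ := by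
  have hq0 : 1 - q ≠ 0 := sub_ne_zero.2 hq1.symm
  set τ := q / (1 - q) with hτ
  have hμ0 : (μ : ℂ) ≠ 0 := ofReal_ne_zero.2 hμ.ne'
  have hU : ∀ z : 𝔻, (1 - (z : ℂ))⁻¹ + τ = μ * ((1 - (Φ z : ℂ))⁻¹ + τ) := fun z => by
    have h1 := one_sub_coe_ne_zero z
    have h2 := one_sub_coe_ne_zero (Φ z)
    have h3 := hmap z
    rw [hτ]
    field_simp
    linear_combination h3
  have hqlt : ‖q‖ < 1 := by
    -- If |q| = 1 then Re τ = -1/2, so W ↦ μ(W + τ) - τ maps the half-plane Re W > 1/2 onto itself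
    -- and Φ would be an automorphism.
    refine hq.lt_of_ne fun hqe => hΦ ⟨fun z w hzw => ?_, fun w => ?_⟩
    · refine inv_one_sub_coe_injective (add_right_cancel (b := τ) ?_)
      simp only
      rw [hU z, hU w, hzw]
    · have hre := re_div_one_sub_of_norm_eq_one hqe hq1
      have hw := half_lt_re_inv_one_sub w
      obtain ⟨z, hz⟩ := exists_inv_one_sub_eq (W := μ * ((1 - (w : ℂ))⁻¹ + τ) - τ) (by
        rw [sub_re, re_ofReal_mul, add_re, hτ, hre]
        nlinarith)
      refine ⟨z, inv_one_sub_coe_injective ?_⟩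
      have h1 := hU z
      rw [hz, sub_add_cancel] at h1
      exact (add_right_cancel (mul_left_cancel₀ hμ0 h1)).symm
  refine ⟨hμ, lt_of_le_of_ne (not_lt.1 fun hlt => ?_) hμ1, hqlt, fun z => ?_⟩
  · have hδ := IsHyperbolicModel.re_add_half_pos hqlt
    rw [← hτ] at hδ
    have hpos : 0 < (μ - 1) * (1 / 2 + τ.re) := mul_pos (by linarith) (by linarith)
    -- If μ > 1, this point of the half-plane is sent to the boundary line Re W = 1/2, which is
    -- impossible.
    obtain ⟨z, hz⟩ := exists_inv_one_sub_eq
      (W := ((1 / 2 + (μ - 1) * (1 / 2 + τ.re) : ℝ) : ℂ)) (by rw [ofReal_re]; linarith)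
    have h1 := congrArg re (hU z)
    rw [hz, add_re, ofReal_re, re_ofReal_mul, add_re] at h1
    have h2 := half_lt_re_inv_one_sub (Φ z)
    nlinarith
  · rw [← mul_div_assoc, div_eq_div_iff (one_sub_mul_ne_zero hq _) (one_sub_mul_ne_zero hq _)]
    linear_combination hmap z

/-- In a suitable coordinate `(z - η) / (C z + D)`, a hyperbolic map which fixes `η` is a
dilation. -/
theorem IsHyperbolicLFT.exists_relation {g : GL (Fin 2) ℂ} (hg : IsHyperbolicLFT g) {η : ℂ}
    (hfix : g • (η : OnePoint ℂ) = (η : OnePoint ℂ)) : ∃ (μ : ℝ) (C D : ℂ), 0 < μ ∧ μ ≠ 1 ∧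
      C * η + D ≠ 0 ∧ ∀ z w : ℂ, g • (z : OnePoint ℂ) = (w : OnePoint ℂ) →
        (w - η) * (C * z + D) = μ * ((z - η) * (C * w + D)) := by
  obtain ⟨S, μ, hμ, hμ1, hS⟩ := hg
  have hdet : S 0 0 * S 1 1 - S 0 1 * S 1 0 ≠ 0 := by
    have := S.det_ne_zero
    rwa [Matrix.det_fin_two] at this
  have hrel : ∀ z w : ℂ, g • (z : OnePoint ℂ) = (w : OnePoint ℂ) →
      ((S 1 0 * z + S 1 1 = 0 ∧ S 1 0 * w + S 1 1 = 0) ∨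
      (S 1 0 * z + S 1 1 ≠ 0 ∧ S 1 0 * w + S 1 1 ≠ 0)) ∧
      (S 0 0 * w + S 0 1) * (S 1 0 * z + S 1 1) =
        μ * ((S 0 0 * z + S 0 1) * (S 1 0 * w + S 1 1)) := by
    intro z w hzw
    have h := hS z
    rw [hzw, OnePoint.smul_some_eq_ite, OnePoint.smul_some_eq_ite] at h
    by_cases hz : S 1 0 * z + S 1 1 = 0 <;> by_cases hw : S 1 0 * w + S 1 1 = 0
    · simp [hz, hw]
    · simp [hz, hw] at h
    · simp [hz, hw] at h
    · rw [if_neg hz, if_neg hw, OnePoint.map_some, OnePoint.coe_eq_coe, ← mul_div_assoc,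
        div_eq_div_iff hw hz] at h
      exact ⟨.inr ⟨hz, hw⟩, by linear_combination h⟩
  have hμc : (μ : ℂ) ≠ 1 := by exact_mod_cast hμ1
  have hμ0 : (μ : ℂ) ≠ 0 := by exact_mod_cast hμ.ne'
  -- The conjugating map sends η to a fixed point of the dilation: either ∞, and then the reciprocal
  -- coordinate with multiplier 1/μ is used, or 0.
  by_cases hη : S 1 0 * η + S 1 1 = 0
  · have hne : S 0 0 * η + S 0 1 ≠ 0 := fun h => hdet (by
      linear_combination S 0 0 * hη - S 1 0 * h)
    have h10 : S 1 0 ≠ 0 := fun h => hdet (by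
      rw [h, zero_mul, zero_add] at hη
      rw [h, hη]
      ring)
    refine ⟨μ⁻¹, S 0 0, S 0 1, inv_pos.2 hμ, fun h => hμ1 (inv_eq_one.1 h), hne,
      fun z w hzw => ?_⟩
    have h1 := (hrel z w hzw).2
    have h2 : ∀ x, S 1 0 * x + S 1 1 = S 1 0 * (x - η) := fun x => by linear_combination hη
    rw [h2, h2] at h1
    push_cast
    field_simp
    refine mul_left_cancel₀ h10 ?_
    linear_combination -h1
  · have hnum : S 0 0 * η + S 0 1 = 0 := by
      have h1 := (hrel η η hfix).2
      have h2 : (1 - (μ : ℂ)) * ((S 0 0 * η + S 0 1) * (S 1 0 * η + S 1 1)) = 0 := by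
        linear_combination h1
      rcases mul_eq_zero.1 h2 with h | h
      · exact absurd (sub_eq_zero.1 h).symm hμc
      · exact (mul_eq_zero.1 h).resolve_right hη
    have h00 : S 0 0 ≠ 0 := fun h => hdet (by
      rw [h, zero_mul, zero_add] at hnum
      rw [h, hnum]
      ring)
    refine ⟨μ, S 1 0, S 1 1, hμ, hμ1, hη, fun z w hzw => ?_⟩
    have h1 := (hrel z w hzw).2
    have h2 : ∀ x, S 0 0 * x + S 0 1 = S 0 0 * (x - η) := fun x => by linear_combination hnum
    rw [h2, h2] at h1
    refine mul_left_cancel₀ h00 ?_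
    linear_combination h1

/-- Differentiating the relation at η, where every term containing a factor that vanishes there
drops out, leaves G'(Cη + D) = μ(Cη + D). -/
theorem hasDerivAt_linearFractional_of_relation {g : GL (Fin 2) ℂ} {η μ C D : ℂ}
    (hfix : g • (η : OnePoint ℂ) = (η : OnePoint ℂ)) (hη : C * η + D ≠ 0)
    (hrel : ∀ z w : ℂ, g • (z : OnePoint ℂ) = (w : OnePoint ℂ) →
      (w - η) * (C * z + D) = μ * ((z - η) * (C * w + D))) :
    HasDerivAt (linearFractional g) μ η := by
  have hden : g 1 0 * η + g 1 1 ≠ 0 := fun h => by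
    rw [OnePoint.smul_some_eq_ite, if_pos h] at hfix
    exact OnePoint.infty_ne_coe _ hfix
  have hG : ∀ z : ℂ, g 1 0 * z + g 1 1 ≠ 0 →
      g • (z : OnePoint ℂ) = (linearFractional g z : OnePoint ℂ) := fun z hz => by
    rw [OnePoint.smul_some_eq_ite, if_neg hz]
    rfl
  have hGη : linearFractional g η = η := OnePoint.coe_injective ((hG η hden).symm.trans hfix)
  have hlin : ∀ a b : ℂ, HasDerivAt (fun z : ℂ => a * z + b) a η := fun a b => by
    simpa using ((hasDerivAt_id η).const_mul a).add_const b
  obtain ⟨G', hG'⟩ : ∃ G', HasDerivAt (linearFractional g) G' η :=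
    ⟨_, (hlin (g 0 0) (g 0 1)).div (hlin (g 1 0) (g 1 1)) hden⟩
  have hev : ∀ᶠ z in 𝓝 η, (linearFractional g z - η) * (C * z + D) =
      μ * ((z - η) * (C * linearFractional g z + D)) := by
    have hc : ContinuousAt (fun z : ℂ => g 1 0 * z + g 1 1) η := (hlin _ _).continuousAt
    filter_upwards [hc.eventually_ne hden] with z hz
    exact hrel z _ (hG z hz)
  have h1 := (hG'.sub_const η).mul (hlin C D)
  have h2 := (((hasDerivAt_id η).sub_const η).mul ((hG'.const_mul C).add_const D)).const_mul μ
  have h3 := h1.unique (h2.congr_of_eventuallyEq hev)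
  simp only [hGη, id, sub_self, zero_mul, add_zero, one_mul] at h3
  have h4 : G' = μ := mul_right_cancel₀ hη h3
  exact h4 ▸ hG'

theorem exists_isHyperbolicModel {g : GL (Fin 2) ℂ} {φ : 𝔻 → 𝔻} {c : Circle} {μ : ℝ} {C D : ℂ}
    (hφ : ∀ z : 𝔻, g • ((z : ℂ) : OnePoint ℂ) = ((φ z : ℂ) : OnePoint ℂ))
    (hnonaut : ¬ Function.Bijective φ) (hnofix : ∀ z : 𝔻, φ z ≠ z) (hμ : 0 < μ) (hμ1 : μ ≠ 1)
    (hη : C * c + D ≠ 0)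
    (hrel : ∀ z w : ℂ, g • (z : OnePoint ℂ) = (w : OnePoint ℂ) →
      (w - c) * (C * z + D) = μ * ((z - c) * (C * w + D))) :
    ∃ q : ℂ, IsHyperbolicModel μ q fun z => c⁻¹ • φ (c • z) := by
  -- A zero of Cz + D in the disc would be the other fixed point of the map.
  have hden : ∀ z : 𝔻, C * z + D ≠ 0 := fun z hz => by
    have h1 := hrel z (φ z) (hφ z)
    have hzc : (z : ℂ) - c ≠ 0 := sub_ne_zero.2 fun h => by
      have := z.norm_lt_one
      rw [h, Circle.norm_coe] at this
      exact lt_irrefl _ this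
    rw [hz, mul_zero, eq_comm, mul_eq_zero, mul_eq_zero] at h1
    have h2 : C * φ z + D = 0 :=
      (h1.resolve_left (ofReal_ne_zero.2 hμ.ne')).resolve_left hzc
    have hC : C ≠ 0 := fun h => by
      rw [h, zero_mul, zero_add] at hz
      exact hη (by rw [h, hz, zero_mul, zero_add])
    exact hnofix z (UnitDisc.coe_injective (mul_left_cancel₀ hC (by linear_combination h2 - hz)))
  have hD : D ≠ 0 := by simpa using hden 0
  have hc := c.coe_ne_zero
  -- With z = cz', the coordinate (z - c)/(Cz + D) is a constant multiple of (1 - z')/(1 - qz') for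
  -- this q.
  refine ⟨-C / D * c, isHyperbolicModel_of_not_bijective hμ hμ1 ?_ ?_ ?_ fun z => ?_⟩
  · rw [norm_mul, Circle.norm_coe, mul_one]
    refine not_lt.1 fun h => ?_
    have hC : C ≠ 0 := fun h0 => by norm_num [h0] at h
    refine hden (UnitDisc.mk (-C / D)⁻¹ (by rw [norm_inv]; exact inv_lt_one_of_one_lt₀ h)) ?_
    rw [UnitDisc.coe_mk]
    field_simp
    ring
  · intro h
    rw [div_mul_eq_mul_div, div_eq_one_iff_eq hD] at h
    exact hη (by linear_combination -h)
  · exact fun h => hnonaut (by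
      have h1 := ((MulAction.bijective c).comp h).comp (MulAction.bijective c⁻¹)
      refine (funext fun z => ?_ : _ = φ) ▸ h1
      simp)
  · have h1 := hrel _ _ (hφ (c • z))
    have h2 : (φ (c • z) : ℂ) = c * (c⁻¹ • φ (c • z) : 𝔻) := by
      rw [← UnitDisc.coe_circle_smul, smul_inv_smul]
    rw [h2, UnitDisc.coe_circle_smul c z] at h1
    generalize c⁻¹ • φ (c • z) = w at h1
    field_simp
    refine mul_left_cancel₀ hc ?_
    linear_combination -h1

end

theorem theorem4p2 (g : GL (Fin 2) ℂ) (φ : 𝔻 → 𝔻)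
    (hφ : ∀ z : 𝔻, g • ((z : ℂ) : OnePoint ℂ) = ((φ z : ℂ) : OnePoint ℂ))
    (hhyp : IsHyperbolicLFT g)
    (hnonaut : ¬ Function.Bijective φ)
    (hnofix : ∀ z : 𝔻, φ z ≠ z)
    (η : ℂ) (hη : ‖η‖ = 1) (hfix : g • (η : OnePoint ℂ) = (η : OnePoint ℂ))
    (ν : ℝ) (lam : ℂ) :
    ∃ μ : ℝ, 0 < μ ∧ HasDerivAt (linearFractional g) (μ : ℂ) η ∧
      ∃ T : WeightedDirichlet ν →L[ℂ] WeightedDirichlet ν,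
        (∀ (f : WeightedDirichlet ν) (z : 𝔻), T f z = lam * f (φ z)) ∧
        (IsRecurrent T ↔ ν ≤ 1 / 2 ∧ μ ^ ((1 - 2 * ν) / 2) < ‖lam‖) ∧
        (ν = 1 / 2 → (IsRecurrent T ↔ 1 < ‖lam‖)) := by
  obtain ⟨μ, C, D, hμ, hμ1, hCD, hrel⟩ := hhyp.exists_relation hfix
  refine ⟨μ, hμ, hasDerivAt_linearFractional_of_relation hfix hCD hrel, ?_⟩
  obtain ⟨c, rfl⟩ : ∃ c : Circle, (c : ℂ) = η := ⟨⟨η, mem_sphere_zero_iff_norm.2 hη⟩, rfl⟩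
  obtain ⟨q, hmodel⟩ := exists_isHyperbolicModel hφ hnonaut hnofix hμ hμ1 hCD hrel
  obtain ⟨T₁, hT₁⟩ := WeightedDirichlet.exists_weightedComposition (ν := ν) (ν' := ν)
    (fun _ => lam) _ fun f => WeightedDirichlet.const_mul_mem lam (hmodel.isAffineModel.comp_mem f)
  obtain ⟨e, he, he'⟩ := WeightedDirichlet.exists_rotation ν c
  let T : WeightedDirichlet ν →L[ℂ] WeightedDirichlet ν :=
    (e.symm : WeightedDirichlet ν →L[ℂ] WeightedDirichlet ν) ∘L T₁ ∘L
      (e : WeightedDirichlet ν →L[ℂ] WeightedDirichlet ν)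
  have hT : ∀ f, T f = e.symm (T₁ (e f)) := fun f => rfl
  have hiff : IsRecurrent T ↔ ν ≤ 1 / 2 ∧ μ ^ ((1 - 2 * ν) / 2) < ‖lam‖ :=
    (isRecurrent_iff_of_semiconj e fun f => by rw [hT, e.apply_symm_apply]).trans
      (hmodel.isRecurrent_iff hT₁)
  refine ⟨T, fun f z => ?_, hiff, ?_⟩
  · rw [hT, he', hT₁, he, smul_inv_smul, smul_inv_smul]
  · rintro rfl
    rw [hiff]
    norm_num
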